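/- Let $X$ be an abstract simplicial complex, possibly infinite and of infinite dimension. Let $d$ denote the path metric on the vertices of a connected $X$: $d(v,w)$ is the least number of edges of a path from $v$ to $w$ in the $1$-skeleton $X^{(1)}$. The $1$-ball around a vertex $v$ is the full subcomplex of $X$ spanned by $v$ and the vertices adjacent to $v$. A loop in $X$ is a subcomplex isomorphic to a triangulation of $S^1$, and its length is its number of edges; it is full if every simplex of $X$ whose vertices all lie on the loop is a simplex of the loop. The complex $X$ is flag if every nonempty finite set of pairwise adjacent vertices spans a simplex. It is $8$-located if it is flag and every full homotopically trivial loop of length at most $8$ is contained in a $1$-ball. Here homotopy is homotopy of edge paths relative to endpoints, generated by inserting or deleting backtrackings $u\,v\,u$ and by exchanging $u\,v\,w$ with $u\,w$ when $\{u,v,w\}$ is a $2$-simplex; $X$ is simply connected if it is nonempty and connected and every closed edge path is homotopically trivial. Theorem. There is a universal constant $\delta \ge 0$ such that for every simply connected, $8$-located simplicial complex $X$, the vertex set $X^{(0)}$ with the metric $d$ is $\delta$-hyperbolic in the sense of Gromov: for all vertices $w,x,y,z$, $$(x\mid z)_w \;\ge\; \min\{(x\mid y)_w,\,(y\mid z)_w\}-\delta,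 \qquad\text{where } (a\mid b)_w=\tfrac12\bigl(d(a,w)+d(b,w)-d(a,b)\bigr).$$ -/

import Mathlib

namespace AbstractSimplicialComplex

variable {V : Type*}

open Classical in
/-- The 1-skeleton of `X`, as a simple graph on the vertices of `X`. -/
def oneSkeleton (X : AbstractSimplicialComplex V) : SimpleGraph V where
  Adj u v := u ≠ v ∧ ({u, v} : Finset V) ∈ X
  symm := ⟨fun u v h => ⟨h.1.symm, by rw [Finset.pair_comm]; exact h.2⟩⟩
  loopless := ⟨fun _ h => h.1 rfl⟩

/-- `X` is flag: every nonempty finite set of pairwise adjacent vertices spans a simplex. -/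
def IsFlag (X : AbstractSimplicialComplex V) : Prop :=
  ∀ s : Finset V, s.Nonempty →
    (∀ u ∈ s, ∀ v ∈ s, u ≠ v → X.oneSkeleton.Adj u v) → s ∈ X

/-- The vertices of the combinatorial ball of radius `r` around `v`. The ball itself is the full
subcomplex spanned by these vertices. The extended distance is used so that vertices of other
components are not in the ball. -/
def ball (X : AbstractSimplicialComplex V) (v : V) (r : ℕ) : Set V :=
  {w | X.oneSkeleton.edist v w ≤ r}

open Classical in
/-- Homotopy of edge paths of `X` relative to their endpoints: the congruence with respect to
concatenation generated by deleting a backtracking `u v u`, and by replacing two consecutive edges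
`u v w` of a 2-simplex by its third edge `u w`. -/
inductive EdgeHomotopic (X : AbstractSimplicialComplex V) :
    ∀ {u v : V}, X.oneSkeleton.Walk u v → X.oneSkeleton.Walk u v → Prop
  | refl {u v : V} (p : X.oneSkeleton.Walk u v) : EdgeHomotopic X p p
  | symm {u v : V} {p q : X.oneSkeleton.Walk u v} :
      EdgeHomotopic X p q → EdgeHomotopic X q p
  | trans {u v : V} {p q r : X.oneSkeleton.Walk u v} :
      EdgeHomotopic X p q → EdgeHomotopic X q r → EdgeHomotopic X p r
  | append {u v w : V} {p p' : X.oneSkeleton.Walk u v} {q q' : X.oneSkeleton.Walk v w} :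
      EdgeHomotopic X p p' → EdgeHomotopic X q q' →
        EdgeHomotopic X (p.append q) (p'.append q')
  | backtrack {u v : V} (h : X.oneSkeleton.Adj u v) :
      EdgeHomotopic X (.cons h (.cons h.symm .nil)) .nil
  | triangle {u v w : V} (huv : X.oneSkeleton.Adj u v) (hvw : X.oneSkeleton.Adj v w)
      (huw : X.oneSkeleton.Adj u w) (hs : ({u, v, w} : Finset V) ∈ X) :
      EdgeHomotopic X (.cons huv (.cons hvw .nil)) (.cons huw .nil)

/-- A closed edge path is homotopically trivial if it is homotopic to the constant path. -/
def IsHomotopicallyTrivial (X : AbstractSimplicialComplex V) {u : V}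
    (p : X.oneSkeleton.Walk u u) : Prop :=
  X.EdgeHomotopic p .nil

/-- `X` is simply connected: it is nonempty and connected, and every closed edge path is
homotopically trivial. -/
def IsSimplyConnected (X : AbstractSimplicialComplex V) : Prop :=
  X.oneSkeleton.Connected ∧
    ∀ (u : V) (p : X.oneSkeleton.Walk u u), X.IsHomotopicallyTrivial p

/-- The closed walk `p` is a full loop of `X`: it runs once around a cycle, and every simplex of
`X` whose vertices lie on this cycle is a vertex or an edge of the cycle. (In particular the
boundary of a 2-simplex is not full.) -/
def IsFullLoop (X : AbstractSimplicialComplex V) {u : V} (p : X.oneSkeleton.Walk u u) : Prop :=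
  p.IsCycle ∧
    ∀ s ∈ X, (∀ x ∈ s, x ∈ p.support) →
      (∃ v, s = {v}) ∨ ∃ e ∈ p.edges, ∀ x, x ∈ s ↔ x ∈ e

/-- `X` is `m`-located: it is flag, and every full homotopically trivial loop of length at most
`m` is contained in a ball of radius 1. -/
def IsLocated (X : AbstractSimplicialComplex V) (m : ℕ) : Prop :=
  X.IsFlag ∧
    ∀ (u : V) (p : X.oneSkeleton.Walk u u),
      X.IsFullLoop p → X.IsHomotopicallyTrivial p → p.length ≤ m →
        ∃ v, ∀ x ∈ p.support, x ∈ X.ball v 1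

/-- The path metric on the vertices of `X`: the number of edges of a shortest path in the
1-skeleton (for `X` connected). -/
noncomputable def vertexDist (X : AbstractSimplicialComplex V) (v w : V) : ℝ :=
  (X.oneSkeleton.dist v w : ℝ)

end AbstractSimplicialComplex

/-- The Gromov product of `x` and `y` with respect to the base point `w`. -/
noncomputable def gromovProduct {V : Type*} (d : V → V → ℝ) (w x y : V) : ℝ :=
  (d x w + d y w - d x y) / 2

/-- The metric `d` is `δ`-hyperbolic in the sense of Gromov. -/
def IsGromovHyperbolic {V : Type*} (d : V → V → ℝ) (δ : ℝ) : Prop :=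
  ∀ w x y z : V,
    min (gromovProduct d w x y) (gromovProduct d w y z) - δ ≤ gromovProduct d w x z

/-! The proof passes from local data to global geometry. In the 1-skeleton of a simply connected
8-located complex every induced cycle of length 4 to 8 has a cone vertex (`isConed_oneSkeleton`).
All later arguments exhibit such a cycle and use its cone vertex.

Level the vertices by the distance to a base vertex. The edge condition and the vertex condition
describe how consecutive spheres fit together. They are proved while a covering of the graph is
built ball by ball: each vertex on the outer sphere receives its missing neighbours, and two copies
of a missing neighbour `z` are identified when their carriers are connected through carriers of `z`.
The two conditions inside a ball keep the cycles to be coned at length at most 8, and the cones give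
the two conditions in the next ball (`IsStage.extend`). In the union, walks lift uniquely and
homotopically invariantly, so simple connectivity makes the projection injective and the levels are
distances (`edgeCond_and_vertCond`).

A cycle running through four levels cannot be coned, since adjacent vertices differ by at most one
level. Playing this against the two conditions gives `exists_near_dn₂`: vertices three levels below
a near pair are two levels below another near pair, one level further down. Hence geodesics from any
base vertex to near, equally distant vertices stay within distance 5 (`dist_le_five`); in particular
bigons are uniformly thin.

Thin bigons imply hyperbolicity. Parallel geodesics at bounded distance come within 10 of each other
after a bounded time (`exists_dist_le_ten`). Therefore geodesics to `O` from the ends of a path of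
length `2 ^ k` come close after a number of steps linear in `k` (`dist_le_of_pow`), so detours are
exponentially expensive and geodesics to `O` are close below the level of the Gromov product
(`dist_le_of_gromovProduct`). No constant depends on the complex. -/

namespace SimpleGraph

/-! ### Induced paths, induced cycles and cone vertices. -/

variable {V : Type*}

/-- Two vertices are near if they are equal or adjacent. -/
def Near (G : SimpleGraph V) (a b : V) : Prop := a = b ∨ G.Adj a b

/-- The first `k + 1` values of `c` form an induced path. -/
structure IsIndPath (G : SimpleGraph V) (k : ℕ) (c : ℕ → V) : Prop where
  adj : ∀ i, i < k → G.Adj (c i) (c (i + 1))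
  far : ∀ i j, i + 1 < j → j ≤ k → ¬ G.Near (c i) (c j)

/-- Every induced cycle of length between 4 and 8 has a vertex adjacent to all its vertices. -/
def IsConed (G : SimpleGraph V) : Prop :=
  -- The cycle is `a, c 0, …, c k`, of length `k + 2`.
  ∀ (k : ℕ) (c : ℕ → V) (a : V), 2 ≤ k → k ≤ 6 → G.IsIndPath k c →
    G.Adj a (c 0) → G.Adj a (c k) → (∀ i, 0 < i → i < k → ¬ G.Near a (c i)) →
    ∃ y, G.Adj y a ∧ ∀ i, i ≤ k → G.Adj y (c i)

variable {G : SimpleGraph V}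

theorem Near.symm {a b : V} (h : G.Near a b) : G.Near b a :=
  h.imp Eq.symm SimpleGraph.Adj.symm

theorem Near.refl (a : V) : G.Near a a := Or.inl rfl

theorem Adj.near {a b : V} (h : G.Adj a b) : G.Near a b := Or.inr h

theorem Near.adj {a b : V} (h : G.Near a b) (hne : a ≠ b) : G.Adj a b := h.resolve_left hne

namespace IsConed

variable (hG : G.IsConed) {a b c d e f g h : V}
include hG

theorem cone5 (ab : G.Adj a b) (bc : G.Adj b c) (cd : G.Adj c d) (de : G.Adj d e)
    (ea : G.Adj e a) (ac : ¬ G.Near a c) (ad : ¬ G.Near a d) (bd : ¬ G.Near b d)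
    (be : ¬ G.Near b e) (ce : ¬ G.Near c e) :
    ∃ y, G.Adj y a ∧ G.Adj y b ∧ G.Adj y c ∧ G.Adj y d ∧ G.Adj y e := by
  obtain ⟨y, ya, hy⟩ := hG 3 (fun i => [b, c, d, e].getD i b) a (by norm_num) (by norm_num)
    ⟨by intro i hi; interval_cases i <;> simpa,
      by
        intro i j hi hj
        have hij : i < j := by omega
        interval_cases j <;> interval_cases i <;> first | omega | simpa⟩
    (by simpa) (by simpa using ea.symm) (by intro i h0 h1; interval_cases i <;> simpa)
  exact ⟨y, ya, hy 0 (by norm_num), hy 1 (by norm_num), hy 2 (by norm_num), hy 3 (by norm_num)⟩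

theorem cone6 (ab : G.Adj a b) (bc : G.Adj b c) (cd : G.Adj c d) (de : G.Adj d e)
    (ef : G.Adj e f) (fa : G.Adj f a) (ac : ¬ G.Near a c) (ad : ¬ G.Near a d)
    (ae : ¬ G.Near a e) (bd : ¬ G.Near b d) (be : ¬ G.Near b e) (bf : ¬ G.Near b f)
    (ce : ¬ G.Near c e) (cf : ¬ G.Near c f) (df : ¬ G.Near d f) :
    ∃ y, G.Adj y a ∧ G.Adj y b ∧ G.Adj y c ∧ G.Adj y d ∧ G.Adj y e ∧ G.Adj y f := by
  obtain ⟨y, ya, hy⟩ := hG 4 (fun i => [b, c, d, e, f].getD i b) a (by norm_num) (by norm_num)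
    ⟨by intro i hi; interval_cases i <;> simpa,
      by
        intro i j hi hj
        have hij : i < j := by omega
        interval_cases j <;> interval_cases i <;> first | omega | simpa⟩
    (by simpa) (by simpa using fa.symm) (by intro i h0 h1; interval_cases i <;> simpa)
  exact ⟨y, ya, hy 0 (by norm_num), hy 1 (by norm_num), hy 2 (by norm_num), hy 3 (by norm_num),
    hy 4 (by norm_num)⟩

theorem cone7 (ab : G.Adj a b) (bc : G.Adj b c) (cd : G.Adj c d) (de : G.Adj d e)
    (ef : G.Adj e f) (fg : G.Adj f g) (ga : G.Adj g a) (ac : ¬ G.Near a c) (ad : ¬ G.Near a d)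
    (ae : ¬ G.Near a e) (af : ¬ G.Near a f) (bd : ¬ G.Near b d) (be : ¬ G.Near b e)
    (bf : ¬ G.Near b f) (bg : ¬ G.Near b g) (ce : ¬ G.Near c e) (cf : ¬ G.Near c f)
    (cg : ¬ G.Near c g) (df : ¬ G.Near d f) (dg : ¬ G.Near d g) (eg : ¬ G.Near e g) :
    ∃ y, G.Adj y a ∧ G.Adj y b ∧ G.Adj y c ∧ G.Adj y d ∧ G.Adj y e ∧ G.Adj y f ∧ G.Adj y g := by
  obtain ⟨y, ya, hy⟩ := hG 5 (fun i => [b, c, d, e, f, g].getD i b) a (by norm_num) (by norm_num)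
    ⟨by intro i hi; interval_cases i <;> simpa,
      by
        intro i j hi hj
        have hij : i < j := by omega
        interval_cases j <;> interval_cases i <;> first | omega | simpa⟩
    (by simpa) (by simpa using ga.symm) (by intro i h0 h1; interval_cases i <;> simpa)
  exact ⟨y, ya, hy 0 (by norm_num), hy 1 (by norm_num), hy 2 (by norm_num), hy 3 (by norm_num),
    hy 4 (by norm_num), hy 5 (by norm_num)⟩

theorem cone8 (ab : G.Adj a b) (bc : G.Adj b c) (cd : G.Adj c d) (de : G.Adj d e)
    (ef : G.Adj e f) (fg : G.Adj f g) (gh : G.Adj g h) (ha : G.Adj h a)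
    (ac : ¬ G.Near a c) (ad : ¬ G.Near a d) (ae : ¬ G.Near a e) (af : ¬ G.Near a f)
    (ag : ¬ G.Near a g) (bd : ¬ G.Near b d) (be : ¬ G.Near b e) (bf : ¬ G.Near b f)
    (bg : ¬ G.Near b g) (bh : ¬ G.Near b h) (ce : ¬ G.Near c e) (cf : ¬ G.Near c f)
    (cg : ¬ G.Near c g) (ch : ¬ G.Near c h) (df : ¬ G.Near d f) (dg : ¬ G.Near d g)
    (dh : ¬ G.Near d h) (eg : ¬ G.Near e g) (eh : ¬ G.Near e h) (fh : ¬ G.Near f h) :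
    ∃ y, G.Adj y a ∧ G.Adj y b ∧ G.Adj y c ∧ G.Adj y d ∧ G.Adj y e ∧ G.Adj y f ∧ G.Adj y g ∧
      G.Adj y h := by
  obtain ⟨y, ya, hy⟩ := hG 6 (fun i => [b, c, d, e, f, g, h].getD i b) a (by norm_num) le_rfl
    ⟨by intro i hi; interval_cases i <;> simpa,
      by
        intro i j hi hj
        have hij : i < j := by omega
        interval_cases j <;> interval_cases i <;> first | omega | simpa⟩
    (by simpa) (by simpa using ha.symm) (by intro i h0 h1; interval_cases i <;> simpa)
  exact ⟨y, ya, hy 0 (by norm_num), hy 1 (by norm_num), hy 2 (by norm_num), hy 3 (by norm_num),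
    hy 4 (by norm_num), hy 5 (by norm_num), hy 6 (by norm_num)⟩

end IsConed

theorem exists_walk_of_adj (c : ℕ → V) (k : ℕ) (hc : ∀ i, i < k → G.Adj (c i) (c (i + 1))) :
    ∃ p : G.Walk (c 0) (c k), p.length = k ∧ (∀ x, x ∈ p.support ↔ ∃ i, i ≤ k ∧ x = c i) ∧
      ∀ e, e ∈ p.edges ↔ ∃ i, i < k ∧ e = s(c i, c (i + 1)) := by
  induction k with
  | zero => exact ⟨.nil, rfl, by simp, by simp⟩
  | succ k ih =>
    obtain ⟨p, h1, h2, h3⟩ := ih fun i hi => hc i (by omega)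
    refine ⟨p.concat (hc k (by omega)), by simp [h1], fun x => ?_, fun e => ?_⟩
    · rw [Walk.support_concat]
      simp only [List.mem_append, h2, List.mem_singleton]
      constructor
      · rintro (⟨i, hi, rfl⟩ | rfl)
        · exact ⟨i, by omega, rfl⟩
        · exact ⟨k + 1, le_rfl, rfl⟩
      · rintro ⟨i, hi, rfl⟩
        rcases Nat.lt_or_ge i (k + 1) with h | h
        · exact Or.inl ⟨i, by omega, rfl⟩
        · exact Or.inr (by rw [show i = k + 1 by omega])
    · rw [Walk.edges_concat]
      simp only [List.concat_eq_append, List.mem_append, h3, List.mem_singleton]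
      constructor
      · rintro (⟨i, hi, rfl⟩ | rfl)
        · exact ⟨i, by omega, rfl⟩
        · exact ⟨k, by omega, rfl⟩
      · rintro ⟨i, hi, rfl⟩
        rcases Nat.lt_or_ge i k with h | h
        · exact Or.inl ⟨i, by omega, rfl⟩
        · exact Or.inr (by rw [show i = k by omega])

theorem IsIndPath.injOn {k : ℕ} {c : ℕ → V} (hc : G.IsIndPath k c) {i j : ℕ} (hi : i ≤ k)
    (hj : j ≤ k) (h : c i = c j) : i = j := by
  rcases lt_trichotomy i j with hij | hij | hij
  · rcases Nat.lt_or_ge (i + 1) j with h' | h'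
    · exact absurd (Or.inl h) (hc.far i j h' hj)
    · obtain rfl : j = i + 1 := by omega
      exact absurd h (hc.adj i (by omega)).ne
  · exact hij
  · rcases Nat.lt_or_ge (j + 1) i with h' | h'
    · exact absurd (Or.inl h.symm) (hc.far j i h' hi)
    · obtain rfl : i = j + 1 := by omega
      exact absurd h.symm (hc.adj j (by omega)).ne

theorem IsIndPath.isPath {k : ℕ} {c : ℕ → V} (hc : G.IsIndPath k c)
    {p : G.Walk (c 0) (c k)} (h1 : p.length = k)
    (h2 : ∀ x, x ∈ p.support ↔ ∃ i, i ≤ k ∧ x = c i) : p.IsPath := by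
  classical
  rw [Walk.isPath_def]
  have hs : p.support.toFinset = (Finset.range (k + 1)).image c := by
    ext x
    simp only [List.mem_toFinset, h2, Finset.mem_image, Finset.mem_range]
    exact ⟨fun ⟨i, hi, h⟩ => ⟨i, by omega, h.symm⟩, fun ⟨i, hi, h⟩ => ⟨i, by omega, h.symm⟩⟩
  have hcard : p.support.toFinset.card = p.support.length := by
    rw [hs, Finset.card_image_of_injOn, Walk.length_support, h1, Finset.card_range]
    intro i hi j hj h
    simp only [Finset.coe_range, Set.mem_Iio] at hi hj
    exact hc.injOn (by omega) (by omega) h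
  exact Multiset.toFinset_card_eq_card_iff_nodup.mp hcard

end SimpleGraph

/-! ### From located complexes to coned graphs. -/

namespace AbstractSimplicialComplex

open SimpleGraph

variable {V : Type*} {X : AbstractSimplicialComplex V}

theorem adj_of_mem_mem {s : Finset V} (hs : s ∈ X) {x y : V} (hx : x ∈ s) (hy : y ∈ s)
    (hne : x ≠ y) : X.oneSkeleton.Adj x y := by
  classical
  refine ⟨hne, ?_⟩
  have h := (X.isRelLowerSet_faces hs).2
  have h' : ({x, y} : Finset V) ∈ X.faces :=
    h (Finset.insert_subset hx (Finset.singleton_subset_iff.mpr hy)) ⟨x, by simp⟩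
  exact h'

/-- An induced cycle of length at least 4 is a full loop, because pairwise adjacent vertices on it
number at most two. The centre of the ball containing it is off the cycle, since every cycle vertex
has a non-neighbour on the cycle; so the centre is adjacent to all of it. -/
theorem isConed_oneSkeleton (hsc : X.IsSimplyConnected) (hloc : X.IsLocated 8) :
    X.oneSkeleton.IsConed := by
  classical
  intro k c a hk2 hk6 hc ha0 hak hfar
  obtain ⟨p, hlen, hsup, hedge⟩ := exists_walk_of_adj c k hc.adj
  have hpath := hc.isPath hlen hsup
  have hmem : ∀ i, i ≤ k → c i ∈ p.support := fun i hi => (hsup _).mpr ⟨i, hi, rfl⟩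
  have hane : ∀ i, i ≤ k → a ≠ c i := by
    intro i hi h
    rcases Nat.eq_zero_or_pos i with rfl | h0
    · exact ha0.ne h
    rcases Nat.lt_or_ge i k with h1 | h1
    · exact hfar i h0 h1 (Or.inl h)
    · obtain rfl : i = k := by omega
      exact hak.ne h
  have hanot : a ∉ p.support := by
    intro h
    obtain ⟨i, hi, h⟩ := (hsup _).mp h
    exact hane i hi h
  have haadj : ∀ i, i ≤ k → X.oneSkeleton.Adj a (c i) → i = 0 ∨ i = k := by
    intro i hi h
    by_contra hne
    exact hfar i (by omega) (by omega) (Or.inr h)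
  have hcadj : ∀ i j, i ≤ k → j ≤ k → X.oneSkeleton.Adj (c i) (c j) → j = i + 1 ∨ i = j + 1 := by
    intro i j hi hj h
    by_contra hne
    have : i ≠ j := fun h' => h.ne (by rw [h'])
    rcases Nat.lt_or_ge i j with h' | h'
    · exact hc.far i j (by omega) hj (Or.inr h)
    · exact hc.far j i (by omega) hi (Or.inr h.symm)
  let q := Walk.cons ha0 (p.concat hak.symm)
  have hqsup : ∀ x, x ∈ q.support ↔ x = a ∨ ∃ i, i ≤ k ∧ x = c i := by
    intro x
    simp only [q, Walk.support_cons, Walk.support_concat, List.mem_cons,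
      List.mem_append, hsup, List.not_mem_nil, or_false]
    exact ⟨fun h => h.elim Or.inl fun h => h.elim Or.inr Or.inl, fun h => h.imp id Or.inl⟩
  have hqedge : ∀ e, e ∈ q.edges ↔
      e = s(a, c 0) ∨ (∃ i, i < k ∧ e = s(c i, c (i + 1))) ∨ e = s(c k, a) := by
    intro e
    simp [q, hedge, Walk.edges_concat]
  have hcyc : q.IsCycle := by
    rw [Walk.cons_isCycle_iff]
    refine ⟨(Walk.concat_isPath_iff _).mpr ⟨hpath, hanot⟩, ?_⟩
    rw [Walk.edges_concat]
    simp only [List.concat_eq_append, List.mem_append, hedge, List.mem_singleton, not_or,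
      not_exists, not_and]
    refine ⟨fun i hi h => ?_, fun h => ?_⟩
    · rcases Sym2.eq_iff.mp h with ⟨h, -⟩ | ⟨h, -⟩
      · exact hane i (by omega) h
      · exact hane (i + 1) (by omega) h
    · rcases Sym2.eq_iff.mp h with ⟨h, -⟩ | ⟨-, h⟩
      · exact hane k le_rfl h
      · have := hc.injOn (Nat.zero_le _) le_rfl h
        omega
  have hfull : X.IsFullLoop q := by
    refine ⟨hcyc, fun s hs hsq => ?_⟩
    obtain ⟨x, hx⟩ := (X.isRelLowerSet_faces hs).1
    by_cases hone : ∀ y ∈ s, y = x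
    · exact Or.inl ⟨x, Finset.eq_singleton_iff_unique_mem.mpr ⟨hx, hone⟩⟩
    push Not at hone
    obtain ⟨y, hy, hyx⟩ := hone
    have hadj : ∀ u ∈ s, ∀ v ∈ s, u ≠ v → X.oneSkeleton.Adj u v := fun u hu v hv huv =>
      adj_of_mem_mem hs hu hv huv
    have hon : ∀ u ∈ s, u = a ∨ ∃ i, i ≤ k ∧ u = c i := fun u hu => (hqsup u).mp (hsq u hu)
    right
    by_cases has : a ∈ s
    · obtain ⟨y, hy, hya⟩ : ∃ y ∈ s, y ≠ a := by
        by_cases hxa : x = a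
        · exact ⟨y, hy, hxa ▸ hyx⟩
        · exact ⟨x, hx, hxa⟩
      obtain ⟨i, hi, rfl⟩ := (hon y hy).resolve_left hya
      have hi' := haadj i hi (hadj a has _ hy hya.symm)
      refine ⟨s(a, c i), (hqedge _).mpr ?_, fun z => ?_⟩
      · rcases hi' with rfl | rfl
        · exact Or.inl rfl
        · exact Or.inr (Or.inr Sym2.eq_swap)
      · rw [Sym2.mem_iff]
        refine ⟨fun hz => ?_, ?_⟩
        · by_contra hne
          push Not at hne
          obtain ⟨j, hj, rfl⟩ := (hon z hz).resolve_left hne.1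
          have hj' := haadj j hj (hadj a has _ hz hne.1.symm)
          have hij := hcadj i j hi hj (hadj _ hy _ hz hne.2.symm)
          omega
        · rintro (rfl | rfl) <;> assumption
    · have hon' : ∀ u ∈ s, ∃ i, i ≤ k ∧ u = c i := fun u hu =>
        (hon u hu).resolve_left fun h => has (h ▸ hu)
      obtain ⟨i, hi, rfl⟩ := hon' x hx
      obtain ⟨j, hj, rfl⟩ := hon' y hy
      have hij := hcadj i j hi hj (hadj _ hx _ hy hyx.symm)
      refine ⟨s(c i, c j), (hqedge _).mpr (Or.inr (Or.inl ?_)), fun z => ?_⟩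
      · rcases hij with rfl | rfl
        · exact ⟨i, by omega, rfl⟩
        · exact ⟨j, by omega, Sym2.eq_swap⟩
      · rw [Sym2.mem_iff]
        refine ⟨fun hz => ?_, ?_⟩
        · by_contra hne
          push Not at hne
          obtain ⟨l, hl, rfl⟩ := hon' z hz
          have h1 := hcadj i l hi hl (hadj _ hx _ hz hne.1.symm)
          have h2 := hcadj j l hj hl (hadj _ hy _ hz hne.2.symm)
          omega
        · rintro (rfl | rfl) <;> assumption
  obtain ⟨v, hv⟩ := hloc.2 a q hfull (hsc.2 a q) (by simp [q, hlen]; omega)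
  have hnear : ∀ x ∈ q.support, v = x ∨ X.oneSkeleton.Adj v x := by
    intro x hx
    have h := hv x hx
    simp only [ball, Set.mem_ofPred_eq, Nat.cast_one] at h
    by_cases hvx : v = x
    · exact Or.inl hvx
    · refine Or.inr (edist_eq_one_iff_adj.mp (le_antisymm h ?_))
      exact Order.one_le_iff_pos.mpr (edist_pos_of_ne hvx)
  have hna : X.oneSkeleton.Near v a := hnear a ((hqsup a).mpr (Or.inl rfl))
  have hnc : ∀ i, i ≤ k → X.oneSkeleton.Near v (c i) := fun i hi =>
    hnear _ ((hqsup _).mpr (Or.inr ⟨i, hi, rfl⟩))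
  have hva : v ≠ a := by
    rintro rfl
    exact hfar 1 (by omega) (by omega) (hnc 1 (by omega))
  have hvc : ∀ i, i ≤ k → v ≠ c i := by
    rintro i hi rfl
    rcases Nat.lt_or_ge (i + 1) k with h | h
    · exact hc.far i k h le_rfl (hnc k le_rfl)
    · rcases Nat.lt_or_ge 1 i with h' | h'
      · exact hc.far 0 i (by omega) hi (hnc 0 (by omega)).symm
      · exact hfar i (by omega) (by omega) hna.symm
  exact ⟨v, hna.adj hva, fun i hi => (hnc i hi).adj (hvc i hi)⟩

end AbstractSimplicialComplex

/-! ### Levels, chains and the shortening of walks. -/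

namespace SimpleGraph

variable {V T : Type*}

/-- `r` is a neighbour of `a` whose level is one less. -/
def Dn (H : SimpleGraph T) (lv : T → ℕ) (a r : T) : Prop := H.Adj a r ∧ lv a = lv r + 1

/-- The vertices `a` and `b` are adjacent and have a common neighbour one level below. -/
def Strong (H : SimpleGraph T) (lv : T → ℕ) (a b : T) : Prop :=
  H.Adj a b ∧ ∃ r, H.Dn lv a r ∧ H.Dn lv b r

/-- The ends of a horizontal edge have equal or adjacent neighbours one level below. -/
def EdgeCond (H : SimpleGraph T) (lv : T → ℕ) : Prop :=
  ∀ x y, H.Adj x y → lv x = lv y → ∃ r s, H.Dn lv x r ∧ H.Dn lv y s ∧ H.Near r s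

/-- Two lower neighbours of a vertex are near each other, or joined by two strong edges among the
lower neighbours of this vertex. -/
def VertCond (H : SimpleGraph T) (lv : T → ℕ) : Prop :=
  ∀ v u w, H.Dn lv v u → H.Dn lv v w →
    H.Near u w ∨ ∃ x, H.Dn lv v x ∧ H.Strong lv u x ∧ H.Strong lv x w

/-- The vertices `a` and `b` are joined by a walk in `S` of length at most `m`. -/
inductive Chain (H : SimpleGraph T) (S : Set T) : ℕ → T → T → Prop
  | nil {m : ℕ} {a : T} : a ∈ S → Chain H S m a a
  | cons {m : ℕ} {a b c : T} : a ∈ S → H.Adj a b → Chain H S m b c → Chain H S (m + 1) a c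

namespace Chain

variable {H : SimpleGraph T} {S : Set T}

theorem mem_left {m : ℕ} {a b : T} (h : H.Chain S m a b) : a ∈ S := by
  cases h <;> assumption

theorem mono {m m' : ℕ} {a b : T} (h : H.Chain S m a b) (hm : m ≤ m') : H.Chain S m' a b := by
  induction h generalizing m' with
  | nil h => exact .nil h
  | cons ha hab _ ih =>
    obtain ⟨k, rfl⟩ : ∃ k, m' = k + 1 := ⟨m' - 1, by omega⟩
    exact .cons ha hab (ih (by omega))

theorem trans {m m' : ℕ} {a b c : T} (h : H.Chain S m a b) (h' : H.Chain S m' b c) :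
    H.Chain S (m + m') a c := by
  induction h with
  | nil _ => exact h'.mono (by omega)
  | cons ha hab _ ih => exact (Chain.cons ha hab (ih h')).mono (by omega)

theorem of_near {a b : T} (ha : a ∈ S) (hb : b ∈ S) (h : H.Near a b) : H.Chain S 1 a b := by
  rcases h with rfl | h
  · exact .nil ha
  · exact .cons ha h (.nil hb)

theorem symm {m : ℕ} {a b : T} (h : H.Chain S m a b) : H.Chain S m b a := by
  induction h with
  | nil h => exact .nil h
  | cons ha hab h ih =>
    exact ih.trans (of_near h.mem_left ha (Or.inr hab.symm))

theorem exists_walk {m : ℕ} {a b : T} (h : H.Chain S m a b) :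
    ∃ k, k ≤ m ∧ ∃ y : ℕ → T, y 0 = a ∧ y k = b ∧ (∀ i, i < k → H.Adj (y i) (y (i + 1))) ∧
      ∀ i, i ≤ k → y i ∈ S := by
  induction h with
  | @nil m a h => exact ⟨0, by omega, fun _ => a, rfl, rfl, by omega, fun _ _ => h⟩
  | @cons m a b c ha hab _ ih =>
    obtain ⟨k, hk, y, h0, h1, h2, h3⟩ := ih
    refine ⟨k + 1, by omega, fun i => Nat.casesOn i a y, rfl, h1, ?_, ?_⟩
    · rintro (_ | i) hi
      · change H.Adj a (y 0)
        rwa [h0]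
      · exact h2 i (by omega)
    · rintro (_ | i) hi
      · exact ha
      · exact h3 i (by omega)

theorem exists_walk_between {m : ℕ} {r s a b : T} (h : H.Chain S m r s) (ha : H.Adj a r)
    (hb : H.Adj s b) :
    ∃ k, k ≤ m + 2 ∧ ∃ y : ℕ → T, y 0 = a ∧ y k = b ∧ (∀ i, i < k → H.Adj (y i) (y (i + 1))) ∧
      ∀ i, 0 < i → i < k → y i ∈ S := by
  obtain ⟨k, hk, y, h0, h1, h2, h3⟩ := h.exists_walk
  refine ⟨k + 2, by omega, fun i => Nat.casesOn i a fun j => if j ≤ k then y j else b,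
    rfl, by simp, ?_, ?_⟩
  · rintro (_ | i) hi
    · simpa [h0] using ha
    · rcases Nat.lt_or_ge i k with h | h
      · simpa [h.le, Nat.succ_le_of_lt h] using h2 i h
      · obtain rfl : i = k := by omega
        simpa [h1] using hb
  · rintro (_ | i) h hi
    · omega
    · have : i ≤ k := by omega
      simpa [this] using h3 i this

end Chain

section Shorten

variable {H : SimpleGraph T}

/-- A repetition or a chord lets a piece of the walk be cut out. The ends stay fixed and inner
vertices remain among the old inner vertices. -/
theorem exists_isIndPath {S : Set T} {k : ℕ} {y : ℕ → T}
    (hadj : ∀ i, i < k → H.Adj (y i) (y (i + 1))) (hS : ∀ i, 0 < i → i < k → y i ∈ S) :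
    ∃ j, j ≤ k ∧ ∃ c : ℕ → T, c 0 = y 0 ∧ c j = y k ∧ H.IsIndPath j c ∧
      ∀ i, 0 < i → i < j → c i ∈ S := by
  induction k using Nat.strong_induction_on generalizing y with
  | _ k ih =>
  by_cases hind : ∀ i j, i + 1 < j → j ≤ k → ¬ H.Near (y i) (y j)
  · exact ⟨k, le_rfl, y, rfl, rfl, ⟨hadj, hind⟩, hS⟩
  push Not at hind
  obtain ⟨i, j, hij, hjk, hn⟩ := hind
  rcases hn with hn | hn
  · obtain ⟨l, hl, c, h0, h1, h2, h3⟩ := ih (k - (j - i)) (by omega)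
      (y := fun t => if t ≤ i then y t else y (t + (j - i))) (by
        intro t ht
        rcases lt_trichotomy t i with h | h | h
        · simpa [h.le, Nat.succ_le_of_lt h] using hadj t (by omega)
        · subst h
          have := hadj j (by omega)
          rw [← hn] at this
          simpa [show t + 1 + (j - t) = j + 1 by omega] using this
        · have := hadj (t + (j - i)) (by omega)
          simpa [show ¬ t ≤ i by omega, show ¬ t + 1 ≤ i by omega,
            show t + 1 + (j - i) = t + (j - i) + 1 by omega] using this) (by
        intro t h0 ht
        split_ifs with h
        · exact hS t h0 (by omega)
        · exact hS _ (by omega) (by omega))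
    refine ⟨l, by omega, c, by simpa using h0, ?_, h2, h3⟩
    rw [h1]
    split_ifs with h
    · rw [show k - (j - i) = i by omega, hn, show j = k by omega]
    · rw [show k - (j - i) + (j - i) = k by omega]
  · obtain ⟨l, hl, c, h0, h1, h2, h3⟩ := ih (k - (j - i - 1)) (by omega)
      (y := fun t => if t ≤ i then y t else y (t + (j - i - 1))) (by
        intro t ht
        rcases lt_trichotomy t i with h | h | h
        · simpa [h.le, Nat.succ_le_of_lt h] using hadj t (by omega)
        · subst h
          simpa [show t + 1 + (j - t - 1) = j by omega] using hn
        · have := hadj (t + (j - i - 1)) (by omega)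
          simpa [show ¬ t ≤ i by omega, show ¬ t + 1 ≤ i by omega,
            show t + 1 + (j - i - 1) = t + (j - i - 1) + 1 by omega] using this) (by
        intro t h0 ht
        split_ifs with h
        · exact hS t h0 (by omega)
        · exact hS _ (by omega) (by omega))
    refine ⟨l, by omega, c, by simpa using h0, ?_, h2, h3⟩
    rw [h1]
    rw [if_neg (by omega), show k - (j - i - 1) + (j - i - 1) = k by omega]

theorem IsIndPath.shift {k : ℕ} {c : ℕ → T} (h : H.IsIndPath k c) (i l : ℕ) (hl : i + l ≤ k) :
    H.IsIndPath l fun t => c (i + t) :=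
  ⟨fun t ht => h.adj (i + t) (by omega), fun s t hs ht => h.far _ _ (by omega) (by omega)⟩

theorem IsIndPath.initial {k : ℕ} {c : ℕ → T} (h : H.IsIndPath k c) (l : ℕ) (hl : l ≤ k) :
    H.IsIndPath l c :=
  ⟨fun t ht => h.adj t (by omega), fun s t hs ht => h.far _ _ (by omega) (by omega)⟩

theorem IsIndPath.reverse {k : ℕ} {c : ℕ → T} (h : H.IsIndPath k c) :
    H.IsIndPath k fun t => c (k - t) := by
  refine ⟨fun t ht => ?_, fun s t hs ht hn => h.far (k - t) (k - s) (by omega) (by omega) hn.symm⟩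
  have := (h.adj (k - (t + 1)) (by omega)).symm
  rwa [show k - (t + 1) + 1 = k - t by omega] at this

end Shorten

/-! ### Finite stages of the covering and short-range injectivity. -/

/-- A finite stage of the construction of a covering of `G`: a graph `H` on the vertices `B`, all
of level at most `n`, with a projection `f` to `G` which is an isomorphism of the neighbourhoods of
vertices of level less than `n`, and injective and full on the other neighbourhoods. -/
structure IsStage (G : SimpleGraph V) (f : T → V) (lv : T → ℕ) (n : ℕ) (H : SimpleGraph T)
    (B : Set T) : Prop where
  lv_le : ∀ x ∈ B, lv x ≤ n
  mem : ∀ x y, H.Adj x y → x ∈ B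
  hom : ∀ x y, H.Adj x y → G.Adj (f x) (f y)
  lv_adj : ∀ x y, H.Adj x y → lv x ≤ lv y + 1
  inj : ∀ x y y', H.Adj x y → H.Adj x y' → f y = f y' → y = y'
  full : ∀ x y y', H.Adj x y → H.Adj x y' → G.Adj (f y) (f y') → H.Adj y y'
  surj : ∀ x ∈ B, lv x < n → ∀ z, G.Adj (f x) z → ∃ y, H.Adj x y ∧ f y = z
  down : ∀ x ∈ B, lv x ≠ 0 → ∃ y, H.Dn lv x y
  zero : ∀ x ∈ B, ∀ y ∈ B, lv x = 0 → lv y = 0 → x = y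
  edge : H.EdgeCond lv
  vert : H.VertCond lv

/-- The neighbour `z` of `f x` does not lift to a neighbour of the vertex `x` of level `n`. -/
def Open (G : SimpleGraph V) (f : T → V) (lv : T → ℕ) (n : ℕ) (H : SimpleGraph T) (B : Set T)
    (x : T) (z : V) : Prop :=
  x ∈ B ∧ lv x = n ∧ G.Adj (f x) z ∧ ∀ y, H.Adj x y → f y ≠ z

/-- The relation on vertices with the missing neighbour `z` generated by adjacency. -/
def OpenEqv (G : SimpleGraph V) (f : T → V) (lv : T → ℕ) (n : ℕ) (H : SimpleGraph T) (B : Set T)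
    (z : V) : T → T → Prop :=
  Relation.ReflTransGen fun a b => G.Open f lv n H B a z ∧ G.Open f lv n H B b z ∧ H.Adj a b

namespace IsStage

variable {G : SimpleGraph V} {f : T → V} {lv : T → ℕ} {n : ℕ} {H : SimpleGraph T} {B : Set T}

section Basic

variable (st : IsStage G f lv n H B)
include st

theorem mem' {x y : T} (h : H.Adj x y) : y ∈ B := st.mem y x h.symm

/-- A lift of a cone vertex of a walk which is adjacent to one vertex of the walk is adjacent to
all of them. -/
theorem adj_of_cone {k : ℕ} {c : ℕ → T} (hc : ∀ i, i < k → H.Adj (c i) (c (i + 1))) {y : T}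
    (hy : ∀ i, i ≤ k → G.Adj (f y) (f (c i))) {i₀ : ℕ} (hi₀ : i₀ ≤ k) (h₀ : H.Adj (c i₀) y) :
    ∀ i, i ≤ k → H.Adj (c i) y := by
  have up : ∀ d, i₀ + d ≤ k → H.Adj (c (i₀ + d)) y := by
    intro d
    induction d with
    | zero => exact fun _ => h₀
    | succ d ih =>
      intro hd
      exact (st.full _ _ _ (ih (by omega)) (hc (i₀ + d) (by omega)) (hy _ hd)).symm
  have dn : ∀ d, d ≤ i₀ → H.Adj (c (i₀ - d)) y := by
    intro d
    induction d with
    | zero => exact fun _ => h₀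
    | succ d ih =>
      intro hd
      have := hc (i₀ - (d + 1)) (by omega)
      rw [show i₀ - (d + 1) + 1 = i₀ - d by omega] at this
      exact (st.full _ _ _ (ih (by omega)) this.symm (hy _ (by omega))).symm
  intro i hi
  rcases le_total i₀ i with h | h
  · simpa [show i₀ + (i - i₀) = i by omega] using up (i - i₀) (by omega)
  · simpa [show i₀ - (i₀ - i) = i by omega] using dn (i₀ - i) (by omega)

/-- By induction proper subpaths already have distant images of their ends. Equal end images
contradict this for the subpath of length `k - 1`; adjacent ones close the image to an induced cycle
of length `k + 1 ≤ 8`. Its cone vertex is handed to `hS`. The two applications differ in how that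
cone vertex is lifted. -/
theorem not_near_of_isIndPath_of (hG : G.IsConed) {S : Set T}
    (hS : ∀ (k : ℕ) (c : ℕ → T) (y : V), 2 ≤ k → k ≤ 7 → H.IsIndPath k c →
      (∀ i, 0 < i → i < k → c i ∈ S) → (∀ i, i ≤ k → G.Adj y (f (c i))) →
      G.Adj (f (c 0)) (f (c k)) → H.Near (c 0) (c k))
    {k : ℕ} {c : ℕ → T} (hk2 : 2 ≤ k) (hk7 : k ≤ 7) (hc : H.IsIndPath k c)
    (hcS : ∀ i, 0 < i → i < k → c i ∈ S) : ¬ G.Near (f (c 0)) (f (c k)) := by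
  induction k using Nat.strong_induction_on generalizing c with
  | _ k ih =>
  have hsub : ∀ i l, i + l ≤ k → l < k → 2 ≤ l → ¬ G.Near (f (c i)) (f (c (i + l))) := by
    intro i l hil hlk hl
    exact ih l hlk hl (by omega) (hc.shift i l hil) fun t h0 h1 => hcS (i + t) (by omega) (by omega)
  rcases Nat.lt_or_ge 2 k with hk | hk
  swap
  · obtain rfl : k = 2 := by omega
    rintro (h | h)
    · exact hc.far 0 2 (by omega) le_rfl
        (Or.inl (st.inj (c 1) _ _ (hc.adj 0 (by omega)).symm (hc.adj 1 (by omega)) h))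
    · exact hc.far 0 2 (by omega) le_rfl
        (Or.inr (st.full (c 1) _ _ (hc.adj 0 (by omega)).symm (hc.adj 1 (by omega)) h))
  rintro (h | h)
  · have h1 := st.hom _ _ (hc.adj (k - 1) (by omega))
    rw [show k - 1 + 1 = k by omega, ← h] at h1
    have h2 := hsub 0 (k - 1) (by omega) (by omega) (by omega)
    rw [Nat.zero_add] at h2
    exact h2 (Or.inr h1.symm)
  · obtain ⟨y, hya, hy⟩ := hG (k - 1) (fun i => f (c (i + 1))) (f (c 0)) (by omega) (by omega)
      ⟨fun i hi => st.hom _ _ (hc.adj (i + 1) (by omega)), fun i j hij hj => by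
        have := hsub (i + 1) (j - i) (by omega) (by omega) (by omega)
        rwa [show i + 1 + (j - i) = j + 1 by omega] at this⟩
      (st.hom _ _ (hc.adj 0 (by omega)))
      (by rwa [show k - 1 + 1 = k by omega])
      (fun i h0 h1 => by
        have := hsub 0 (i + 1) (by omega) (by omega) (by omega)
        rwa [Nat.zero_add] at this)
    refine hc.far 0 k (by omega) le_rfl (hS k c y hk2 hk7 hc hcS ?_ h)
    rintro (_ | i) hi
    · exact hya
    · exact hy i (by omega)

/-- Induced paths of length at most 7 whose inner vertices have level less than `n` project to
paths with distant ends. -/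
theorem not_near_of_isIndPath (hG : G.IsConed) {k : ℕ} {c : ℕ → T} (hk2 : 2 ≤ k) (hk7 : k ≤ 7)
    (hc : H.IsIndPath k c) (hlow : ∀ i, 0 < i → i < k → lv (c i) < n) :
    ¬ G.Near (f (c 0)) (f (c k)) := by
  refine st.not_near_of_isIndPath_of hG (S := {x | lv x < n}) ?_ hk2 hk7 hc hlow
  intro k c y hk2 _ hc hcS hy h
  obtain ⟨y', hy', rfl⟩ := st.surj (c 1) (st.mem _ _ (hc.adj 1 (by omega)))
    (hcS 1 (by omega) (by omega)) y (hy 1 (by omega)).symm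
  have hall := st.adj_of_cone hc.adj hy (i₀ := 1) (by omega) hy'
  exact Or.inr (st.full y' _ _ (hall 0 (by omega)).symm (hall k le_rfl).symm h)

/-- The projection is injective and full at short range: the walk shortens to an induced path, which
can only have length 0 or 1. -/
theorem near_of_walk (hG : G.IsConed) {k : ℕ} {y : ℕ → T} (hk : k ≤ 7)
    (hadj : ∀ i, i < k → H.Adj (y i) (y (i + 1))) (hlow : ∀ i, 0 < i → i < k → lv (y i) < n)
    (h : G.Near (f (y 0)) (f (y k))) : H.Near (y 0) (y k) := by
  obtain ⟨j, hj, c, h0, h1, hc, hcS⟩ := exists_isIndPath (S := {x | lv x < n}) hadj hlow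
  rw [← h0, ← h1] at h ⊢
  rcases Nat.lt_or_ge j 2 with hj2 | hj2
  · interval_cases j
    · exact Near.refl _
    · exact Or.inr (hc.adj 0 (by omega))
  · exact absurd h (st.not_near_of_isIndPath hG hj2 (by omega) hc hcS)

theorem open_adj {x x' : T} {z : V} (h : G.Open f lv n H B x z) (hadj : H.Adj x x')
    (hlv : lv x' = n) (hz : G.Adj (f x') z) : G.Open f lv n H B x' z := by
  refine ⟨st.mem' hadj, hlv, hz, ?_⟩
  rintro y hy rfl
  exact h.2.2.2 y (st.full x' _ _ hadj.symm hy h.2.2.1) rfl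

/-- The missing neighbour of a vertex is not near the projection of a vertex of lower level which
is joined to it by a short walk through lower levels. -/
theorem not_near_of_open (hG : G.IsConed) {k : ℕ} {y : ℕ → T} {z : V} (hk : k ≤ 6)
    (hadj : ∀ i, i < k → H.Adj (y i) (y (i + 1))) (hlow : ∀ i, i < k → lv (y i) < n)
    (hk0 : 0 < k) (h : G.Open f lv n H B (y k) z) : ¬ G.Near z (f (y 0)) := by
  rintro (rfl | hz)
  · rcases st.near_of_walk hG (by omega) hadj (fun i _ hi => hlow i hi) (Or.inr h.2.2.1.symm) with
      h' | h'
    · have := hlow 0 hk0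
      rw [h', h.2.1] at this
      omega
    · exact h.2.2.2 _ h'.symm rfl
  · obtain ⟨z', hz', rfl⟩ := st.surj (y 0) (st.mem _ _ (hadj 0 hk0)) (hlow 0 hk0) z hz.symm
    -- The lift of `z` at `y 0` is put in front of the walk, which then has length at most 7 and
    -- adjacent images of its ends.
    have := st.near_of_walk hG (k := k + 1) (y := fun i => Nat.casesOn i z' y) (by omega)
      (by
        rintro (_ | i) hi
        · exact hz'.symm
        · exact hadj i (by omega))
      (by
        rintro (_ | i) h0 hi
        · omega
        · exact hlow i (by omega)) (Or.inr h.2.2.1.symm)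
    rcases this with h' | h'
    · exact h.2.2.1.ne (congrArg f h').symm
    · exact h.2.2.2 _ h'.symm rfl

/-- At a lower level `z` would lift at `y`, and `full` would make this lift a neighbour of `x`. -/
theorem lv_eq_of_open {x y : T} {z : V} (h : G.Open f lv n H B x z) (hxy : H.Adj x y)
    (hyz : G.Adj (f y) z) : lv y = n := by
  have h1 := st.lv_le y (st.mem' hxy)
  by_contra hne
  obtain ⟨z', hz', rfl⟩ := st.surj y (st.mem' hxy) (by omega) z hyz
  exact h.2.2.2 z' (st.full y _ _ hxy.symm hz' h.2.2.1) rfl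

theorem dn_of_lt {a r : T} (ha : lv a = n) (h : H.Adj a r) (hr : lv r < n) : H.Dn lv a r :=
  ⟨h, by have := st.lv_adj a r h; omega⟩

end Basic

end IsStage

end SimpleGraph

/-! ### Classes of vertices with a common missing neighbour. -/

namespace SimpleGraph

variable {V T : Type*}

/-- Lower neighbours of `a` and `b` are joined by a walk of length at most `m` below level `n`. -/
def DownJoin (H : SimpleGraph T) (lv : T → ℕ) (n m : ℕ) (a b : T) : Prop :=
  ∃ r s, H.Dn lv a r ∧ H.Dn lv b s ∧ H.Chain {x | lv x < n} m r s

/-- The vertices `a` and `b` are near each other, or joined by two strong edges through a vertex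
with the missing neighbour `z`. -/
def OpenJoin (G : SimpleGraph V) (f : T → V) (lv : T → ℕ) (n : ℕ) (H : SimpleGraph T) (B : Set T)
    (z : V) (a b : T) : Prop :=
  H.Near a b ∨ ∃ y, G.Open f lv n H B y z ∧ H.Strong lv a y ∧ H.Strong lv y b

theorem DownJoin.symm {H : SimpleGraph T} {lv : T → ℕ} {n m : ℕ} {a b : T}
    (h : H.DownJoin lv n m a b) : H.DownJoin lv n m b a := by
  obtain ⟨r, s, hr, hs, h⟩ := h
  exact ⟨s, r, hs, hr, h.symm⟩

theorem DownJoin.mono {H : SimpleGraph T} {lv : T → ℕ} {n m m' : ℕ} {a b : T}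
    (h : H.DownJoin lv n m a b) (hm : m ≤ m') : H.DownJoin lv n m' a b := by
  obtain ⟨r, s, hr, hs, h⟩ := h
  exact ⟨r, s, hr, hs, h.mono hm⟩

namespace IsStage

variable {G : SimpleGraph V} {f : T → V} {lv : T → ℕ} {n : ℕ} {H : SimpleGraph T} {B : Set T}
variable (st : IsStage G f lv n H B)
include st

theorem downJoin_of_adj {a b : T} (ha : lv a = n) (hb : lv b = n) (h : H.Adj a b) :
    H.DownJoin lv n 1 a b := by
  obtain ⟨r, s, hr, hs, hn⟩ := st.edge a b h (by omega)
  exact ⟨r, s, hr, hs, Chain.of_near (show lv r < n by have := hr.2; omega)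
    (show lv s < n by have := hs.2; omega) hn⟩

omit st in
theorem downJoin_of_strong {a b : T} (ha : lv a = n) (h : H.Strong lv a b) :
    H.DownJoin lv n 0 a b := by
  obtain ⟨-, r, hr, hs⟩ := h
  exact ⟨r, r, hr, hs, .nil (show lv r < n by have := hr.2; omega)⟩

theorem chain_of_dn {b u u' : T} (hb : lv b = n) (hu : H.Dn lv b u) (hu' : H.Dn lv b u') :
    H.Chain {x | lv x < n} 2 u u' := by
  have h1 : u ∈ {x | lv x < n} := by have := hu.2; change lv u < n; omega
  have h2 : u' ∈ {x | lv x < n} := by have := hu'.2; change lv u' < n; omega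
  rcases st.vert b u u' hu hu' with h | ⟨x, hx, hs, hs'⟩
  · exact (Chain.of_near h1 h2 h).mono (by omega)
  · have h3 : x ∈ {x | lv x < n} := by have := hx.2; change lv x < n; omega
    exact .cons h1 hs.1 (.cons h3 hs'.1 (.nil h2))

/-- Passing through `b` costs 2 by the vertex condition, while an edge costs 1 and a strong edge 0.
Two edges, or three strong edges, thus cost exactly the 4 that `openJoin_of_downJoin` allows; this
is why the vertex condition asks for strong edges. -/
theorem downJoin_trans {m m' : ℕ} {a b c : T} (hb : lv b = n) (h : H.DownJoin lv n m a b)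
    (h' : H.DownJoin lv n m' b c) : H.DownJoin lv n (m + 2 + m') a c := by
  obtain ⟨r, s, hr, hs, h⟩ := h
  obtain ⟨r', s', hr', hs', h'⟩ := h'
  exact ⟨r, s', hr, hs', (h.trans (st.chain_of_dn hb hs hr')).trans h'⟩

omit st in
theorem exists_isIndPath_of_downJoin {m : ℕ} {a b : T} (h : H.DownJoin lv n m a b) :
    ∃ j, j ≤ m + 2 ∧ ∃ c : ℕ → T, c 0 = a ∧ c j = b ∧ H.IsIndPath j c ∧
      ∀ i, 0 < i → i < j → lv (c i) < n := by
  obtain ⟨r, s, hr, hs, h⟩ := h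
  obtain ⟨k, hk, y, h0, h1, hadj, hS⟩ := h.exists_walk_between hr.1 hs.1.symm
  obtain ⟨j, hj, c, hc0, hcj, hc, hcS⟩ := exists_isIndPath hadj hS
  exact ⟨j, by omega, c, by rw [hc0, h0], by rw [hcj, h1], hc, hcS⟩

theorem near_of_downJoin (hG : G.IsConed) {m : ℕ} {a b : T} (hm : m ≤ 5)
    (h : H.DownJoin lv n m a b) (hn : G.Near (f a) (f b)) : H.Near a b := by
  obtain ⟨j, hj, c, rfl, rfl, hc, hcS⟩ := exists_isIndPath_of_downJoin h
  exact st.near_of_walk hG (by omega) hc.adj hcS hn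

/-- A vertex whose projection is adjacent to `z`, joined from below to a vertex with the missing
neighbour `z`. -/
theorem openJoin_of_downJoin (hG : G.IsConed) {a x : T} {z : V} (hd : H.DownJoin lv n 4 a x)
    (hx : G.Open f lv n H B x z) (ha : lv a = n) (haz : G.Adj (f a) z) :
    G.OpenJoin f lv n H B z a x := by
  by_cases hnear : H.Near a x
  · exact Or.inl hnear
  obtain ⟨j, hj, c, rfl, rfl, hc, hcS⟩ := exists_isIndPath_of_downJoin hd
  have hj2 : 2 ≤ j := by
    by_contra h
    interval_cases j
    · exact hnear (Near.refl _)
    · exact hnear (Or.inr (hc.adj 0 (by omega)))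
  -- The path has length at most 6, so `z` closes it to an induced cycle of length at most 8.
  obtain ⟨y, hyz, hy⟩ := hG j (fun i => f (c i)) z hj2 (by omega)
    ⟨fun i hi => st.hom _ _ (hc.adj i hi), fun i l hil hl => by
      have := st.not_near_of_isIndPath hG (k := l - i) (by omega) (by omega)
        (hc.shift i (l - i) (by omega)) fun t h0 h1 => hcS _ (by omega) (by omega)
      simpa [show i + (l - i) = l by omega] using this⟩
    haz.symm hx.2.2.1.symm
    (fun i h0 h1 => by
      have := st.not_near_of_open hG (k := j - i) (y := fun t => c (i + t)) (z := z) (by omega)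
        (fun t ht => hc.adj (i + t) (by omega)) (fun t ht => hcS _ (by omega) (by omega))
        (by omega) (by simpa [show i + (j - i) = j by omega] using hx)
      simpa using this)
  obtain ⟨y', hy', rfl⟩ := st.surj (c 1) (st.mem _ _ (hc.adj 1 (by omega)))
    (hcS 1 (by omega) (by omega)) y (hy 1 (by omega)).symm
  have hall := st.adj_of_cone hc.adj hy (i₀ := 1) (by omega) hy'
  -- The lifted cone vertex is on level `n`, so `c 1` and `c (j - 1)` lie below it and make its
  -- edges to the two ends strong.
  have hlv := st.lv_eq_of_open hx (hall j le_rfl) hyz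
  have hlow : ∀ i, 0 < i → i < j → H.Dn lv y' (c i) := fun i h0 h1 =>
    st.dn_of_lt hlv (hall i (by omega)).symm (hcS i h0 h1)
  refine Or.inr ⟨y', st.open_adj hx (hall j le_rfl) hlv hyz, ⟨hall 0 (by omega), c 1, ?_, ?_⟩,
    (hall j le_rfl).symm, c (j - 1), ?_, ?_⟩
  · exact st.dn_of_lt ha (hc.adj 0 (by omega)) (hcS 1 (by omega) (by omega))
  · exact hlow 1 (by omega) (by omega)
  · exact hlow (j - 1) (by omega) (by omega)
  · refine st.dn_of_lt hx.2.1 ?_ (hcS (j - 1) (by omega) (by omega))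
    have := hc.adj (j - 1) (by omega)
    rw [show j - 1 + 1 = j by omega] at this
    exact this.symm

omit st in
theorem openEqv_symm {z : V} {a b : T} (h : G.OpenEqv f lv n H B z a b) :
    G.OpenEqv f lv n H B z b a := by
  induction h with
  | refl => exact .refl
  | tail _ h ih => exact .head ⟨h.2.1, h.1, h.2.2.symm⟩ ih

omit st in
theorem open_of_openEqv {z : V} {a b : T} (h : G.OpenEqv f lv n H B z a b)
    (ha : G.Open f lv n H B a z) : G.Open f lv n H B b z := by
  induction h with
  | refl => exact ha
  | tail _ h _ => exact h.2.1

omit st in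
theorem openEqv_of_openJoin {z : V} {a b : T} (ha : G.Open f lv n H B a z)
    (hb : G.Open f lv n H B b z) (h : G.OpenJoin f lv n H B z a b) :
    G.OpenEqv f lv n H B z a b := by
  rcases h with (rfl | h) | ⟨y, hy, h, h'⟩
  · exact .refl
  · exact .single ⟨ha, hb, h⟩
  · exact .tail (.single ⟨ha, hy, h.1⟩) ⟨hy, hb, h'.1⟩

theorem openJoin_of_adj_adj (hG : G.IsConed) {z : V} {a b c : T} (ha : G.Open f lv n H B a z)
    (hb : G.Open f lv n H B b z) (hc : G.Open f lv n H B c z) (hab : H.Adj a b)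
    (hbc : H.Adj b c) : G.OpenJoin f lv n H B z a c :=
  st.openJoin_of_downJoin hG (st.downJoin_trans hb.2.1 (st.downJoin_of_adj ha.2.1 hb.2.1 hab)
    (st.downJoin_of_adj hb.2.1 hc.2.1 hbc)) hc ha.2.1 ha.2.2.1

/-- Extending a join by one edge leaves either an edge, two edges, or three strong edges, and each
of these reduces to a join again. Hence every class has diameter at most two. -/
theorem openJoin_of_openEqv (hG : G.IsConed) {z : V} {a b : T} (ha : G.Open f lv n H B a z)
    (h : G.OpenEqv f lv n H B z a b) : G.OpenJoin f lv n H B z a b := by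
  induction h with
  | refl => exact Or.inl (Near.refl _)
  | @tail b c _ h ih =>
    obtain ⟨hb, hc, hbc⟩ := h
    rcases ih with (rfl | hab) | ⟨y, hy, hay, hyb⟩
    · exact Or.inl (Or.inr hbc)
    · exact st.openJoin_of_adj_adj hG ha hb hc hab hbc
    · rcases st.openJoin_of_adj_adj hG hy hb hc hyb.1 hbc with (rfl | hyc) | ⟨y', hy', hyy, hyc⟩
      · exact Or.inl (Or.inr hay.1)
      · exact st.openJoin_of_adj_adj hG ha hy hc hay.1 hyc
      · exact st.openJoin_of_downJoin hG (st.downJoin_trans hy'.2.1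
          (st.downJoin_trans hy.2.1 (downJoin_of_strong ha.2.1 hay)
            (downJoin_of_strong hy.2.1 hyy)) (downJoin_of_strong hy'.2.1 hyc)) hc ha.2.1 ha.2.2.1

theorem downJoin_of_openEqv (hG : G.IsConed) {z : V} {a b : T} (ha : G.Open f lv n H B a z)
    (h : G.OpenEqv f lv n H B z a b) : a = b ∨ H.DownJoin lv n 2 a b := by
  have hb := open_of_openEqv h ha
  rcases st.openJoin_of_openEqv hG ha h with (h | h) | ⟨y, hy, h, h'⟩
  · exact Or.inl h
  · exact Or.inr ((st.downJoin_of_adj ha.2.1 hb.2.1 h).mono (by omega))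
  · exact Or.inr (st.downJoin_trans hy.2.1 (downJoin_of_strong ha.2.1 h)
      (downJoin_of_strong hy.2.1 h'))

theorem chain_of_openEqv (hG : G.IsConed) {z : V} {a b : T} (ha : G.Open f lv n H B a z)
    (h : G.OpenEqv f lv n H B z a b) : H.Chain {x | lv x = n} 2 a b := by
  have hb := open_of_openEqv h ha
  rcases st.openJoin_of_openEqv hG ha h with h | ⟨y, hy, h, h'⟩
  · exact (Chain.of_near (S := {x | lv x = n}) ha.2.1 hb.2.1 h).mono (by omega)
  · exact .cons ha.2.1 h.1 (.cons hy.2.1 h'.1 (.nil hb.2.1))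

/-- A cone vertex of a walk lifts to a vertex adjacent to the whole walk, or is a missing
neighbour of all its vertices. -/
theorem cone_cases {k : ℕ} {c : ℕ → T} (hc : ∀ i, i < k → H.Adj (c i) (c (i + 1)))
    (hB : c 0 ∈ B) {y : V} (hy : ∀ i, i ≤ k → G.Adj y (f (c i))) :
    (∃ y', f y' = y ∧ ∀ i, i ≤ k → H.Adj (c i) y') ∨
      G.Open f lv n H B (c 0) y ∧ G.OpenEqv f lv n H B y (c 0) (c k) := by
  by_cases hex : ∃ i, i ≤ k ∧ ∃ y', H.Adj (c i) y' ∧ f y' = y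
  · obtain ⟨i, hi, y', hy', rfl⟩ := hex
    exact Or.inl ⟨y', rfl, st.adj_of_cone hc hy hi hy'⟩
  push Not at hex
  right
  have hmem : ∀ i, i ≤ k → c i ∈ B := by
    rintro (_ | i) hi
    · exact hB
    · exact st.mem' (hc i (by omega))
  have hop : ∀ i, i ≤ k → G.Open f lv n H B (c i) y := by
    intro i hi
    refine ⟨hmem i hi, ?_, (hy i hi).symm, hex i hi⟩
    by_contra hne
    have := st.lv_le _ (hmem i hi)
    obtain ⟨y', hy', rfl⟩ := st.surj (c i) (hmem i hi) (by omega) y (hy i hi).symm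
    exact hex i hi y' hy' rfl
  refine ⟨hop 0 (by omega), ?_⟩
  have : ∀ i, i ≤ k → G.OpenEqv f lv n H B y (c 0) (c i) := by
    intro i
    induction i with
    | zero => exact fun _ => .refl
    | succ i ih =>
      exact fun hi => (ih (by omega)).tail ⟨hop i (by omega), hop (i + 1) hi, hc i (by omega)⟩
  exact this k le_rfl

/-- Here the levels are unrestricted. A cone vertex that does not lift is missing at every vertex of
the path, so the ends lie in one class and are joined from below, where short-range injectivity is
known. -/
theorem not_near_of_isIndPath' (hG : G.IsConed) {k : ℕ} {c : ℕ → T} (hk2 : 2 ≤ k) (hk7 : k ≤ 7)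
    (hc : H.IsIndPath k c) : ¬ G.Near (f (c 0)) (f (c k)) := by
  refine st.not_near_of_isIndPath_of hG (S := Set.univ) ?_ hk2 hk7 hc fun _ _ _ => trivial
  intro k c y hk2 _ hc _ hy h
  rcases st.cone_cases hc.adj (st.mem _ _ (hc.adj 0 (by omega))) hy with
    ⟨y', rfl, hy'⟩ | ⟨hop, heq⟩
  · exact Or.inr (st.full y' _ _ (hy' 0 (by omega)).symm (hy' k le_rfl).symm h)
  · rcases st.downJoin_of_openEqv hG hop heq with heq | hd
    · exact Or.inl heq
    · exact st.near_of_downJoin hG (by omega) hd (Or.inr h)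

omit st in
theorem exists_isIndPath_of_chain {S : Set T} {m : ℕ} {a b : T} (h : H.Chain S m a b) :
    ∃ j, j ≤ m ∧ ∃ c : ℕ → T, c 0 = a ∧ c j = b ∧ H.IsIndPath j c ∧ ∀ i, i ≤ j → c i ∈ S := by
  obtain ⟨k, hk, y, h0, h1, hadj, hS⟩ := h.exists_walk
  obtain ⟨j, hj, c, hc0, hcj, hc, hcS⟩ := exists_isIndPath hadj fun i _ hi => hS i hi.le
  refine ⟨j, by omega, c, by rw [hc0, h0], by rw [hcj, h1], hc, fun i hi => ?_⟩
  rcases Nat.eq_zero_or_pos i with rfl | h0'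
  · rw [hc0]; exact hS 0 (by omega)
  rcases Nat.lt_or_ge i j with h' | h'
  · exact hcS i h0' h'
  · rw [show i = j by omega, hcj]; exact hS k le_rfl

theorem near_of_chain (hG : G.IsConed) {S : Set T} {m : ℕ} {a b : T} (hm : m ≤ 7)
    (h : H.Chain S m a b) (hn : G.Near (f a) (f b)) : H.Near a b := by
  obtain ⟨j, hj, c, rfl, rfl, hc, -⟩ := exists_isIndPath_of_chain h
  rcases Nat.lt_or_ge j 2 with hj2 | hj2
  · interval_cases j
    · exact Near.refl _
    · exact Or.inr (hc.adj 0 (by omega))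
  · exact absurd hn (st.not_near_of_isIndPath' hG hj2 (by omega) hc)

theorem isIndPath_map (hG : G.IsConed) {k : ℕ} {c : ℕ → T} (hk7 : k ≤ 7) (hc : H.IsIndPath k c) :
    G.IsIndPath k fun i => f (c i) :=
  ⟨fun i hi => st.hom _ _ (hc.adj i hi), fun i l hil hl => by
    have := st.not_near_of_isIndPath' hG (k := l - i) (by omega) (by omega)
      (hc.shift i (l - i) (by omega))
    simpa [show i + (l - i) = l by omega] using this⟩

theorem ne_of_isIndPath (hG : G.IsConed) {k : ℕ} {c : ℕ → T} {z : V} (hk7 : k ≤ 7)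
    (hc : H.IsIndPath k c) (hz : G.Open f lv n H B (c 0) z) : z ≠ f (c k) := by
  rintro rfl
  rcases Nat.lt_or_ge k 2 with hk | hk
  · interval_cases k
    · exact hz.2.2.1.ne rfl
    · exact hz.2.2.2 _ (hc.adj 0 (by omega)) rfl
  · exact st.not_near_of_isIndPath' hG hk hk7 hc (Or.inr hz.2.2.1)

/-- After cutting at inner vertices whose images are adjacent to `z`, the path and `z` form an
induced cycle of length at most 8. If the cone vertex lifts, its lift also misses `z` and links the
ends; if not, the ends are joined from below. -/
theorem openEqv_of_isIndPath (hG : G.IsConed) {k : ℕ} {c : ℕ → T} {z : V} (hk : k ≤ 6)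
    (hc : H.IsIndPath k c) (hlv : ∀ i, i ≤ k → lv (c i) = n) (h0 : G.Open f lv n H B (c 0) z)
    (h1 : G.Adj (f (c k)) z) : G.OpenEqv f lv n H B z (c 0) (c k) := by
  induction k using Nat.strong_induction_on generalizing c with
  | _ k ih =>
  rcases Nat.lt_or_ge k 2 with hk2 | hk2
  · interval_cases k
    · exact .refl
    · have := hc.adj 0 (by omega)
      exact .single ⟨h0, st.open_adj h0 this (hlv 1 le_rfl) h1, this⟩
  by_cases hmid : ∃ j, 0 < j ∧ j < k ∧ G.Adj (f (c j)) z
  · obtain ⟨j, hj0, hjk, hj⟩ := hmid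
    have e1 := ih j hjk (by omega) (hc.initial j hjk.le) (fun i hi => hlv i (by omega)) h0 hj
    have e2 := ih (k - j) (by omega) (by omega) (hc.shift j (k - j) (by omega))
      (fun i hi => hlv (j + i) (by omega)) (open_of_openEqv e1 h0)
      (by rwa [show j + (k - j) = k by omega])
    rw [show j + (k - j) = k by omega] at e2
    exact e1.trans e2
  push Not at hmid
  obtain ⟨y, hyz, hy⟩ := hG k (fun i => f (c i)) z hk2 hk (st.isIndPath_map hG (by omega) hc)
    h0.2.2.1.symm h1.symm (fun i hi0 hik hn => by
      rcases hn with hn | hn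
      · exact st.ne_of_isIndPath hG (by omega) (hc.initial i hik.le) h0 hn
      · exact hmid i hi0 hik hn.symm)
  rcases st.cone_cases hc.adj h0.1 hy with ⟨y', rfl, hy'⟩ | ⟨hop, heq⟩
  · have hlvy := st.lv_eq_of_open h0 (hy' 0 (by omega)) hyz
    have hoy := st.open_adj h0 (hy' 0 (by omega)) hlvy hyz
    exact .tail (.single ⟨h0, hoy, hy' 0 (by omega)⟩)
      ⟨hoy, st.open_adj hoy (hy' k le_rfl).symm (hlv k le_rfl) h1, (hy' k le_rfl).symm⟩
  · rcases st.downJoin_of_openEqv hG hop heq with heq | hd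
    · rw [heq]
      exact .refl
    · have hj := st.openJoin_of_downJoin hG (hd.symm.mono (by omega)) h0 (hlv k le_rfl) h1
      have hok : G.Open f lv n H B (c k) z := by
        rcases hj with (h | h) | ⟨y, hy, h, -⟩
        · rw [h]; exact h0
        · exact st.open_adj h0 h.symm (hlv k le_rfl) h1
        · exact st.open_adj hy h.1.symm (hlv k le_rfl) h1
      exact openEqv_symm (openEqv_of_openJoin hok h0 hj)

theorem openEqv_of_chain (hG : G.IsConed) {m : ℕ} {a b : T} {z : V} (hm : m ≤ 6)
    (hc : H.Chain {x | lv x = n} m a b) (h0 : G.Open f lv n H B a z) (h1 : G.Adj (f b) z) :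
    G.OpenEqv f lv n H B z a b := by
  obtain ⟨j, hj, c, rfl, rfl, hc, hS⟩ := exists_isIndPath_of_chain hc
  exact st.openEqv_of_isIndPath hG (by omega) hc hS h0 h1

end IsStage

/-! ### Edges between new vertices. -/

/-- The missing neighbours `z₁` of `x₁` and `z₂` of `x₂` are to be joined by an edge. -/
def OpenAdj (G : SimpleGraph V) (f : T → V) (lv : T → ℕ) (n : ℕ) (H : SimpleGraph T) (B : Set T)
    (z₁ : V) (x₁ : T) (z₂ : V) (x₂ : T) : Prop :=
  ∃ y₁ y₂, H.Near y₁ y₂ ∧ G.OpenEqv f lv n H B z₁ x₁ y₁ ∧ G.OpenEqv f lv n H B z₂ x₂ y₂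

namespace IsStage

variable {G : SimpleGraph V} {f : T → V} {lv : T → ℕ} {n : ℕ} {H : SimpleGraph T} {B : Set T}
variable (st : IsStage G f lv n H B)
include st

omit st in
theorem isIndPath_snoc {k : ℕ} {c : ℕ → V} {z : V} (hc : G.IsIndPath k c) (h : G.Adj (c k) z)
    (hfar : ∀ i, i < k → ¬ G.Near (c i) z) :
    G.IsIndPath (k + 1) fun i => if i ≤ k then c i else z := by
  refine ⟨fun i hi => ?_, fun i j hij hj => ?_⟩
  · rcases Nat.lt_or_ge i k with h' | h'
    · simpa [h'.le, Nat.succ_le_of_lt h'] using hc.adj i h'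
    · obtain rfl : i = k := by omega
      simpa using h
  · rcases Nat.lt_or_ge k j with h' | h'
    · simpa [show i ≤ k by omega, show ¬ j ≤ k by omega] using hfar i (by omega)
    · simpa [show i ≤ k by omega, h'] using hc.far i j hij h'

/-- Once chords are excluded, `z₁`, `z₂` and the path of length at most 4 form an induced cycle of
length at most 7. The cone vertex lifts at `c 1`, which is below level `n`, and the lift misses both
`z₁` and `z₂`, so it serves as representative in both classes. -/
theorem openAdj_of_downJoin (hG : G.IsConed) {x₁ x₂ : T} {z₁ z₂ : V}
    (hd : H.DownJoin lv n 2 x₁ x₂) (h₁ : G.Open f lv n H B x₁ z₁) (h₂ : G.Open f lv n H B x₂ z₂)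
    (hz : G.Adj z₁ z₂) : G.OpenAdj f lv n H B z₁ x₁ z₂ x₂ := by
  by_cases hnear : H.Near x₁ x₂
  · exact ⟨x₁, x₂, hnear, .refl, .refl⟩
  have key : ∀ {x₁ x₂ : T} {z : V}, H.DownJoin lv n 2 x₁ x₂ → G.Open f lv n H B x₁ z →
      lv x₂ = n → G.Adj (f x₂) z → G.OpenEqv f lv n H B z x₁ x₂ := by
    intro x₁ x₂ z hd h hlv hadj
    have hj := st.openJoin_of_downJoin hG (hd.symm.mono (by omega)) h hlv hadj
    have hok : G.Open f lv n H B x₂ z := by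
      rcases hj with (h' | h') | ⟨y, hy, h', -⟩
      · rw [h']; exact h
      · exact st.open_adj h h'.symm hlv hadj
      · exact st.open_adj hy h'.1.symm hlv hadj
    exact openEqv_symm (openEqv_of_openJoin hok h hj)
  by_cases ha : G.Adj (f x₂) z₁
  · exact ⟨x₂, x₂, Near.refl _, key hd h₁ h₂.2.1 ha, .refl⟩
  by_cases hb : G.Adj (f x₁) z₂
  · exact ⟨x₁, x₁, Near.refl _, .refl, key hd.symm h₂ h₁.2.1 hb⟩
  obtain ⟨j, hj, c, rfl, rfl, hc, hcS⟩ := exists_isIndPath_of_downJoin hd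
  have hj2 : 2 ≤ j := by
    by_contra h
    interval_cases j
    · exact hnear (Near.refl _)
    · exact hnear (Or.inr (hc.adj 0 (by omega)))
  have hmap := st.isIndPath_map hG (by omega) hc
  have hne := st.not_near_of_isIndPath' hG hj2 (by omega) hc
  have hsn := isIndPath_snoc hmap h₂.2.2.1 (fun i hi hn => by
    rcases Nat.eq_zero_or_pos i with rfl | hi0
    · rcases hn with hn | hn
      · exact hne (Or.inr (hn ▸ h₂.2.2.1.symm))
      · exact hb hn
    · have := st.not_near_of_open hG (k := j - i) (y := fun t => c (i + t)) (z := z₂) (by omega)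
        (fun t ht => hc.adj (i + t) (by omega)) (fun t ht => hcS _ (by omega) (by omega))
        (by omega) (by simpa [show i + (j - i) = j by omega] using h₂)
      exact this (by simpa using hn.symm))
  obtain ⟨y, hyz₁, hy⟩ := hG (j + 1) _ z₁ (by omega) (by omega) hsn
    (by simpa using h₁.2.2.1.symm) (by simpa using hz)
    (fun i hi0 hik hn => by
      simp only [show i ≤ j by omega, if_true] at hn
      rcases Nat.lt_or_ge i j with hij | hij
      · have := st.not_near_of_open hG (k := i) (y := fun t => c (i - t)) (z := z₁) (by omega)
          (fun t ht => by
            have := (hc.adj (i - (t + 1)) (by omega)).symm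
            rwa [show i - (t + 1) + 1 = i - t by omega] at this)
          (fun t ht => hcS _ (by omega) (by omega)) hi0 (by simpa using h₁)
        exact this (by simpa using hn)
      · obtain rfl : i = j := by omega
        rcases hn with hn | hn
        · exact hne (Or.inr (hn ▸ h₁.2.2.1))
        · exact ha hn.symm)
  have hyz₂ : G.Adj y z₂ := by simpa using hy (j + 1) le_rfl
  have hyc : ∀ i, i ≤ j → G.Adj y (f (c i)) := fun i hi => by simpa [hi] using hy i (by omega)
  obtain ⟨y', hy', rfl⟩ := st.surj (c 1) (st.mem _ _ (hc.adj 1 (by omega)))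
    (hcS 1 (by omega) (by omega)) y (hyc 1 (by omega)).symm
  have hall := st.adj_of_cone hc.adj hyc (i₀ := 1) (by omega) hy'
  have hlv := st.lv_eq_of_open h₁ (hall 0 (by omega)) hyz₁
  exact ⟨y', y', Near.refl _,
    .single ⟨h₁, st.open_adj h₁ (hall 0 (by omega)) hlv hyz₁, hall 0 (by omega)⟩,
    .single ⟨h₂, st.open_adj h₂ (hall j le_rfl) hlv hyz₂, hall j le_rfl⟩⟩

/-- A further path vertex with image adjacent to `z₁` or `z₂` replaces the corresponding end within
its class and shortens the path. Without such vertices there is a cycle of length at most 7 to cone;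
when the cone vertex does not lift, distinct ends are joined from below. -/
theorem openAdj_of_isIndPath (hG : G.IsConed) {k : ℕ} {c : ℕ → T} {z₁ z₂ : V} (hk : k ≤ 4)
    (hc : H.IsIndPath k c) (hlv : ∀ i, i ≤ k → lv (c i) = n)
    (h₁ : G.Open f lv n H B (c 0) z₁) (h₂ : G.Open f lv n H B (c k) z₂) (hz : G.Adj z₁ z₂) :
    G.OpenAdj f lv n H B z₁ (c 0) z₂ (c k) := by
  induction k using Nat.strong_induction_on generalizing c with
  | _ k ih =>
  rcases Nat.lt_or_ge k 2 with hk2 | hk2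
  · refine ⟨c 0, c k, ?_, .refl, .refl⟩
    interval_cases k
    · exact Near.refl _
    · exact Or.inr (hc.adj 0 (by omega))
  by_cases hmid : ∃ i, 0 < i ∧ i ≤ k ∧ G.Adj (f (c i)) z₁
  · obtain ⟨i, hi0, hik, hi⟩ := hmid
    have e := st.openEqv_of_isIndPath hG (by omega) (hc.initial i hik)
      (fun t ht => hlv t (by omega)) h₁ hi
    obtain ⟨y₁, y₂, hn, e₁, e₂⟩ := ih (k - i) (by omega) (by omega)
      (hc.shift i (k - i) (by omega)) (fun t ht => hlv (i + t) (by omega)) (open_of_openEqv e h₁)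
      (by rwa [show i + (k - i) = k by omega])
    rw [show i + (k - i) = k by omega] at e₂
    exact ⟨y₁, y₂, hn, e.trans e₁, e₂⟩
  by_cases hmid' : ∃ i, i < k ∧ G.Adj (f (c i)) z₂
  · obtain ⟨i, hik, hi⟩ := hmid'
    have e := st.openEqv_of_isIndPath hG (k := k - i) (z := z₂) (by omega)
      (hc.reverse.initial (k - i) (by omega)) (fun t ht => hlv _ (by omega))
      (by simpa using h₂) (by rwa [show k - (k - i) = i by omega])
    rw [show k - (k - i) = i by omega, Nat.sub_zero] at e
    obtain ⟨y₁, y₂, hn, e₁, e₂⟩ := ih i hik (by omega) (hc.initial i hik.le)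
      (fun t ht => hlv t (by omega)) h₁ (open_of_openEqv e h₂)
    exact ⟨y₁, y₂, hn, e₁, e.trans e₂⟩
  push Not at hmid hmid'
  have hsn := isIndPath_snoc (st.isIndPath_map hG (by omega) hc) h₂.2.2.1 (fun i hi hn => by
    rcases hn with hn | hn
    · have := st.ne_of_isIndPath hG (k := k - i) (z := z₂) (by omega)
        (hc.reverse.initial (k - i) (by omega)) (by simpa using h₂)
      rw [show k - (k - i) = i by omega] at this
      exact this hn.symm
    · exact hmid' i hi hn)
  obtain ⟨y, hyz₁, hy⟩ := hG (k + 1) _ z₁ (by omega) (by omega) hsn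
    (by simpa using h₁.2.2.1.symm) (by simpa using hz)
    (fun i hi0 hik hn => by
      simp only [show i ≤ k by omega, if_true] at hn
      rcases hn with hn | hn
      · exact st.ne_of_isIndPath hG (by omega) (hc.initial i (by omega)) h₁ hn
      · exact hmid i hi0 (by omega) hn.symm)
  have hyz₂ : G.Adj y z₂ := by simpa using hy (k + 1) le_rfl
  have hyc : ∀ i, i ≤ k → G.Adj y (f (c i)) := fun i hi => by simpa [hi] using hy i (by omega)
  rcases st.cone_cases hc.adj h₁.1 hyc with ⟨y', rfl, hall⟩ | ⟨hop, heq⟩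
  · have hlv := st.lv_eq_of_open h₁ (hall 0 (by omega)) hyz₁
    exact ⟨y', y', Near.refl _,
      .single ⟨h₁, st.open_adj h₁ (hall 0 (by omega)) hlv hyz₁, hall 0 (by omega)⟩,
      .single ⟨h₂, st.open_adj h₂ (hall k le_rfl) hlv hyz₂, hall k le_rfl⟩⟩
  · rcases st.downJoin_of_openEqv hG hop heq with heq | hd
    · exact ⟨c 0, c k, Or.inl heq, .refl, .refl⟩
    · exact st.openAdj_of_downJoin hG hd h₁ h₂ hz

theorem openAdj_of_chain (hG : G.IsConed) {m : ℕ} {a b : T} {z₁ z₂ : V} (hm : m ≤ 4)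
    (hc : H.Chain {x | lv x = n} m a b) (h₁ : G.Open f lv n H B a z₁)
    (h₂ : G.Open f lv n H B b z₂) (hz : G.Adj z₁ z₂) : G.OpenAdj f lv n H B z₁ a z₂ b := by
  obtain ⟨j, hj, c, rfl, rfl, hc, hS⟩ := exists_isIndPath_of_chain hc
  exact st.openAdj_of_isIndPath hG (by omega) hc hS h₁ h₂ hz

end IsStage

end SimpleGraph

/-! ### The next stage of the covering. -/

namespace SimpleGraph

variable {V T : Type*}

/-- `nw z x` is a new vertex of level `n + 1` over `z`, depending only on the class of `x` among
the vertices with the missing neighbour `z`. -/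
structure IsNew (G : SimpleGraph V) (f : T → V) (lv : T → ℕ) (n : ℕ) (H : SimpleGraph T)
    (B : Set T) (nw : V → T → T) : Prop where
  map : ∀ z x, G.Open f lv n H B x z → f (nw z x) = z
  lv_eq : ∀ z x, G.Open f lv n H B x z → lv (nw z x) = n + 1
  eqv : ∀ z x x', G.Open f lv n H B x z → G.Open f lv n H B x' z → nw z x = nw z x' →
    G.OpenEqv f lv n H B z x x'
  eq : ∀ z x y, G.Open f lv n H B x z → G.OpenEqv f lv n H B z x y → nw z x = nw z y

/-- Adjacency in the next stage. -/
inductive ExtAdj (G : SimpleGraph V) (f : T → V) (lv : T → ℕ) (n : ℕ) (H : SimpleGraph T)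
    (B : Set T) (nw : V → T → T) : T → T → Prop
  | old {a b : T} : H.Adj a b → ExtAdj G f lv n H B nw a b
  | up {a : T} {z : V} : G.Open f lv n H B a z → ExtAdj G f lv n H B nw a (nw z a)
  | down {a : T} {z : V} : G.Open f lv n H B a z → ExtAdj G f lv n H B nw (nw z a) a
  -- Asking for carriers near each other builds the edge condition into the new level.
  | new {a b : T} {z w : V} : G.Open f lv n H B a z → G.Open f lv n H B b w → G.Adj z w →
      H.Near a b → ExtAdj G f lv n H B nw (nw z a) (nw w b)

/-- The graph of the next stage. -/
def extGraph (G : SimpleGraph V) (f : T → V) (lv : T → ℕ) (n : ℕ) (H : SimpleGraph T)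
    (B : Set T) (nw : V → T → T) : SimpleGraph T where
  Adj a b := a ≠ b ∧ G.ExtAdj f lv n H B nw a b
  symm := ⟨fun a b ⟨hne, h⟩ => ⟨hne.symm, by
    cases h with
    | old h => exact .old h.symm
    | up h => exact .down h
    | down h => exact .up h
    | new h h' hz hn => exact .new h' h hz.symm hn.symm⟩⟩
  loopless := ⟨fun _ h => h.1 rfl⟩

/-- The vertices of the next stage. -/
def extSet (G : SimpleGraph V) (f : T → V) (lv : T → ℕ) (n : ℕ) (H : SimpleGraph T)
    (B : Set T) (nw : V → T → T) : Set T :=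
  B ∪ {y | ∃ z x, G.Open f lv n H B x z ∧ y = nw z x}

theorem le_extGraph (G : SimpleGraph V) (f : T → V) (lv : T → ℕ) (n : ℕ) (H : SimpleGraph T)
    (B : Set T) (nw : V → T → T) : H ≤ G.extGraph f lv n H B nw :=
  fun _ _ h => ⟨h.ne, .old h⟩

namespace IsStage

variable {G : SimpleGraph V} {f : T → V} {lv : T → ℕ} {n : ℕ} {H : SimpleGraph T} {B : Set T}
variable {nw : V → T → T}
variable (st : IsStage G f lv n H B) (hnw : IsNew G f lv n H B nw)
include st hnw

omit st in
theorem ext_up {x : T} {z : V} (h : G.Open f lv n H B x z) :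
    (G.extGraph f lv n H B nw).Adj x (nw z x) := by
  refine ⟨fun he => ?_, .up h⟩
  have := hnw.lv_eq z x h
  rw [← he, h.2.1] at this
  omega

omit st in
theorem ext_new {a b : T} {z z' : V} (ha : G.Open f lv n H B a z) (hb : G.Open f lv n H B b z')
    (hz : G.Adj z z') (hab : H.Near a b) :
    (G.extGraph f lv n H B nw).Adj (nw z a) (nw z' b) := by
  refine ⟨fun he => ?_, .new ha hb hz hab⟩
  have := congrArg f he
  rw [hnw.map z a ha, hnw.map z' b hb] at this
  exact hz.ne this

theorem nw_notMem {x : T} {z : V} (h : G.Open f lv n H B x z) : nw z x ∉ B := fun hB => by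
  have h1 := st.lv_le _ hB
  have h2 := hnw.lv_eq z x h
  omega

theorem ext_adj_of_mem {x y : T} (hx : x ∈ B) (h : (G.extGraph f lv n H B nw).Adj x y) :
    H.Adj x y ∨ ∃ z, G.Open f lv n H B x z ∧ y = nw z x := by
  obtain ⟨-, h⟩ := h
  cases h with
  | old h => exact Or.inl h
  | up h => exact Or.inr ⟨_, h, rfl⟩
  | down h => exact absurd hx (st.nw_notMem hnw h)
  | new h _ _ _ => exact absurd hx (st.nw_notMem hnw h)

theorem ext_adj_of_new {x y : T} {z : V} (hx : G.Open f lv n H B x z)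
    (h : (G.extGraph f lv n H B nw).Adj (nw z x) y) :
    (G.Open f lv n H B y z ∧ G.OpenEqv f lv n H B z x y) ∨
      ∃ z' x' x₁, G.Open f lv n H B x' z' ∧ G.Adj z z' ∧ G.OpenEqv f lv n H B z x x₁ ∧
        H.Near x₁ x' ∧ y = nw z' x' := by
  obtain ⟨-, h⟩ := h
  generalize hp : nw z x = p at h
  have key : ∀ {a : T} {w : V}, G.Open f lv n H B a w → nw z x = nw w a →
      w = z ∧ G.OpenEqv f lv n H B z x a := by
    intro a w ha he
    have := congrArg f he
    rw [hnw.map z x hx, hnw.map w a ha] at this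
    subst this
    exact ⟨rfl, hnw.eqv _ _ _ hx ha he⟩
  cases h with
  | old h => exact absurd (hp ▸ st.mem _ _ h) (st.nw_notMem hnw hx)
  | up h => exact absurd (hp ▸ h.1) (st.nw_notMem hnw hx)
  | down h =>
    obtain ⟨rfl, he⟩ := key h hp
    exact Or.inl ⟨h, he⟩
  | @new a b w w' h h' hz hn =>
    obtain ⟨rfl, he⟩ := key h hp
    exact Or.inr ⟨w', b, a, h', hz, he, hn, rfl⟩

omit hnw in
theorem ext_mem {x y : T} (h : (G.extGraph f lv n H B nw).Adj x y) :
    x ∈ B ∨ ∃ z x₀, G.Open f lv n H B x₀ z ∧ x = nw z x₀ := by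
  obtain ⟨-, h⟩ := h
  cases h with
  | old h => exact Or.inl (st.mem _ _ h)
  | up h => exact Or.inl h.1
  | down h => exact Or.inr ⟨_, _, h, rfl⟩
  | new h _ _ _ => exact Or.inr ⟨_, _, h, rfl⟩

theorem ext_hom {x y : T} (h : (G.extGraph f lv n H B nw).Adj x y) : G.Adj (f x) (f y) := by
  obtain ⟨-, h⟩ := h
  cases h with
  | old h => exact st.hom _ _ h
  | up h => rw [hnw.map _ _ h]; exact h.2.2.1
  | down h => rw [hnw.map _ _ h]; exact h.2.2.1.symm
  | new h h' hz _ => rwa [hnw.map _ _ h, hnw.map _ _ h']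

omit st hnw in
theorem lv_near {a b : T} {z z' : V} (ha : G.Open f lv n H B a z) (hb : G.Open f lv n H B b z')
    (h : H.Near a b) : H.Chain {x | lv x = n} 1 a b :=
  Chain.of_near (S := {x | lv x = n}) ha.2.1 hb.2.1 h

/-- The case of interest is a new vertex `x`. Its neighbours are connected through a chain on level
`n`: at most 2 inside the class of `x`, plus 1 for each neighbour that is itself new. The total of 4
is within the range of `near_of_chain` and `openEqv_of_chain`. -/
theorem ext_inj (hG : G.IsConed) {x y y' : T} (h : (G.extGraph f lv n H B nw).Adj x y)
    (h' : (G.extGraph f lv n H B nw).Adj x y') (hf : f y = f y') : y = y' := by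
  rcases st.ext_mem h with hx | ⟨z, x, hx, rfl⟩
  · rcases st.ext_adj_of_mem hnw hx h with h | ⟨z, hz, rfl⟩ <;>
      rcases st.ext_adj_of_mem hnw hx h' with h' | ⟨z', hz', rfl⟩
    · exact st.inj x _ _ h h' hf
    · rw [hnw.map _ _ hz'] at hf
      exact absurd hf (hz'.2.2.2 _ h)
    · rw [hnw.map _ _ hz] at hf
      exact absurd hf.symm (hz.2.2.2 _ h')
    · rw [hnw.map _ _ hz, hnw.map _ _ hz'] at hf
      rw [hf]
  · have mixed : ∀ {y x' x₁ : T} {z' : V}, G.Open f lv n H B y z → G.OpenEqv f lv n H B z x y →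
        G.Open f lv n H B x' z' → G.OpenEqv f lv n H B z x x₁ → H.Near x₁ x' → f y ≠ z' := by
      rintro y x' x₁ _ hy hxy hx' hxx₁ hn rfl
      have c := (lv_near (open_of_openEqv hxx₁ hx) hx' hn).symm.trans
        (st.chain_of_openEqv hG (open_of_openEqv hxx₁ hx) ((openEqv_symm hxx₁).trans hxy))
      rcases st.near_of_chain hG (by omega) c (Or.inr hx'.2.2.1) with he | he
      · exact hx'.2.2.1.ne (congrArg f he)
      · exact hx'.2.2.2 _ he rfl
    rcases st.ext_adj_of_new hnw hx h with ⟨hy, hxy⟩ | ⟨z₁, x₁, w₁, hx₁, hz₁, he₁, hn₁, rfl⟩ <;>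
      rcases st.ext_adj_of_new hnw hx h' with ⟨hy', hxy'⟩ | ⟨z₂, x₂, w₂, hx₂, hz₂, he₂, hn₂, rfl⟩
    · have c := st.chain_of_openEqv hG hy ((openEqv_symm hxy).trans hxy')
      rcases st.near_of_chain hG (by omega) c (Or.inl hf) with he | he
      · exact he
      · exact absurd hf (st.hom _ _ he).ne
    · rw [hnw.map _ _ hx₂] at hf
      exact absurd hf (mixed hy hxy hx₂ he₂ hn₂)
    · rw [hnw.map _ _ hx₁] at hf
      exact absurd hf.symm (mixed hy' hxy' hx₁ he₁ hn₁)
    · rw [hnw.map _ _ hx₁, hnw.map _ _ hx₂] at hf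
      subst hf
      have hw₁ := open_of_openEqv he₁ hx
      have hw₂ := open_of_openEqv he₂ hx
      have c := ((lv_near hw₁ hx₁ hn₁).symm.trans
        (st.chain_of_openEqv hG hw₁ ((openEqv_symm he₁).trans he₂))).trans (lv_near hw₂ hx₂ hn₂)
      exact hnw.eq _ _ _ hx₁ (st.openEqv_of_chain hG (by omega) c hx₁ hx₂.2.2.1)

/-- The chains are those used for injectivity. Two new neighbours of a new vertex give length 1 + 2
+ 1 = 4, exactly what `openAdj_of_chain` permits. -/
theorem ext_full (hG : G.IsConed) {x y y' : T} (h : (G.extGraph f lv n H B nw).Adj x y)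
    (h' : (G.extGraph f lv n H B nw).Adj x y') (hf : G.Adj (f y) (f y')) :
    (G.extGraph f lv n H B nw).Adj y y' := by
  rcases st.ext_mem h with hx | ⟨z, x, hx, rfl⟩
  · have mixed : ∀ {y : T} {z : V}, H.Adj x y → G.Open f lv n H B x z → G.Adj (f y) z →
        (G.extGraph f lv n H B nw).Adj y (nw z x) := by
      intro y z hxy hz hyz
      have hy := st.open_adj hz hxy (st.lv_eq_of_open hz hxy hyz) hyz
      rw [hnw.eq _ _ _ hz (.single ⟨hz, hy, hxy⟩)]
      exact ext_up hnw hy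
    rcases st.ext_adj_of_mem hnw hx h with h | ⟨z, hz, rfl⟩ <;>
      rcases st.ext_adj_of_mem hnw hx h' with h' | ⟨z', hz', rfl⟩
    · exact le_extGraph _ _ _ _ _ _ _ (st.full x _ _ h h' hf)
    · rw [hnw.map _ _ hz'] at hf
      exact mixed h hz' hf
    · rw [hnw.map _ _ hz] at hf
      exact (mixed h' hz hf.symm).symm
    · rw [hnw.map _ _ hz, hnw.map _ _ hz'] at hf
      exact ext_new hnw hz hz' hf (Near.refl _)
  · have mixed : ∀ {y x' x₁ : T} {z' : V}, G.Open f lv n H B y z → G.OpenEqv f lv n H B z x y →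
        G.Open f lv n H B x' z' → G.OpenEqv f lv n H B z x x₁ → H.Near x₁ x' →
        G.Adj (f y) z' → (G.extGraph f lv n H B nw).Adj y (nw z' x') := by
      intro y x' x₁ z' hy hxy hx' hxx₁ hn hyz
      have c := (lv_near (open_of_openEqv hxx₁ hx) hx' hn).symm.trans
        (st.chain_of_openEqv hG (open_of_openEqv hxx₁ hx) ((openEqv_symm hxx₁).trans hxy))
      have he := st.openEqv_of_chain hG (by omega) c hx' hyz
      rw [hnw.eq _ _ _ hx' he]
      exact ext_up hnw (open_of_openEqv he hx')
    rcases st.ext_adj_of_new hnw hx h with ⟨hy, hxy⟩ | ⟨z₁, x₁, w₁, hx₁, hz₁, he₁, hn₁, rfl⟩ <;>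
      rcases st.ext_adj_of_new hnw hx h' with ⟨hy', hxy'⟩ | ⟨z₂, x₂, w₂, hx₂, hz₂, he₂, hn₂, rfl⟩
    · have c := st.chain_of_openEqv hG hy ((openEqv_symm hxy).trans hxy')
      rcases st.near_of_chain hG (by omega) c (Or.inr hf) with he | he
      · exact absurd (congrArg f he) hf.ne
      · exact le_extGraph _ _ _ _ _ _ _ he
    · rw [hnw.map _ _ hx₂] at hf
      exact mixed hy hxy hx₂ he₂ hn₂ hf
    · rw [hnw.map _ _ hx₁] at hf
      exact (mixed hy' hxy' hx₁ he₁ hn₁ hf.symm).symm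
    · rw [hnw.map _ _ hx₁, hnw.map _ _ hx₂] at hf
      have hw₁ := open_of_openEqv he₁ hx
      have hw₂ := open_of_openEqv he₂ hx
      have c := ((lv_near hw₁ hx₁ hn₁).symm.trans
        (st.chain_of_openEqv hG hw₁ ((openEqv_symm he₁).trans he₂))).trans (lv_near hw₂ hx₂ hn₂)
      obtain ⟨y₁, y₂, hn, h₁, h₂⟩ := st.openAdj_of_chain hG (by omega) c hx₁ hx₂ hf
      rw [hnw.eq _ _ _ hx₁ h₁, hnw.eq _ _ _ hx₂ h₂]
      exact ext_new hnw (open_of_openEqv h₁ hx₁) (open_of_openEqv h₂ hx₂) hf hn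

omit st hnw in
theorem ext_dn {a r : T} (h : H.Dn lv a r) : (G.extGraph f lv n H B nw).Dn lv a r :=
  ⟨le_extGraph _ _ _ _ _ _ _ h.1, h.2⟩

omit st hnw in
theorem ext_strong {a b : T} (h : H.Strong lv a b) : (G.extGraph f lv n H B nw).Strong lv a b :=
  ⟨le_extGraph _ _ _ _ _ _ _ h.1, h.2.imp fun _ h => ⟨ext_dn h.1, ext_dn h.2⟩⟩

omit st hnw in
theorem ext_near {a b : T} (h : H.Near a b) : (G.extGraph f lv n H B nw).Near a b :=
  h.imp_right fun h => le_extGraph _ _ _ _ _ _ _ h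

theorem dn_of_ext_dn {a r : T} (ha : a ∈ B) (h : (G.extGraph f lv n H B nw).Dn lv a r) :
    H.Dn lv a r := by
  refine ⟨?_, h.2⟩
  rcases st.ext_adj_of_mem hnw ha h.1 with h' | ⟨z, hz, rfl⟩
  · exact h'
  · have h1 := h.2
    rw [hnw.lv_eq _ _ hz, hz.2.1] at h1
    omega

/-- The next stage of the construction of the covering. -/
theorem extend (hG : G.IsConed) :
    IsStage G f lv (n + 1) (G.extGraph f lv n H B nw) (G.extSet f lv n H B nw) where
  lv_le := by
    rintro x (hx | ⟨z, x, hx, rfl⟩)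
    · have := st.lv_le x hx
      omega
    · exact (hnw.lv_eq _ _ hx).le
  mem := fun x y h => st.ext_mem h
  hom := fun x y h => st.ext_hom hnw h
  lv_adj := by
    rintro x y ⟨-, h⟩
    cases h with
    | old h => exact st.lv_adj _ _ h
    | up h => rw [hnw.lv_eq _ _ h, h.2.1]; omega
    | down h => rw [hnw.lv_eq _ _ h, h.2.1]
    | new h h' _ _ => rw [hnw.lv_eq _ _ h, hnw.lv_eq _ _ h']; omega
  inj := fun x y y' h h' hf => st.ext_inj hnw hG h h' hf
  full := fun x y y' h h' hf => st.ext_full hnw hG h h' hf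
  surj := by
    rintro x (hx | ⟨z, x, hx, rfl⟩) hlv z' hz'
    · by_cases hex : ∃ y, H.Adj x y ∧ f y = z'
      · exact hex.imp fun y hy => ⟨le_extGraph _ _ _ _ _ _ _ hy.1, hy.2⟩
      push Not at hex
      have hop : G.Open f lv n H B x z' := by
        refine ⟨hx, ?_, hz', hex⟩
        by_contra hne
        obtain ⟨y, hy, hy'⟩ := st.surj x hx (by omega) z' hz'
        exact hex y hy hy'
      exact ⟨_, ext_up hnw hop, hnw.map _ _ hop⟩
    · rw [hnw.lv_eq _ _ hx] at hlv
      omega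
  down := by
    rintro x (hx | ⟨z, x, hx, rfl⟩) hlv
    · exact (st.down x hx hlv).imp fun _ h => ext_dn h
    · exact ⟨x, (ext_up hnw hx).symm, by rw [hnw.lv_eq _ _ hx, hx.2.1]⟩
  zero := by
    rintro x (hx | ⟨z, x, hx, rfl⟩) y (hy | ⟨z', y, hy, rfl⟩) h0 h1
    · exact st.zero x hx y hy h0 h1
    · rw [hnw.lv_eq _ _ hy] at h1
      omega
    · rw [hnw.lv_eq _ _ hx] at h0
      omega
    · rw [hnw.lv_eq _ _ hx] at h0
      omega
  edge := by
    rintro x y ⟨-, h⟩ hlv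
    cases h with
    | old h =>
      obtain ⟨r, r', hr, hr', hn⟩ := st.edge x y h hlv
      exact ⟨r, r', ext_dn hr, ext_dn hr', ext_near hn⟩
    | up h => rw [hnw.lv_eq _ _ h, h.2.1] at hlv; omega
    | down h => rw [hnw.lv_eq _ _ h, h.2.1] at hlv; omega
    | @new a b z z' h h' _ hn =>
      exact ⟨a, b, ⟨(ext_up hnw h).symm, by rw [hnw.lv_eq _ _ h, h.2.1]⟩,
        ⟨(ext_up hnw h').symm, by rw [hnw.lv_eq _ _ h', h'.2.1]⟩, ext_near hn⟩
  vert := by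
    intro v u u' hu hu'
    rcases st.ext_mem hu.1 with hv | ⟨z, x, hx, rfl⟩
    · rcases st.vert v u u' (st.dn_of_ext_dn hnw hv hu) (st.dn_of_ext_dn hnw hv hu') with
        h | ⟨y, hy, h, h'⟩
      · exact Or.inl (ext_near h)
      · exact Or.inr ⟨y, ext_dn hy, ext_strong h, ext_strong h'⟩
    · have key : ∀ {u : T}, (G.extGraph f lv n H B nw).Dn lv (nw z x) u →
          G.Open f lv n H B u z ∧ G.OpenEqv f lv n H B z x u := by
        intro u hu
        rcases st.ext_adj_of_new hnw hx hu.1 with h | ⟨z', x', _, hx', _, _, _, rfl⟩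
        · exact h
        · have := hu.2
          rw [hnw.lv_eq _ _ hx, hnw.lv_eq _ _ hx'] at this
          omega
      obtain ⟨ho, he⟩ := key hu
      obtain ⟨ho', he'⟩ := key hu'
      -- The lower neighbours of a new vertex form one class, so the vertex condition is the
      -- description of classes by joins.
      rcases st.openJoin_of_openEqv hG ho ((openEqv_symm he).trans he') with h | ⟨y, hy, h, h'⟩
      · exact Or.inl (ext_near h)
      · have hxy : G.OpenEqv f lv n H B z x y := he.tail ⟨ho, hy, h.1⟩
        refine Or.inr ⟨y, ⟨?_, by rw [hnw.lv_eq _ _ hx, hy.2.1]⟩, ext_strong h, ext_strong h'⟩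
        rw [hnw.eq _ _ _ hx hxy]
        exact (ext_up hnw hy).symm

end IsStage

end SimpleGraph

/-! ### The full covering and the lifting of walks. -/

namespace SimpleGraph

variable {V T : Type*}

/-- A covering of `G` by the graph `H` on the vertices `B`, with root `o`, levelled by `lv`. -/
structure IsLayeredCover (G : SimpleGraph V) (f : T → V) (lv : T → ℕ) (o : T) (H : SimpleGraph T)
    (B : Set T) : Prop where
  root : o ∈ B
  lv_root : lv o = 0
  mem : ∀ x y, H.Adj x y → x ∈ B
  hom : ∀ x y, H.Adj x y → G.Adj (f x) (f y)
  lv_adj : ∀ x y, H.Adj x y → lv x ≤ lv y + 1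
  inj : ∀ x y y', H.Adj x y → H.Adj x y' → f y = f y' → y = y'
  full : ∀ x y y', H.Adj x y → H.Adj x y' → G.Adj (f y) (f y') → H.Adj y y'
  surj : ∀ x ∈ B, ∀ z, G.Adj (f x) z → ∃ y, H.Adj x y ∧ f y = z
  down : ∀ x ∈ B, lv x ≠ 0 → ∃ y, H.Dn lv x y
  zero : ∀ x ∈ B, ∀ y ∈ B, lv x = 0 → lv y = 0 → x = y
  edge : H.EdgeCond lv
  vert : H.VertCond lv

section Construction

variable (G : SimpleGraph V) (f : T → V) (lv : T → ℕ)

theorem isStage_zero {o : T} (ho : lv o = 0) : IsStage G f lv 0 ⊥ {o} where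
  lv_le := by rintro x rfl; exact ho.le
  mem := by simp
  hom := by simp
  lv_adj := by simp
  inj := by simp
  full := by simp
  surj := by simp
  down := by rintro x rfl h; exact absurd ho h
  zero := by rintro x rfl y rfl _ _; rfl
  edge := by rintro x y h; exact absurd h (by simp)
  vert := by rintro v u u' h; exact absurd h.1 (by simp)

/-- The new vertex over `z` attached to the class of `x`. -/
noncomputable def consNew (f : List V → V) (n : ℕ) (H : SimpleGraph (List V)) (B : Set (List V))
    (z : V) (x : List V) : List V :=
  -- A covering vertex is a list: the head is its image, the tail a chosen carrier from the class,
  -- and the length its level.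
  z :: Classical.epsilon (G.OpenEqv f List.length n H B z x)

theorem isNew_consNew {O : V} {n : ℕ} {H : SimpleGraph (List V)} {B : Set (List V)} :
    IsNew G (fun l => l.headD O) List.length n H B
      (G.consNew (fun l => l.headD O) n H B) := by
  have key : ∀ z x, G.OpenEqv (fun l => l.headD O) List.length n H B z x
      (Classical.epsilon (G.OpenEqv (fun l => l.headD O) List.length n H B z x)) :=
    fun z x => Classical.epsilon_spec ⟨x, .refl⟩
  refine ⟨fun z x _ => rfl, fun z x h => ?_, fun z x x' _ _ h => ?_, fun z x x' _ h => ?_⟩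
  · exact congrArg (· + 1) (IsStage.open_of_openEqv (key z x) h).2.1
  · have h1 := key z x
    rw [(List.cons.inj h).2] at h1
    exact h1.trans (IsStage.openEqv_symm (key z x'))
  · have : G.OpenEqv (fun l => l.headD O) List.length n H B z x =
        G.OpenEqv (fun l => l.headD O) List.length n H B z x' :=
      funext fun y => propext ⟨(IsStage.openEqv_symm h).trans, h.trans⟩
    unfold consNew
    rw [this]

/-- The stages of the construction of the covering. -/
noncomputable def coverStage (f : List V → V) : ℕ → SimpleGraph (List V) × Set (List V)
  | 0 => (⊥, {[]})
  | n + 1 =>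
    (G.extGraph f List.length n (coverStage f n).1 (coverStage f n).2
      (G.consNew f n (coverStage f n).1 (coverStage f n).2),
     G.extSet f List.length n (coverStage f n).1 (coverStage f n).2
      (G.consNew f n (coverStage f n).1 (coverStage f n).2))

theorem isStage_coverStage (hG : G.IsConed) (O : V) (n : ℕ) :
    IsStage G (fun l => l.headD O) List.length n (G.coverStage (fun l => l.headD O) n).1
      (G.coverStage (fun l => l.headD O) n).2 := by
  induction n with
  | zero => exact G.isStage_zero _ _ rfl
  | succ n ih => exact ih.extend G.isNew_consNew hG

theorem coverStage_fst_mono (f : List V → V) : Monotone fun n => (G.coverStage f n).1 :=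
  monotone_nat_of_le_succ fun _ => le_extGraph _ _ _ _ _ _ _

theorem coverStage_snd_mono (f : List V → V) : Monotone fun n => (G.coverStage f n).2 :=
  monotone_nat_of_le_succ fun _ => Set.subset_union_left

/-- The union of the stages. -/
def coverGraph (f : List V → V) : SimpleGraph (List V) where
  Adj a b := ∃ n, (G.coverStage f n).1.Adj a b
  symm := ⟨fun _ _ ⟨n, h⟩ => ⟨n, h.symm⟩⟩
  loopless := ⟨fun _ ⟨_, h⟩ => h.ne rfl⟩

theorem exists_isLayeredCover (hG : G.IsConed) (O : V) :
    IsLayeredCover G (fun l : List V => l.headD O) List.length []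
      (G.coverGraph fun l => l.headD O) {x | ∃ n, x ∈ (G.coverStage (fun l => l.headD O) n).2} := by
  -- The root `[]` has no head; the default value sends it to the base vertex.
  set f : List V → V := fun l => l.headD O with hf
  have st := G.isStage_coverStage hG O
  rw [← hf] at st
  have adj_mono : ∀ {m n a b}, m ≤ n → (G.coverStage f m).1.Adj a b →
      (G.coverStage f n).1.Adj a b := fun h h' => G.coverStage_fst_mono f h h'
  have mem_mono : ∀ {m n a}, m ≤ n → a ∈ (G.coverStage f m).2 → a ∈ (G.coverStage f n).2 :=
    fun h h' => G.coverStage_snd_mono f h h'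
  have le_cover : ∀ n, (G.coverStage f n).1 ≤ G.coverGraph f := fun n _ _ h => ⟨n, h⟩
  have dn : ∀ {n a b}, (G.coverStage f n).1.Dn List.length a b →
      (G.coverGraph f).Dn List.length a b := fun h => ⟨le_cover _ h.1, h.2⟩
  have near : ∀ {n a b}, (G.coverStage f n).1.Near a b → (G.coverGraph f).Near a b :=
    fun h => h.imp_right fun h => le_cover _ h
  have strong : ∀ {n a b}, (G.coverStage f n).1.Strong List.length a b →
      (G.coverGraph f).Strong List.length a b :=
    fun h => ⟨le_cover _ h.1, h.2.imp fun _ h => ⟨dn h.1, dn h.2⟩⟩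
  exact {
    root := ⟨0, rfl⟩
    lv_root := rfl
    mem := fun x y ⟨n, h⟩ => ⟨n, (st n).mem x y h⟩
    hom := fun x y ⟨n, h⟩ => (st n).hom x y h
    lv_adj := fun x y ⟨n, h⟩ => (st n).lv_adj x y h
    inj := fun x y y' ⟨m, h⟩ ⟨n, h'⟩ he =>
      (st (max m n)).inj x y y' (adj_mono (le_max_left _ _) h) (adj_mono (le_max_right _ _) h') he
    full := fun x y y' ⟨m, h⟩ ⟨n, h'⟩ he => ⟨max m n, (st (max m n)).full x y y'
      (adj_mono (le_max_left _ _) h) (adj_mono (le_max_right _ _) h') he⟩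
    surj := fun x ⟨n, h⟩ z hz => by
      -- A vertex of level `n` has all its neighbours only from stage `n + 1` on.
      obtain ⟨y, hy, hy'⟩ := (st (n + 1)).surj x (mem_mono (by omega) h)
        (Nat.lt_succ_of_le ((st n).lv_le x h)) z hz
      exact ⟨y, ⟨_, hy⟩, hy'⟩
    down := fun x ⟨n, h⟩ h0 => ((st n).down x h h0).imp fun _ h => dn h
    zero := fun x ⟨m, h⟩ y ⟨n, h'⟩ => (st (max m n)).zero x (mem_mono (le_max_left _ _) h) y
      (mem_mono (le_max_right _ _) h')
    edge := fun x y ⟨n, h⟩ he => by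
      obtain ⟨r, r', hr, hr', hn⟩ := (st n).edge x y h he
      exact ⟨r, r', dn hr, dn hr', near hn⟩
    vert := by
      rintro v u u' ⟨⟨m, h⟩, hl⟩ ⟨⟨n, h'⟩, hl'⟩
      rcases (st (max m n)).vert v u u' ⟨adj_mono (le_max_left _ _) h, hl⟩
        ⟨adj_mono (le_max_right _ _) h', hl'⟩ with h | ⟨x, hx, h, h'⟩
      · exact Or.inl (near h)
      · exact Or.inr ⟨x, dn hx, strong h, strong h'⟩ }

end Construction

section Lifting

variable {G : SimpleGraph V} (f : T → V) (H : SimpleGraph T)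

/-- The walk `p` lifts to a walk of `H` from `x` to `y`. -/
def Lifts : ∀ {u v : V}, G.Walk u v → T → T → Prop
  | _, _, .nil, x, y => x = y
  | _, _, @Walk.cons _ _ _ w _ _ p, x, y => ∃ x', H.Adj x x' ∧ f x' = w ∧ Lifts p x' y

variable {f H}

theorem lifts_append {u v w : V} (p : G.Walk u v) (q : G.Walk v w) (x z : T) :
    Lifts f H (p.append q) x z ↔ ∃ y, Lifts f H p x y ∧ Lifts f H q y z := by
  induction p generalizing x with
  | nil => simp [Lifts]
  | cons h p ih => simp only [Walk.cons_append, Lifts, ih]; grind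

theorem lifts_reverse {u v : V} (p : G.Walk u v) {x y : T} (hx : f x = u)
    (h : Lifts f H p x y) : Lifts f H p.reverse y x := by
  induction p generalizing x with
  | nil => exact h.symm
  | cons h' p ih =>
    obtain ⟨x', hxx', hx', h⟩ := h
    rw [Walk.reverse_cons, lifts_append]
    exact ⟨x', ih hx' h, x, hxx'.symm, hx, rfl⟩

theorem map_of_lifts {u v : V} (p : G.Walk u v) {x y : T} (hx : f x = u)
    (h : Lifts f H p x y) : f y = v := by
  induction p generalizing x with
  | nil => exact h ▸ hx
  | cons h' p ih =>
    obtain ⟨x', hxx', hx', h⟩ := h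
    exact ih hx' h

namespace IsLayeredCover

variable {lv : T → ℕ} {o : T} {B : Set T} (hc : IsLayeredCover G f lv o H B)
include hc

theorem exists_lifts {u v : V} (p : G.Walk u v) {x : T} (hxB : x ∈ B) (hx : f x = u) :
    ∃ y ∈ B, Lifts f H p x y := by
  induction p generalizing x with
  | nil => exact ⟨x, hxB, rfl⟩
  | @cons u v w h p ih =>
    obtain ⟨x', hxx', hx'⟩ := hc.surj x hxB v (hx ▸ h)
    obtain ⟨y, hy, h⟩ := ih (hc.mem _ _ hxx'.symm) hx'
    exact ⟨y, hy, x', hxx', hx', h⟩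

theorem lifts_unique {u v : V} (p : G.Walk u v) {x y y' : T} (h : Lifts f H p x y)
    (h' : Lifts f H p x y') : y = y' := by
  induction p generalizing x with
  | nil => exact h.symm.trans h'
  | cons e p ih =>
    obtain ⟨x₁, hx₁, he₁, h⟩ := h
    obtain ⟨x₂, hx₂, he₂, h'⟩ := h'
    obtain rfl := hc.inj _ _ _ hx₁ hx₂ (he₁.trans he₂.symm)
    exact ih h h'

theorem mem_of_lifts {u v : V} (p : G.Walk u v) {x y : T} (hxB : x ∈ B)
    (h : Lifts f H p x y) : y ∈ B := by
  induction p generalizing x with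
  | nil => exact h ▸ hxB
  | cons e p ih =>
    obtain ⟨x₁, hx₁, he₁, h⟩ := h
    exact ih (hc.mem _ _ hx₁.symm) h

theorem exists_walk_lifts {x : T} (hx : x ∈ B) :
    ∃ p : G.Walk (f o) (f x), p.length = lv x ∧ Lifts f H p o x := by
  induction hn : lv x generalizing x with
  | zero =>
    obtain rfl := hc.zero x hx o hc.root hn hc.lv_root
    exact ⟨.nil, rfl, rfl⟩
  | succ n ih =>
    obtain ⟨y, hxy, hl⟩ := hc.down x hx (by omega)
    obtain ⟨p, hp, h⟩ := ih (hc.mem _ _ hxy.symm) (by omega)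
    refine ⟨p.append (.cons (hc.hom _ _ hxy.symm) .nil), by simp [hp], ?_⟩
    rw [lifts_append]
    exact ⟨y, h, x, hxy.symm, rfl, rfl⟩

theorem lv_le_of_lifts {u v : V} (p : G.Walk u v) {x y : T} (h : Lifts f H p x y) :
    lv y ≤ lv x + p.length := by
  induction p generalizing x with
  | nil => rw [show x = y from h]; simp
  | cons e p ih =>
    obtain ⟨x₁, hx₁, he₁, h⟩ := h
    have h1 := ih h
    have h2 := hc.lv_adj _ _ hx₁.symm
    rw [Walk.length_cons]
    omega

/-- If the projection is injective, the levels are the distances to the base point. -/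
theorem conditions (hconn : G.Connected) (hinj : Set.InjOn f B) :
    G.EdgeCond (G.dist (f o)) ∧ G.VertCond (G.dist (f o)) := by
  have hsurj : ∀ v, ∃ x ∈ B, f x = v := by
    intro v
    obtain ⟨p⟩ := hconn (f o) v
    obtain ⟨y, hy, h⟩ := hc.exists_lifts p hc.root rfl
    exact ⟨y, hy, map_of_lifts p rfl h⟩
  have hdist : ∀ x ∈ B, G.dist (f o) (f x) = lv x := by
    intro x hx
    apply le_antisymm
    · obtain ⟨p, hp, -⟩ := hc.exists_walk_lifts hx
      exact hp ▸ dist_le p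
    · obtain ⟨p, hp⟩ := hconn.exists_walk_length_eq_dist (f o) (f x)
      obtain ⟨y, hy, h⟩ := hc.exists_lifts p hc.root rfl
      have h1 := hc.lv_le_of_lifts p h
      rw [hinj hy hx (map_of_lifts p rfl h), hc.lv_root] at h1
      omega
  have hadj : ∀ x ∈ B, ∀ y ∈ B, G.Adj (f x) (f y) → H.Adj x y := by
    intro x hx y hy h
    obtain ⟨y', hy', he⟩ := hc.surj x hx _ h
    rwa [← hinj (hc.mem _ _ hy'.symm) hy he]
  have hdn : ∀ {x y}, H.Dn lv x y → G.Dn (G.dist (f o)) (f x) (f y) := by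
    intro x y h
    refine ⟨hc.hom _ _ h.1, ?_⟩
    rw [hdist x (hc.mem _ _ h.1), hdist y (hc.mem _ _ h.1.symm), h.2]
  have hdn' : ∀ x ∈ B, ∀ y ∈ B, G.Dn (G.dist (f o)) (f x) (f y) → H.Dn lv x y := by
    intro x hx y hy h
    refine ⟨hadj x hx y hy h.1, ?_⟩
    rw [← hdist x hx, ← hdist y hy, h.2]
  have hnear : ∀ {x y}, H.Near x y → G.Near (f x) (f y) :=
    fun h => h.imp (congrArg f) (hc.hom _ _)
  have hstrong : ∀ {x y}, H.Strong lv x y → G.Strong (G.dist (f o)) (f x) (f y) := by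
    rintro x y ⟨h, r, hr, hr'⟩
    exact ⟨hc.hom _ _ h, f r, hdn hr, hdn hr'⟩
  constructor
  · intro u v huv hl
    obtain ⟨x, hx, rfl⟩ := hsurj u
    obtain ⟨y, hy, rfl⟩ := hsurj v
    rw [hdist x hx, hdist y hy] at hl
    obtain ⟨r, r', hr, hr', hn⟩ := hc.edge x y (hadj x hx y hy huv) hl
    exact ⟨f r, f r', hdn hr, hdn hr', hnear hn⟩
  · intro v u u' hu hu'
    obtain ⟨v, hv, rfl⟩ := hsurj v
    obtain ⟨u, huB, rfl⟩ := hsurj u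
    obtain ⟨u', huB', rfl⟩ := hsurj u'
    rcases hc.vert v u u' (hdn' _ hv _ huB hu) (hdn' _ hv _ huB' hu') with h | ⟨x, hx, h, h'⟩
    · exact Or.inl (hnear h)
    · exact Or.inr ⟨f x, hdn hx, hstrong h, hstrong h'⟩

end IsLayeredCover

end Lifting

end SimpleGraph

/-! ### Homotopy invariance of lifts, and injectivity of the projection. -/

namespace AbstractSimplicialComplex

open SimpleGraph

variable {V T : Type*} {X : AbstractSimplicialComplex V}

/-- A backtracking lifts to a backtracking by `inj`, and a triangle lifts to a triangle by `full`;
`surj` supplies the vertex to be inserted. -/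
theorem lifts_iff_of_edgeHomotopic {f : T → V} {lv : T → ℕ} {o : T} {H : SimpleGraph T} {B : Set T}
    (hc : IsLayeredCover X.oneSkeleton f lv o H B) {u v : V} {p q : X.oneSkeleton.Walk u v}
    (h : X.EdgeHomotopic p q) {x y : T} (hx : x ∈ B) (hxu : f x = u) :
    Lifts f H p x y ↔ Lifts f H q x y := by
  induction h generalizing x y with
  | refl _ => exact Iff.rfl
  | symm _ ih => exact (ih hx hxu).symm
  | trans _ _ ih ih' => exact (ih hx hxu).trans (ih' hx hxu)
  | @append u v w p p' q q' _ _ ih ih' =>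
    rw [lifts_append, lifts_append]
    constructor
    · rintro ⟨z, h, h'⟩
      exact ⟨z, (ih hx hxu).1 h, (ih' (hc.mem_of_lifts p hx h) (map_of_lifts p hxu h)).1 h'⟩
    · rintro ⟨z, h, h'⟩
      exact ⟨z, (ih hx hxu).2 h, (ih' (hc.mem_of_lifts p' hx h) (map_of_lifts p' hxu h)).2 h'⟩
  | @backtrack u v h =>
    constructor
    · rintro ⟨x₁, h₁, e₁, x₂, h₂, e₂, rfl⟩
      exact hc.inj _ _ _ h₁.symm h₂ (hxu.trans e₂.symm)
    · rintro rfl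
      obtain ⟨x₁, h₁, e₁⟩ := hc.surj x hx v (hxu ▸ h)
      exact ⟨x₁, h₁, e₁, x, h₁.symm, hxu, rfl⟩
  | @triangle u v w huv hvw huw _ =>
    constructor
    · rintro ⟨x₁, h₁, e₁, x₂, h₂, e₂, rfl⟩
      exact ⟨x₂, hc.full _ _ _ h₁.symm h₂ (by rwa [hxu, e₂]), e₂, rfl⟩
    · rintro ⟨x₂, h₂, e₂, rfl⟩
      obtain ⟨x₁, h₁, e₁⟩ := hc.surj x hx v (hxu ▸ huv)
      exact ⟨x₁, h₁, e₁, x₂, hc.full _ _ _ h₁ h₂ (by rwa [e₁, e₂]), e₂, rfl⟩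

/-- Walks from the root to two points over the same vertex project to a closed path. It is trivial,
so its lift closes up, and uniqueness of lifts identifies the points. -/
theorem injOn_of_isLayeredCover (hsc : X.IsSimplyConnected) {f : T → V} {lv : T → ℕ} {o : T}
    {H : SimpleGraph T} {B : Set T} (hc : IsLayeredCover X.oneSkeleton f lv o H B) :
    Set.InjOn f B := by
  intro x hx y hy hxy
  obtain ⟨p, -, hp⟩ := hc.exists_walk_lifts hx
  obtain ⟨q, -, hq⟩ := hc.exists_walk_lifts hy
  have hq' := lifts_reverse q rfl hq
  generalize hw : f y = w at q hq hq' hxy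
  subst hxy
  obtain ⟨z, hz, hz'⟩ := hc.exists_lifts q.reverse hx rfl
  have h : Lifts f H (p.append q.reverse) o z := (lifts_append _ _ _ _).2 ⟨x, hp, hz'⟩
  obtain rfl : o = z := (lifts_iff_of_edgeHomotopic hc (hsc.2 _ (p.append q.reverse))
    hc.root rfl).1 h
  have hzq := lifts_reverse q.reverse rfl hz'
  rw [Walk.reverse_reverse] at hzq
  exact hc.lifts_unique q hzq hq

/-- The edge condition and the vertex condition for the distance to any vertex. -/
theorem edgeCond_and_vertCond (hsc : X.IsSimplyConnected) (hloc : X.IsLocated 8) (O : V) :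
    X.oneSkeleton.EdgeCond (X.oneSkeleton.dist O) ∧
      X.oneSkeleton.VertCond (X.oneSkeleton.dist O) := by
  have hc := exists_isLayeredCover X.oneSkeleton (isConed_oneSkeleton hsc hloc) O
  exact hc.conditions hsc.1 (injOn_of_isLayeredCover hsc hc)

end AbstractSimplicialComplex

/-! ### Lower neighbours of near vertices. -/

namespace SimpleGraph

variable {V : Type*}

/-- A coned graph whose vertices are levelled, with the edge condition and the vertex condition. -/
structure IsLayered (G : SimpleGraph V) (lv : V → ℕ) : Prop where
  coned : G.IsConed
  lv_adj : ∀ x y, G.Adj x y → lv x ≤ lv y + 1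
  down : ∀ x, lv x ≠ 0 → ∃ y, G.Dn lv x y
  edge : G.EdgeCond lv
  vert : G.VertCond lv

/-- The vertices `v` and `v'` are equal or have lower neighbours which are near each other. -/
def LowerNear (G : SimpleGraph V) (lv : V → ℕ) (v v' : V) : Prop :=
  v = v' ∨ ∃ r r', G.Dn lv v r ∧ G.Dn lv v' r' ∧ G.Near r r'

theorem LowerNear.symm {G : SimpleGraph V} {lv : V → ℕ} {v v' : V} (h : G.LowerNear lv v v') :
    G.LowerNear lv v' v :=
  h.imp Eq.symm fun ⟨r, r', hr, hr', hn⟩ => ⟨r', r, hr', hr, hn.symm⟩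

theorem IsIndPath.snoc {G : SimpleGraph V} {k : ℕ} {c : ℕ → V} {z : V} (hc : G.IsIndPath k c)
    (h : G.Adj (c k) z) (hfar : ∀ i, i < k → ¬ G.Near (c i) z) :
    G.IsIndPath (k + 1) fun i => if i ≤ k then c i else z :=
  IsStage.isIndPath_snoc hc h hfar

namespace IsLayered

variable {G : SimpleGraph V} {lv : V → ℕ} (L : G.IsLayered lv)
include L

theorem far {a b : V} (h : lv a + 2 ≤ lv b ∨ lv b + 2 ≤ lv a) : ¬ G.Near a b := by
  rintro (rfl | hab)
  · omega
  · have h1 := L.lv_adj _ _ hab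
    have h2 := L.lv_adj _ _ hab.symm
    omega

omit L in
theorem not_near {a b : V} (h : lv a ≠ lv b) (hab : ¬ G.Adj a b) : ¬ G.Near a b := by
  rintro (rfl | h')
  · exact h rfl
  · exact hab h'

theorem lv_eq_of_adj {a b y : V} (hab : lv a = lv b + 2) (ha : G.Adj y a) (hb : G.Adj y b) :
    lv y = lv b + 1 := by
  have h1 := L.lv_adj _ _ ha.symm
  have h2 := L.lv_adj _ _ hb
  omega

theorem lowerNear_of_near {v v' : V} (h : G.Near v v') (hl : lv v = lv v') :
    G.LowerNear lv v v' :=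
  h.imp_right fun h => L.edge _ _ h hl

/-- There is no induced cycle running through four levels. -/
theorem not_lowerNear_of_tall {f f' v v' r r' : V} (hff : G.Near f f') (hl : lv f = lv f')
    (hv : G.Dn lv f v) (hv' : G.Dn lv f' v') (hr : G.Dn lv v r) (hr' : G.Dn lv v' r')
    (h1 : f = f' ∨ ¬ G.Adj v f' ∧ ¬ G.Adj v' f) (hvv : ¬ G.Near v v') (hrr : ¬ G.Near r r')
    (hrv : ¬ G.Adj r v') (hvr : ¬ G.Adj v r') : ¬ G.LowerNear lv r r' := by
  rintro (h | ⟨s, s', hs, hs', hss⟩)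
  · exact hrr (Or.inl h)
  have e1 := hv.2
  have e2 := hv'.2
  have e3 := hr.2
  have e4 := hr'.2
  have e5 := hs.2
  have e6 := hs'.2
  have hrv' : ¬ G.Near r v' := not_near (lv := lv) (by omega) hrv
  have hvr' : ¬ G.Near v r' := not_near (lv := lv) (by omega) hvr
  -- A bottom edge with a chord to `r` or `r'` is collapsed to a single vertex, which makes the
  -- cycle induced.
  have key : ∃ s s', G.Dn lv r s ∧ G.Dn lv r' s' ∧
      (s = s' ∨ G.Adj s s' ∧ ¬ G.Near r s' ∧ ¬ G.Near s r') := by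
    by_cases h : G.Adj r s'
    · exact ⟨s', s', ⟨h, by omega⟩, hs', Or.inl rfl⟩
    by_cases h' : G.Adj s r'
    · exact ⟨s, s, hs, ⟨h'.symm, by omega⟩, Or.inl rfl⟩
    · exact ⟨s, s', hs, hs', hss.imp_right fun h₀ => ⟨h₀, not_near (lv := lv) (by omega) h,
        not_near (lv := lv) (by omega) h'⟩⟩
  clear hss hs hs' e5 e6 s s'
  obtain ⟨s, s', hs, hs', hss⟩ := key
  have e5 := hs.2
  have e6 := hs'.2
  -- `f` and `s` are three levels apart, so no vertex is adjacent to both.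
  have tall : ∀ y, G.Adj y f → G.Adj y s → False := by
    intro y h h'
    have h1 := L.lv_adj _ _ h.symm
    have h2 := L.lv_adj _ _ h'
    omega
  have hffv : f = f' ∨ G.Adj f f' ∧ ¬ G.Near f v' ∧ ¬ G.Near v f' := by
    rcases h1 with h1 | ⟨h1, h2⟩
    · exact Or.inl h1
    · exact hff.imp_right fun h => ⟨h, not_near (lv := lv) (by omega) fun h => h2 h.symm,
        not_near (lv := lv) (by omega) h1⟩
  have a1 := hv.1
  have a2 := hr.1
  have a3 := hs.1
  have a4 := hs'.1.symm
  have a5 := hr'.1.symm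
  have a6 := hv'.1.symm
  rcases hffv with rfl | ⟨hff', hfv, hvf⟩ <;> rcases hss with rfl | ⟨hss, hrs, hsr⟩
  · obtain ⟨y, h, -, -, h', -⟩ := L.coned.cone6 a1 a2 a3 a4 a5 a6 (L.far (by omega))
      (L.far (by omega)) (L.far (by omega)) (L.far (by omega)) hvr' hvv hrr hrv' (L.far (by omega))
    exact tall y h h'
  · obtain ⟨y, h, -, -, h', -⟩ := L.coned.cone7 a1 a2 a3 hss a4 a5 a6 (L.far (by omega))
      (L.far (by omega)) (L.far (by omega)) (L.far (by omega)) (L.far (by omega))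
      (L.far (by omega)) hvr' hvv hrs hrr hrv' hsr (L.far (by omega)) (L.far (by omega))
    exact tall y h h'
  · obtain ⟨y, h, -, -, h', -⟩ := L.coned.cone7 a1 a2 a3 a4 a5 a6 hff'.symm (L.far (by omega))
      (L.far (by omega)) (L.far (by omega)) hfv (L.far (by omega)) hvr' hvv hvf hrr hrv'
      (L.far (by omega)) (L.far (by omega)) (L.far (by omega)) (L.far (by omega))
    exact tall y h h'
  · obtain ⟨y, h, -, -, h', -⟩ := L.coned.cone8 a1 a2 a3 hss a4 a5 a6 hff'.symm (L.far (by omega))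
      (L.far (by omega)) (L.far (by omega)) (L.far (by omega)) hfv (L.far (by omega))
      (L.far (by omega)) hvr' hvv hvf hrs hrr hrv' (L.far (by omega)) hsr (L.far (by omega))
      (L.far (by omega)) (L.far (by omega)) (L.far (by omega)) (L.far (by omega))
    exact tall y h h'

theorem chain_of_vert {b u u' : V} (hu : G.Dn lv b u) (hu' : G.Dn lv b u') :
    G.Chain {x | lv x + 1 = lv b} 2 u u' := by
  have h1 : u ∈ {x | lv x + 1 = lv b} := hu.2.symm
  have h2 : u' ∈ {x | lv x + 1 = lv b} := hu'.2.symm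
  rcases L.vert b u u' hu hu' with h | ⟨x, hx, hs, hs'⟩
  · exact (Chain.of_near h1 h2 h).mono (by omega)
  · exact .cons h1 hs.1 (.cons (Eq.symm hx.2) hs'.1 (.nil h2))

/-- Otherwise the chain shortens to an induced path from `v` to `v'` of length at most 5, which
forms with `f` and `f'` a cycle of length at most 8. Its cone vertex is on the level of `v`, so `hX`
links `c 1` to `c (j - 1)` one level further down, producing the forbidden cycle through four
levels. -/
theorem lowerNear_of_chain' {f f' v v' r r' : V}
    (hX : ∀ y u u', lv y + 1 = lv f → G.Dn lv y u → G.Dn lv y u' → G.LowerNear lv u u')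
    (hff : G.Near f f') (hl : lv f = lv f') (hv : G.Dn lv f v) (hv' : G.Dn lv f' v')
    (h1 : f = f' ∨ ¬ G.Adj v f' ∧ ¬ G.Adj v' f) (hr : G.Dn lv v r) (hr' : G.Dn lv v' r')
    (hch : G.Chain {x | lv x + 1 = lv v} 3 r r') : G.LowerNear lv v v' := by
  by_contra hn
  have e1 := hv.2
  have e2 := hv'.2
  obtain ⟨k, hk, y, h0, hyk, hadj, hS⟩ := hch.exists_walk_between hr.1 hr'.1.symm
  obtain ⟨j, hj, c, hc0, hcj, hc, hcS⟩ := exists_isIndPath hadj hS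
  rw [h0] at hc0
  rw [hyk] at hcj
  have hvv : ¬ G.Near v v' := fun h => hn (L.lowerNear_of_near h (by omega))
  have hj2 : 2 ≤ j := by
    by_contra hj2
    apply hvv
    rw [← hc0, ← hcj]
    interval_cases j
    · exact Near.refl _
    · exact (hc.adj 0 (by omega)).near
  have hcS' : ∀ i, 0 < i → i < j → lv (c i) + 1 = lv v := hcS
  have lv1 := hcS' 1 (by omega) (by omega)
  have lvj := hcS' (j - 1) (by omega) (by omega)
  have hd1 : G.Dn lv v (c 1) := ⟨hc0 ▸ hc.adj 0 (by omega), by omega⟩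
  have hdj : G.Dn lv v' (c (j - 1)) := by
    have := hc.adj (j - 1) (by omega)
    rw [show j - 1 + 1 = j by omega, hcj] at this
    exact ⟨this.symm, by omega⟩
  obtain ⟨z, hzf, hz⟩ : ∃ z, G.Adj z f ∧ ∀ i, i ≤ j → G.Adj z (c i) := by
    have hfi : ∀ i, 0 < i → i < j → ¬ G.Near f (c i) := fun i h h' =>
      L.far (by have := hcS' i h h'; omega)
    rcases h1 with rfl | ⟨h1, h2⟩
    · exact L.coned j c f hj2 (by omega) hc (hc0 ▸ hv.1) (hcj ▸ hv'.1) hfi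
    · rcases hff with rfl | hff
      · exact absurd hv.1.symm h1
      have hc' := hc.snoc (z := f') (hcj ▸ hv'.1.symm) (by
        intro i hi
        rcases Nat.eq_zero_or_pos i with rfl | hi0
        · rw [hc0]
          exact not_near (lv := lv) (by omega) h1
        · exact L.far (by have := hcS' i hi0 hi; omega))
      obtain ⟨z, hz, hz'⟩ := L.coned (j + 1) _ f (by omega) (by omega) hc'
        (by simpa [hc0] using hv.1) (by simpa using hff) (by
          intro i hi0 hi
          rw [if_pos (by omega)]
          rcases Nat.lt_or_ge i j with hij | hij
          · exact hfi i hi0 hij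
          · obtain rfl : i = j := by omega
            rw [hcj]
            exact not_near (lv := lv) (by omega) fun h => h2 h.symm)
      refine ⟨z, hz, fun i hi => ?_⟩
      simpa [hi] using hz' i (by omega)
  have hlz := L.lv_eq_of_adj (by omega) hzf (hz 1 (by omega))
  have hX' := hX z (c 1) (c (j - 1)) (by omega) ⟨hz 1 (by omega), by omega⟩
    ⟨hz (j - 1) (by omega), by omega⟩
  refine L.not_lowerNear_of_tall hff hl hv hv' hd1 hdj h1 hvv ?_ ?_ ?_ hX'
  · exact fun h => hn (Or.inr ⟨_, _, hd1, hdj, h⟩)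
  · exact fun h => hn (Or.inr ⟨_, _, hd1, ⟨h.symm, by omega⟩, Near.refl _⟩)
  · exact fun h => hn (Or.inr ⟨_, _, ⟨h, by omega⟩, hdj, Near.refl _⟩)

theorem lowerNear_of_chain {f f' v v' r r' : V}
    (hX : ∀ y u u', lv y + 1 = lv f → G.Dn lv y u → G.Dn lv y u' → G.LowerNear lv u u')
    (hff : G.Near f f') (hl : lv f = lv f') (hv : G.Dn lv f v) (hv' : G.Dn lv f' v')
    (hr : G.Dn lv v r) (hr' : G.Dn lv v' r')
    (hch : G.Chain {x | lv x + 1 = lv v} 3 r r') : G.LowerNear lv v v' := by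
  have e1 := hv.2
  have e2 := hv'.2
  by_cases h1 : G.Adj v f'
  · exact L.lowerNear_of_chain' (f := f') (fun y u u' h => hX y u u' (by omega)) (Near.refl _) rfl
      ⟨h1.symm, by omega⟩ hv' (Or.inl rfl) hr hr' hch
  by_cases h2 : G.Adj v' f
  · exact L.lowerNear_of_chain' (f := f) hX (Near.refl _) rfl
      hv ⟨h2.symm, by omega⟩ (Or.inl rfl) hr hr' hch
  exact L.lowerNear_of_chain' hX hff hl hv hv' (Or.inr ⟨h1, h2⟩) hr hr' hch

/-- Apart from immediate cases, the edge `w p`, the descents to `t` and `s` and the link below them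
form an induced cycle of length 5 or 6. Its cone vertex is adjacent to `w` and to a vertex two
levels below `w`, hence lies directly below `w`. -/
theorem exists_dn_near' {w p t s : V}
    (hX : ∀ u u', G.Dn lv w u → G.Dn lv p u' → G.LowerNear lv u u')
    (hwp : G.Adj w p) (hl : lv w = lv p) (ht : G.Dn lv w t) (hs : G.Dn lv p s)
    (htp : ¬ G.Adj t p) : ∃ y, G.Dn lv w y ∧ G.Near y s := by
  have e1 := ht.2
  have e2 := hs.2
  by_cases hsw : G.Adj w s
  · exact ⟨s, ⟨hsw, by omega⟩, Near.refl _⟩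
  by_cases hts : G.Near t s
  · exact ⟨t, ht, hts⟩
  rcases hX t s ht hs with h | ⟨u, u', hu, hu', hn⟩
  · exact absurd (Or.inl h) hts
  have e3 := hu.2
  have e4 := hu'.2
  have hsw' : ¬ G.Near w s := not_near (lv := lv) (by omega) hsw
  have htp' : ¬ G.Near t p := not_near (lv := lv) (by omega) htp
  have five : ∀ u, G.Dn lv t u → G.Dn lv s u → ∃ y, G.Dn lv w y ∧ G.Near y s := by
    intro u hu hu'
    have e5 := hu.2
    obtain ⟨y, hyw, -, hyu, hys, -⟩ := L.coned.cone5 ht.1 hu.1 hu'.1.symm hs.1.symm hwp.symm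
      (L.far (by omega)) hsw' hts htp' (L.far (by omega))
    have := L.lv_eq_of_adj (by omega) hyw hyu
    exact ⟨y, ⟨hyw.symm, by omega⟩, hys.near⟩
  by_cases h1 : G.Adj t u'
  · exact five u' ⟨h1, by omega⟩ hu'
  by_cases h2 : G.Adj s u
  · exact five u hu ⟨h2, by omega⟩
  rcases hn with rfl | hn
  · exact five u hu hu'
  obtain ⟨y, hyw, -, hyu, -, hys, -⟩ := L.coned.cone6 ht.1 hu.1 hn hu'.1.symm hs.1.symm hwp.symm
    (L.far (by omega)) (L.far (by omega)) hsw' (not_near (lv := lv) (by omega) h1) hts htp'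
    (not_near (lv := lv) (by omega) fun h => h2 h.symm) (L.far (by omega)) (L.far (by omega))
  have := L.lv_eq_of_adj (by omega) hyw hyu
  exact ⟨y, ⟨hyw.symm, by omega⟩, hys.near⟩

/-- Lower neighbours of vertices which are near each other and have the same level are equal, or
have themselves lower neighbours which are near each other. -/
theorem lowerNear_of_dn {f f' v v' : V} (hff : G.Near f f') (hl : lv f = lv f')
    (hv : G.Dn lv f v) (hv' : G.Dn lv f' v') : G.LowerNear lv v v' := by
  induction hn : lv f using Nat.strong_induction_on generalizing f f' v v' with
  | _ n ih =>
  -- One horizontal edge `c c₂` is crossed. The chain underneath has length at most 3: one for `r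
  -- s`, then two among the lower neighbours of `c`, or one provided by `exists_dn_near'`.
  have step : ∀ {f f' v c c₂ : V}, lv f = n → G.Near f f' → lv f = lv f' → G.Dn lv f v →
      G.Dn lv f' c → G.Dn lv f' c₂ → G.LowerNear lv v c → G.Adj c c₂ → G.LowerNear lv v c₂ := by
    intro f f' v c c₂ hn hff hl hv hc hc₂ hvc hcc
    have e1 := hv.2
    have e2 := hc.2
    have e3 := hc₂.2
    rcases hvc with rfl | ⟨r, s, hr, hs, hrs⟩
    · exact L.lowerNear_of_near hcc.near (by omega)
    have e4 := hr.2
    have e5 := hs.2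
    obtain ⟨t, ht⟩ := L.down c₂ (by omega)
    have e6 := ht.2
    have hX : ∀ y u u', lv y + 1 = lv f → G.Dn lv y u → G.Dn lv y u' → G.LowerNear lv u u' :=
      fun y u u' h hu hu' => ih (lv y) (by omega) (Near.refl _) rfl hu hu' rfl
    have hrsc : G.Chain {x | lv x + 1 = lv v} 1 r s := Chain.of_near
      (show lv r + 1 = lv v by omega) (show lv s + 1 = lv v by omega) hrs
    by_cases htc : G.Adj t c
    · have hch := L.chain_of_vert hs ⟨htc.symm, by omega⟩
      rw [show lv c = lv v by omega] at hch
      exact L.lowerNear_of_chain hX hff hl hv hc₂ hr ht (hrsc.trans hch)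
    · obtain ⟨y, hy, hys⟩ := L.exists_dn_near'
        (fun u u' hu hu' => ih (lv c₂) (by omega) hcc.symm.near (by omega) hu hu' rfl)
        hcc.symm (by omega) ht hs htc
      have e7 := hy.2
      have hysc : G.Chain {x | lv x + 1 = lv v} 1 s y := Chain.of_near
        (show lv s + 1 = lv v by omega) (show lv y + 1 = lv v by omega) hys.symm
      exact L.lowerNear_of_chain hX hff hl hv hc₂ hr hy ((hrsc.trans hysc).mono (by omega))
  -- The vertex condition at `f'` connects `c` to `c₂` by at most two such edges.
  have steps : ∀ {f f' v c c₂ : V}, lv f = n → G.Near f f' → lv f = lv f' → G.Dn lv f v →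
      G.Dn lv f' c → G.Dn lv f' c₂ → G.LowerNear lv v c → G.LowerNear lv v c₂ := by
    intro f f' v c c₂ hn hff hl hv hc hc₂ hvc
    rcases L.vert f' c c₂ hc hc₂ with (rfl | h) | ⟨x, hx, h, h'⟩
    · exact hvc
    · exact step hn hff hl hv hc hc₂ hvc h
    · exact step hn hff hl hv hx hc₂ (step hn hff hl hv hc hx hvc h.1) h'.1
  rcases hff with rfl | hff
  · exact steps hn (Near.refl _) rfl hv hv hv' (Or.inl rfl)
  · obtain ⟨v₀, v₀', hv₀, hv₀', hn₀⟩ := L.edge f f' hff hl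
    have e1 := hv₀.2
    have e2 := hv₀'.2
    have h1 := steps hn hff.near hl hv₀ hv₀' hv' (L.lowerNear_of_near hn₀ (by omega))
    exact (steps (by omega) hff.symm.near hl.symm hv' hv₀ hv h1.symm).symm

theorem exists_dn_near {w p t s : V} (hwp : G.Adj w p) (hl : lv w = lv p) (ht : G.Dn lv w t)
    (hs : G.Dn lv p s) (htp : ¬ G.Adj t p) : ∃ y, G.Dn lv w y ∧ G.Near y s :=
  L.exists_dn_near' (fun _ _ hu hu' => L.lowerNear_of_dn hwp.near hl hu hu') hwp hl ht hs htp

end IsLayered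

end SimpleGraph

/-! ### Descending paths stay close. -/

namespace SimpleGraph

variable {V : Type*}

/-- The vertex `t` is two levels below `y`, and joined to it by a descending path. -/
def Dn₂ (G : SimpleGraph V) (lv : V → ℕ) (y t : V) : Prop :=
  ∃ w, G.Dn lv y w ∧ G.Dn lv w t

/-- The vertices `t` and `t'` lie three levels below the adjacent or equal vertices `x` and `x'`,
but not two levels below vertices which are near each other. -/
structure IsSpread (G : SimpleGraph V) (lv : V → ℕ) (x x' v v' t t' : V) : Prop where
  near : G.Near x x'
  lv_eq : lv x = lv x'
  dn : G.Dn lv x v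
  dn' : G.Dn lv x' v'
  not_adj : x = x' ∨ ¬ G.Adj v x' ∧ ¬ G.Adj v' x
  dn₂ : G.Dn₂ lv v t
  dn₂' : G.Dn₂ lv v' t'
  far : ∀ y y', G.Dn₂ lv y t → G.Dn₂ lv y' t' → ¬ G.Near y y'

namespace IsSpread

variable {G : SimpleGraph V} {lv : V → ℕ} {x x' v v' t t' : V}

theorem symm (h : G.IsSpread lv x x' v v' t t') : G.IsSpread lv x' x v' v t' t where
  near := h.near.symm
  lv_eq := h.lv_eq.symm
  dn := h.dn'
  dn' := h.dn
  not_adj := h.not_adj.imp Eq.symm And.symm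
  dn₂ := h.dn₂'
  dn₂' := h.dn₂
  far y y' hy hy' hn := h.far y' y hy' hy hn.symm

variable (L : G.IsLayered lv) (S : G.IsSpread lv x x' v v' t t')

include S in
theorem not_near : ¬ G.Near v v' := S.far v v' S.dn₂ S.dn₂'

include S in
theorem lv_eq' : lv v = lv v' := by
  have h1 := S.dn.2
  have h2 := S.dn'.2
  have h3 := S.lv_eq
  omega

include S in
theorem not_adj_of_dn {w : V} (hw : G.Dn lv v w) (hwt : G.Dn lv w t) : ¬ G.Adj w v' := fun h =>
  S.far v' v' ⟨w, ⟨h.symm, by rw [← S.lv_eq', hw.2]⟩, hwt⟩ S.dn₂' (Near.refl _)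

include L S

/-- A path through lower levels between `v` and `v'` is coned together with `x` and `x'`. -/
theorem exists_cone {k : ℕ} {c : ℕ → V} (hk : 2 ≤ k) (hk' : k ≤ 5) (hc : G.IsIndPath k c)
    (h0 : c 0 = v) (h1 : c k = v') (hlow : ∀ i, 0 < i → i < k → lv (c i) + 1 = lv v) :
    ∃ z, lv z = lv v ∧ ∀ i, i ≤ k → G.Adj z (c i) := by
  have e1 := S.dn.2
  have e2 := S.dn'.2
  have e3 := S.lv_eq
  have hfi : ∀ i, 0 < i → i < k → ¬ G.Near x (c i) := fun i h h' =>
    L.far (by have := hlow i h h'; omega)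
  have key : ∃ z, G.Adj z x ∧ ∀ i, i ≤ k → G.Adj z (c i) := by
    rcases S.not_adj with he | ⟨ha, hb⟩
    · exact L.coned k c x hk (by omega) hc (h0 ▸ S.dn.1) (by rw [h1, he]; exact S.dn'.1) hfi
    · rcases S.near with he | hxx
      · rw [← he] at ha
        exact absurd S.dn.1.symm ha
      have hc' := hc.snoc (z := x') (h1 ▸ S.dn'.1.symm) (by
        intro i hi
        rcases Nat.eq_zero_or_pos i with rfl | hi0
        · rw [h0]
          exact IsLayered.not_near (lv := lv) (by omega) ha
        · exact L.far (by have := hlow i hi0 hi; omega))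
      obtain ⟨z, hz, hz'⟩ := L.coned (k + 1) _ x (by omega) (by omega) hc'
        (by simpa [h0] using S.dn.1) (by simpa using hxx) (by
          intro i hi0 hi
          rw [if_pos (by omega)]
          rcases Nat.lt_or_ge i k with hik | hik
          · exact hfi i hi0 hik
          · obtain rfl : i = k := by omega
            rw [h1]
            exact IsLayered.not_near (lv := lv) (by omega) fun h => hb h.symm)
      refine ⟨z, hz, fun i hi => ?_⟩
      simpa [hi] using hz' i (by omega)
  obtain ⟨z, hzx, hz⟩ := key
  have e4 := hlow 1 (by omega) (by omega)
  have := L.lv_eq_of_adj (by omega) hzx (hz 1 (by omega))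
  exact ⟨z, by omega, hz⟩

/-- The cone over a path of length three. -/
theorem exists_cone_three {a b : V} (ha : G.Dn lv v a) (hb : G.Dn lv v' b) (hab : G.Adj a b)
    (hav : ¬ G.Adj a v') (hbv : ¬ G.Adj v b) :
    ∃ z, lv z = lv v ∧ G.Adj z v ∧ G.Adj z a ∧ G.Adj z b ∧ G.Adj z v' := by
  have e1 := ha.2
  have e2 := hb.2
  have e3 := S.lv_eq'
  have nvb : ¬ G.Near v b := IsLayered.not_near (lv := lv) (by omega) hbv
  have nav : ¬ G.Near a v' := IsLayered.not_near (lv := lv) (by omega) hav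
  have hind : G.IsIndPath 3 (fun i => [v, a, b, v'].getD i v) := by
    refine ⟨fun i hi => ?_, fun i j hij hj => ?_⟩
    · interval_cases i
      · exact ha.1
      · exact hab
      · exact hb.1.symm
    · have hi : i < j := by omega
      interval_cases j <;> interval_cases i <;> first | omega | skip
      · exact nvb
      · exact S.not_near
      · exact nav
  obtain ⟨z, hz, hz'⟩ := S.exists_cone L (by omega) (by omega) hind rfl rfl (by
    intro i h h'
    interval_cases i
    · exact e1.symm
    · change lv b + 1 = lv v
      omega)
  exact ⟨z, hz, hz' 0 (by omega), hz' 1 (by omega), hz' 2 (by omega), hz' 3 (by omega)⟩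

/-- The cone over a path of length two. -/
theorem exists_cone_two {q : V} (hq : G.Dn lv v q) (hq' : G.Dn lv v' q) :
    ∃ z, lv z = lv v ∧ G.Adj z v ∧ G.Adj z v' := by
  have hind : G.IsIndPath 2 (fun i => [v, q, v'].getD i v) := by
    refine ⟨fun i hi => ?_, fun i j hij hj => ?_⟩
    · interval_cases i
      · exact hq.1
      · exact hq'.1.symm
    · have hi : i < j := by omega
      interval_cases j <;> interval_cases i <;> first | omega | skip
      exact S.not_near
  obtain ⟨z, hz, hz'⟩ := S.exists_cone L (by omega) (by omega) hind rfl rfl (by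
    intro i h h'
    interval_cases i
    exact hq.2.symm)
  exact ⟨z, hz, hz' 0 (by omega), hz' 2 (by omega)⟩

/-- Otherwise the cone vertex over `v, w, c, v'` would be two levels above `t` and adjacent to `v'`,
against `far`. -/
theorem not_near_of_dn {w c : V} (hw : G.Dn lv v w) (hwt : G.Dn lv w t) (hc : G.Dn lv v' c)
    (hcv : ¬ G.Adj v c) : ¬ G.Near w c := by
  rintro (rfl | h)
  · exact hcv hw.1
  obtain ⟨z, hz, -, hzw, -, hzv⟩ := S.exists_cone_three L hw hc h (S.not_adj_of_dn hw hwt) hcv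
  exact S.far z v' ⟨w, ⟨hzw, by rw [hz, hw.2]⟩, hwt⟩ S.dn₂' hzv.near

theorem not_lowerNear_of_dn {w c : V} (hw : G.Dn lv v w) (hwt : G.Dn lv w t) (hc : G.Dn lv v' c)
    (hcv : ¬ G.Adj v c) : ¬ G.LowerNear lv w c :=
  L.not_lowerNear_of_tall S.near S.lv_eq S.dn S.dn' hw hc S.not_adj S.not_near
    (S.not_near_of_dn L hw hwt hc hcv) (S.not_adj_of_dn hw hwt) hcv

/-- If not, `lowerNear_of_dn` gives adjacent lower neighbours `r` and `r'`, and the cone vertex `z`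
over `v, r, r', v'` is adjacent to `v`. Comparing `w` below `v` with `r'` below `z` contradicts
`not_lowerNear_of_dn`. -/
theorem exists_dn_dn : ∃ q, G.Dn lv v q ∧ G.Dn lv v' q := by
  by_contra! hP
  obtain ⟨w, hw, hwt⟩ := S.dn₂
  have e := S.lv_eq'
  rcases L.lowerNear_of_dn S.near S.lv_eq S.dn S.dn' with h | ⟨r, r', hr, hr', hn⟩
  · exact S.not_near (Or.inl h)
  have e1 := hr.2
  have e2 := hr'.2
  have h1 : ¬ G.Adj r v' := fun h => hP r hr ⟨h.symm, by omega⟩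
  have h2 : ¬ G.Adj v r' := fun h => hP r' ⟨h, by omega⟩ hr'
  have hne : r ≠ r' := by
    rintro rfl
    exact hP r hr hr'
  obtain ⟨z, hz, hzv, -, hzr, -⟩ := S.exists_cone_three L hr hr' (hn.adj hne) h1 h2
  exact S.not_lowerNear_of_dn L hw hwt hr' h2
    (L.lowerNear_of_dn hzv.symm.near hz.symm hw ⟨hzr, by omega⟩)

/-- A lower neighbour of `v'` not adjacent to `v` is not joined to `w` by a short path through the
level of `t`. -/
theorem not_chain_of_dn {w c r₁ r₂ r₃ : V} (hw : G.Dn lv v w) (hwt : G.Dn lv w t)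
    (hc : G.Dn lv v' c) (hcv : ¬ G.Adj v c) (h₁ : G.Dn lv w r₁) (h₃ : G.Dn lv c r₃)
    (h₂ : lv r₂ = lv t) (h₁₂ : G.Near r₁ r₂) (h₂₃ : G.Near r₂ r₃) : False := by
  have hD := S.not_lowerNear_of_dn L hw hwt hc hcv
  have hwc := S.not_near_of_dn L hw hwt hc hcv
  obtain ⟨q, hq, hq'⟩ := S.exists_dn_dn L
  obtain ⟨z, hz, hzv, hzv'⟩ := S.exists_cone_two L hq hq'
  have e := S.lv_eq'
  have e1 := hw.2
  have e2 := hwt.2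
  have e3 := hc.2
  have e4 := h₁.2
  have e5 := h₃.2
  have hwz : ¬ G.Adj w z := fun h => S.far z v' ⟨w, ⟨h.symm, by omega⟩, hwt⟩ S.dn₂' hzv'.near
  have hr₁₃ : ¬ G.Near r₁ r₃ := fun h => hD (Or.inr ⟨_, _, h₁, h₃, h⟩)
  have hr₁c : ¬ G.Adj c r₁ := fun h => hD (Or.inr ⟨_, _, h₁, ⟨h, by omega⟩, Near.refl _⟩)
  have hr₃w : ¬ G.Adj w r₃ := fun h => hD (Or.inr ⟨_, _, ⟨h, by omega⟩, h₃, Near.refl _⟩)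
  have hr₂w : ¬ G.Adj w r₂ := fun h => hD (Or.inr ⟨_, _, ⟨h, by omega⟩, h₃, h₂₃⟩)
  have hr₂c : ¬ G.Adj c r₂ := fun h => hD (Or.inr ⟨_, _, h₁, ⟨h, by omega⟩, h₁₂⟩)
  have a₁₂ : G.Adj r₁ r₂ := h₁₂.adj (by rintro rfl; exact hr₂w h₁.1)
  have a₂₃ : G.Adj r₂ r₃ := h₂₃.adj (by rintro rfl; exact hr₂c h₃.1)
  have nwv' : ¬ G.Near w v' := IsLayered.not_near (lv := lv) (by omega) (S.not_adj_of_dn hw hwt)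
  have nwz : ¬ G.Near w z := IsLayered.not_near (lv := lv) (by omega) hwz
  have nwr₃ : ¬ G.Near w r₃ := IsLayered.not_near (lv := lv) (by omega) hr₃w
  have nwr₂ : ¬ G.Near w r₂ := IsLayered.not_near (lv := lv) (by omega) hr₂w
  have ncr₁ : ¬ G.Near c r₁ := IsLayered.not_near (lv := lv) (by omega) hr₁c
  have ncr₂ : ¬ G.Near c r₂ := IsLayered.not_near (lv := lv) (by omega) hr₂c
  have nvc : ¬ G.Near v c := IsLayered.not_near (lv := lv) (by omega) hcv
  have nr₃₁ : ¬ G.Near r₃ r₁ := fun h => hr₁₃ h.symm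
  -- The cycle is `w, v, z, v', c, r₃, r₂, r₁`, with `v'` left out when `z` is adjacent to `c`. The
  -- cone vertex `y` is on the level of `w` and not adjacent to `t`, since `z` would then be two
  -- levels above `t`. So some lower neighbour of `w` is near `r₃`, which was excluded.
  obtain ⟨y, hyw, hyv, hyz, hyr₃⟩ : ∃ y, G.Adj y w ∧ G.Adj y v ∧ G.Adj y z ∧ G.Adj y r₃ := by
    by_cases hzc : G.Adj z c
    · obtain ⟨y, h1, h2, h3, -, h5, -⟩ := L.coned.cone7 hw.1.symm hzv.symm hzc h₃.1 a₂₃.symm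
        a₁₂.symm h₁.1.symm nwz hwc nwr₃ nwr₂ nvc (L.far (by omega)) (L.far (by omega))
        (L.far (by omega)) (L.far (by omega)) (L.far (by omega)) (L.far (by omega)) ncr₂ ncr₁ nr₃₁
      exact ⟨y, h1, h2, h3, h5⟩
    · obtain ⟨y, h1, h2, h3, -, -, h5, -⟩ := L.coned.cone8 hw.1.symm hzv.symm hzv' hc.1 h₃.1
        a₂₃.symm a₁₂.symm h₁.1.symm nwz nwv' hwc nwr₃ nwr₂ S.not_near nvc (L.far (by omega))
        (L.far (by omega)) (L.far (by omega)) (IsLayered.not_near (lv := lv) (by omega) hzc)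
        (L.far (by omega)) (L.far (by omega)) (L.far (by omega)) (L.far (by omega))
        (L.far (by omega)) (L.far (by omega)) ncr₂ ncr₁ nr₃₁
      exact ⟨y, h1, h2, h3, h5⟩
  have hly := L.lv_eq_of_adj (by omega) hyv hyr₃
  have hty : ¬ G.Adj t y := fun h =>
    S.far z v' ⟨y, ⟨hyz.symm, by omega⟩, h.symm, by omega⟩ S.dn₂' hzv'.near
  obtain ⟨y', hy', hn⟩ := L.exists_dn_near hyw.symm (by omega) hwt ⟨hyr₃, by omega⟩ hty
  exact hD (Or.inr ⟨_, _, hy', h₃, hn⟩)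

/-- No common lower neighbour of `v` and `v'` is adjacent to a vertex between `v` and `t`. -/
theorem not_adj_of_dn_dn {w q : V} (hw : G.Dn lv v w) (hwt : G.Dn lv w t) (hq : G.Dn lv v q)
    (hq' : G.Dn lv v' q) : ¬ G.Adj w q := by
  intro hwq
  obtain ⟨w', hw', hwt'⟩ := S.dn₂'
  have e := S.lv_eq'
  have e1 := hw.2
  have e2 := hwt.2
  have e3 := hq.2
  have e4 := hw'.2
  have e5 := hwt'.2
  have htq : ∀ {q}, G.Dn lv v q → G.Dn lv v' q → ¬ G.Adj t q := fun hq hq' h =>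
    S.not_adj_of_dn hq ⟨h.symm, by have := hq.2; omega⟩ hq'.1.symm
  have htq' : ∀ {q}, G.Dn lv v q → G.Dn lv v' q → ¬ G.Adj t' q := fun hq hq' h =>
    S.symm.not_adj_of_dn hq' ⟨h.symm, by have := hq.2; omega⟩ hq.1.symm
  have hw'v : ¬ G.Adj v w' := fun h => S.symm.not_adj_of_dn hw' hwt' h.symm
  have finish : ∀ {p s}, G.Dn lv v p → G.Dn lv v' p → G.Dn lv q s → G.Dn lv p s → G.Adj w' p →
      False := by
    intro p s hp hp' hs hs' hwp
    have e6 := hp.2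
    have e7 := hs.2
    obtain ⟨y, hy, hys⟩ := L.exists_dn_near hwq (by omega) hwt hs (htq hq hq')
    obtain ⟨y', hy', hys'⟩ := L.exists_dn_near hwp (by omega) hwt' hs' (htq' hp hp')
    exact S.not_chain_of_dn L hw hwt hw' hw'v hy hy' (r₂ := s) (by omega) hys hys'.symm
  -- The vertex condition at `v'` leads from `q` to `w'`. An intermediate vertex `p` is either again
  -- below both `v` and `v'`, or plays the part of `c` in `not_lowerNear_of_dn`.
  rcases L.vert v' q w' hq' hw' with (rfl | h) | ⟨p, hp', ⟨hqp, s, hs, hs'⟩, ⟨hpw, -⟩⟩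
  · exact hw'v hq.1
  · obtain ⟨s, hs⟩ := L.down q (by omega)
    exact finish hq hq' hs hs h.symm
  · have e6 := hp'.2
    by_cases hp : G.Adj v p
    · exact finish ⟨hp, by omega⟩ hp' hs hs' hpw.symm
    · obtain ⟨y, hy, hys⟩ := L.exists_dn_near hwq (by omega) hwt hs (htq hq hq')
      exact S.not_lowerNear_of_dn L hw hwt hp' hp (Or.inr ⟨_, _, hy, hs', hys⟩)

theorem exists_strong_strong {w p : V} (hw : G.Dn lv v w) (hwt : G.Dn lv w t) (hp : G.Dn lv v p)
    (hp' : G.Dn lv v' p) :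
    ∃ y, G.Dn lv v y ∧ ¬ G.Adj y v' ∧ G.Strong lv w y ∧ G.Strong lv y p := by
  rcases L.vert v w p hw hp with (rfl | h) | ⟨y, hy, h, h'⟩
  · exact absurd hp'.1.symm (S.not_adj_of_dn hw hwt)
  · exact absurd h (S.not_adj_of_dn_dn L hw hwt hp hp')
  · refine ⟨y, hy, fun hyv => ?_, h, h'⟩
    have e := S.lv_eq'
    have e1 := hy.2
    exact S.not_adj_of_dn_dn L hw hwt hy ⟨hyv.symm, by omega⟩ h.1

/-- The vertices between levels are linked by a path `w, y, p, y', w'` with `p` below both `v` and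
`v'`. Lower neighbours under this path give a walk from below `w` to below `y'` with at most one
intermediate vertex, which `not_chain_of_dn` forbids. -/
theorem false : False := by
  obtain ⟨w, hw, hwt⟩ := S.dn₂
  obtain ⟨w', hw', hwt'⟩ := S.dn₂'
  obtain ⟨p, hp, hp'⟩ := S.exists_dn_dn L
  obtain ⟨y, hy, -, ⟨hwy, r, hwr, hyr⟩, ⟨hyp, -⟩⟩ := S.exists_strong_strong L hw hwt hp hp'
  obtain ⟨y', hy', hyv', -, ⟨hyp', s, hys, hps⟩⟩ :=
    S.symm.exists_strong_strong L hw' hwt' hp' hp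
  have hvy : ¬ G.Adj v y' := fun h => hyv' h.symm
  have e1 := hw.2
  have e2 := hwt.2
  have e3 := hy.2
  have e4 := hp.2
  have e5 := hyr.2
  have e6 := hps.2
  have hty : ¬ G.Adj t y := fun h =>
    S.not_adj_of_dn_dn L hy ⟨h.symm, by omega⟩ hp hp' hyp
  by_cases hrp : G.Adj r p
  · rcases L.vert p r s ⟨hrp.symm, by omega⟩ hps with h | ⟨m, hm, h, h'⟩
    · exact S.not_chain_of_dn L hw hwt hy' hvy hwr hys (r₂ := r) (by omega) (Near.refl _) h
    · have e7 := hm.2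
      exact S.not_chain_of_dn L hw hwt hy' hvy hwr hys (r₂ := m) (by omega) h.1.near h'.1.near
  · obtain ⟨s₁, hs₁, hn₁⟩ := L.exists_dn_near hyp (by omega) hyr hps hrp
    obtain ⟨u, hu, hn⟩ := L.exists_dn_near hwy (by omega) hwt hs₁ hty
    have e7 := hs₁.2
    exact S.not_chain_of_dn L hw hwt hy' hvy hu hys (r₂ := s₁) (by omega) hn hn₁

end IsSpread

namespace IsLayered

variable {G : SimpleGraph V} {lv : V → ℕ} (L : G.IsLayered lv)
include L

theorem exists_near_dn₂ {x x' v v' t t' : V} (hxx : G.Near x x') (hl : lv x = lv x')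
    (hv : G.Dn lv x v) (hv' : G.Dn lv x' v') (ht : G.Dn₂ lv v t) (ht' : G.Dn₂ lv v' t') :
    ∃ y y', G.Dn₂ lv y t ∧ G.Dn₂ lv y' t' ∧ G.Near y y' := by
  by_contra! hfar
  have e1 := hv.2
  have e2 := hv'.2
  by_cases h1 : G.Adj v x'
  · exact IsSpread.false L (x := x')
      ⟨Near.refl _, rfl, ⟨h1.symm, by omega⟩, hv', Or.inl rfl, ht, ht', hfar⟩
  by_cases h2 : G.Adj v' x
  · exact IsSpread.false L (x := x) ⟨Near.refl _, rfl, hv, ⟨h2.symm, by omega⟩, Or.inl rfl, ht, ht',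
      hfar⟩
  exact IsSpread.false L ⟨hxx, hl, hv, hv', Or.inr ⟨h1, h2⟩, ht, ht', hfar⟩

end IsLayered

/-- The vertex `t` is joined to `x` by a descending path of length `k`. -/
def Below (G : SimpleGraph V) (lv : V → ℕ) : ℕ → V → V → Prop
  | 0, x, t => x = t
  | k + 1, x, t => ∃ y, G.Dn lv x y ∧ Below G lv k y t

theorem Below.reachable {G : SimpleGraph V} {lv : V → ℕ} {k : ℕ} {x t : V}
    (h : G.Below lv k x t) : ∃ p : G.Walk x t, p.length = k := by
  induction k generalizing x with
  | zero => obtain rfl : x = t := h; exact ⟨.nil, rfl⟩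
  | succ k ih =>
    obtain ⟨y, hy, h⟩ := h
    obtain ⟨p, hp⟩ := ih h
    exact ⟨.cons hy.1 p, by simp [hp]⟩

/-- Descending paths which start near each other stay close to each other. -/
theorem IsLayered.dist_le_five {G : SimpleGraph V} {lv : V → ℕ} (L : G.IsLayered lv) {k : ℕ}
    {x x' t t' : V} (hxx : G.Near x x') (hl : lv x = lv x') (h : G.Below lv k x t)
    (h' : G.Below lv k x' t') : G.dist t t' ≤ 5 := by
  induction k generalizing x x' with
  | zero =>
    obtain rfl : x = t := h
    obtain rfl : x' = t' := h'
    rcases hxx with rfl | h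
    · simp
    · rw [dist_eq_one_iff_adj.2 h]; omega
  | succ k ih =>
    -- At most two steps remain on each side: 2 + 1 + 2 = 5. Longer descents are restarted one level
    -- lower from a near pair.
    rcases Nat.lt_or_ge k 2 with hk | hk
    · obtain ⟨p, hp⟩ := h.reachable
      obtain ⟨q, hq⟩ := h'.reachable
      rcases hxx with rfl | hxx
      · have := dist_le (p.reverse.append q)
        simp only [Walk.length_append, Walk.length_reverse] at this
        omega
      · have := dist_le (p.reverse.append (.cons hxx q))
        simp only [Walk.length_append, Walk.length_reverse, Walk.length_cons] at this
        omega
    · obtain ⟨k, rfl⟩ : ∃ m, k = m + 2 := ⟨k - 2, by omega⟩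
      obtain ⟨v, hv, w, hw, s, hs, h⟩ := h
      obtain ⟨v', hv', w', hw', s', hs', h'⟩ := h'
      obtain ⟨y, y', ⟨u, hu, hu₂⟩, ⟨u', hu', hu₂'⟩, hn⟩ :=
        L.exists_near_dn₂ hxx hl hv hv' ⟨w, hw, hs⟩ ⟨w', hw', hs'⟩
      refine ih hn ?_ ⟨u, hu, s, hu₂, h⟩ ⟨u', hu', s', hu₂', h'⟩
      have := hv.2
      have := hv'.2
      have := hw.2
      have := hw'.2
      have := hs.2
      have := hs'.2
      have := hu.2
      have := hu'.2
      have := hu₂.2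
      have := hu₂'.2
      omega

end SimpleGraph

/-! ### Thin bigons and the contraction of parallel geodesics. -/

namespace SimpleGraph

variable {V : Type*}

/-- The vertex `t` lies on a geodesic from `O` to `x`. -/
def Between (G : SimpleGraph V) (O x t : V) : Prop :=
  G.dist O t + G.dist t x = G.dist O x

/-- Geodesics from a common vertex to vertices which are near each other and equally far stay
close. -/
structure IsThin (G : SimpleGraph V) : Prop where
  connected : G.Connected
  dist_le : ∀ O x y s t, G.Near x y → G.dist O x = G.dist O y → G.Between O x s →
    G.Between O y t → G.dist O s = G.dist O t → G.dist s t ≤ 5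

/-- Geodesics from a common vertex to equally far vertices which are not too far from each other
are close after `M` steps. -/
def Contracts (G : SimpleGraph V) (M : ℕ) : Prop :=
  ∀ O x x' t t', G.dist O x = G.dist O x' → G.dist x x' ≤ 120 → G.Between O x t →
    G.Between O x' t' → G.dist O t = G.dist O t' → G.dist O t + M ≤ G.dist O x → G.dist t t' ≤ 60

variable {G : SimpleGraph V}

theorem Connected.exists_geodesic (hG : G.Connected) (a b : V) :
    ∃ γ : ℕ → V, γ 0 = a ∧ γ (G.dist a b) = b ∧
      ∀ i j, i ≤ j → j ≤ G.dist a b → G.dist (γ i) (γ j) + i = j := by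
  obtain ⟨p, hp⟩ := hG.exists_walk_length_eq_dist a b
  refine ⟨p.getVert, p.getVert_zero, hp ▸ p.getVert_length, ?_⟩
  have step : ∀ k i, i + k ≤ G.dist a b → G.dist (p.getVert i) (p.getVert (i + k)) ≤ k := by
    intro k
    induction k with
    | zero => simp
    | succ k ih =>
      intro i hi
      have h1 := ih i (by omega)
      have h2 := dist_eq_one_iff_adj.2 (p.adj_getVert_succ (i := i + k) (by omega))
      have h3 := hG.dist_triangle (u := p.getVert i) (v := p.getVert (i + k))
        (w := p.getVert (i + k + 1))
      rw [← Nat.add_assoc]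
      omega
  intro i j hij hj
  have h1 := step i 0 (by omega)
  have h2 := step (j - i) i (by omega)
  have h3 := step (G.dist a b - j) j (by omega)
  rw [Nat.zero_add, p.getVert_zero] at h1
  rw [show i + (j - i) = j by omega] at h2
  rw [show j + (G.dist a b - j) = p.length by omega, p.getVert_length] at h3
  have h4 := hG.dist_triangle (u := a) (v := p.getVert i) (w := b)
  have h5 := hG.dist_triangle (u := p.getVert i) (v := p.getVert j) (w := b)
  omega

theorem Between.trans (hG : G.Connected) {O x y z : V} (h : G.Between O x y)
    (h' : G.Between O y z) : G.Between O x z := by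
  unfold Between at *
  have h1 := hG.dist_triangle (u := O) (v := z) (w := x)
  have h2 := hG.dist_triangle (u := z) (v := y) (w := x)
  omega

theorem Between.exists_between (hG : G.Connected) {O x t : V} (h : G.Between O x t) {l : ℕ}
    (h1 : G.dist O t ≤ l) (h2 : l ≤ G.dist O x) :
    ∃ u, G.dist O u = l ∧ G.Between O x u ∧ G.Between O u t := by
  unfold Between at *
  obtain ⟨γ, h0, hN, hγ⟩ := hG.exists_geodesic t x
  refine ⟨γ (l - G.dist O t), ?_⟩
  have e1 := hγ 0 (l - G.dist O t) (by omega) (by omega)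
  have e2 := hγ (l - G.dist O t) (G.dist t x) (by omega) le_rfl
  rw [h0] at e1
  rw [hN] at e2
  have h3 := hG.dist_triangle (u := O) (v := t) (w := γ (l - G.dist O t))
  have h4 := hG.dist_triangle (u := O) (v := γ (l - G.dist O t)) (w := x)
  omega

theorem Connected.exists_between (hG : G.Connected) (O x : V) {l : ℕ} (h : l ≤ G.dist O x) :
    ∃ u, G.dist O u = l ∧ G.Between O x u := by
  obtain ⟨u, h1, h2, -⟩ := Between.exists_between hG (O := O) (x := x) (t := O)
    (by simp [Between]) (l := l) (by simp) h
  exact ⟨u, h1, h2⟩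

theorem below_of_between (hG : G.Connected) {O x t : V} (h : G.Between O x t) :
    G.Below (G.dist O) (G.dist t x) x t := by
  induction hk : G.dist t x generalizing x with
  | zero => exact (hG.dist_eq_zero_iff.1 hk).symm
  | succ k ih =>
    unfold Between at *
    obtain ⟨γ, h0, hN, hγ⟩ := hG.exists_geodesic t x
    have e1 := hγ 0 k (by omega) (by omega)
    have e2 := hγ k (k + 1) (by omega) (by omega)
    rw [hk] at hN
    rw [hN] at e2
    rw [h0] at e1
    have h1 := hG.dist_triangle (u := O) (v := γ k) (w := x)
    have h2 := hG.dist_triangle (u := O) (v := t) (w := γ k)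
    refine ⟨γ k, ⟨(dist_eq_one_iff_adj.1 (by omega)).symm, by omega⟩, ih ?_ (by omega)⟩
    omega

theorem isThin_of_isLayered (hG : G.Connected) (h : ∀ O, G.IsLayered (G.dist O)) : G.IsThin where
  connected := hG
  dist_le O x x' t t' hxx hl hb hb' ht := by
    have h1 := below_of_between hG hb
    have h2 := below_of_between hG hb'
    have e : G.dist t' x' = G.dist t x := by
      unfold Between at *
      omega
    rw [e] at h2
    exact (h O).dist_le_five hxx hl h1 h2

namespace IsThin

variable (hT : G.IsThin)
include hT

theorem dist_le_of_step {O x x' t t' : V} (hxx : G.dist x x' ≤ 1) (hb : G.Between O x t)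
    (hb' : G.Between O x' t') (ht : G.dist O t = G.dist O t') : G.dist t t' ≤ 5 := by
  have hG := hT.connected
  have h1 := hG.dist_triangle (u := O) (v := x) (w := x')
  have h2 := hG.dist_triangle (u := O) (v := x') (w := x)
  rw [dist_comm (u := x') (v := x)] at h2
  have hn : G.Near x x' := by
    rcases Nat.eq_zero_or_pos (G.dist x x') with h | h
    · exact Or.inl (hG.dist_eq_zero_iff.1 h)
    · exact Or.inr (dist_eq_one_iff_adj.1 (by omega))
  rcases lt_trichotomy (G.dist O x) (G.dist O x') with h | h | h
  · have hxx' : G.Between O x' x := by unfold Between; omega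
    exact hT.dist_le O x' x' t t' (Near.refl _) rfl (hxx'.trans hG hb) hb' ht
  · exact hT.dist_le O x x' t t' hn h hb hb' ht
  · have hxx' : G.Between O x x' := by unfold Between; rw [dist_comm (u := x') (v := x)]; omega
    exact hT.dist_le O x x t t' (Near.refl _) rfl hb (hxx'.trans hG hb') ht

theorem dist_le_of_path {O : V} {γ : ℕ → V} {K : ℕ} {t t' : V}
    (hγ : ∀ i, i < K → G.dist (γ i) (γ (i + 1)) ≤ 1) (hl : ∀ i, i ≤ K → G.dist O t ≤ G.dist O (γ i))
    (hb : G.Between O (γ 0) t) (hb' : G.Between O (γ K) t') (ht : G.dist O t = G.dist O t') :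
    G.dist t t' ≤ 5 * K + 5 := by
  induction K generalizing t' with
  | zero => exact hT.dist_le_of_step (by simp) hb hb' ht
  | succ K ih =>
    obtain ⟨u, hu, hbu⟩ := hT.connected.exists_between O (γ K) (hl K (by omega))
    have h1 := ih (fun i hi => hγ i (by omega)) (fun i hi => hl i (by omega)) hbu hu.symm
    have h2 := hT.dist_le_of_step (hγ K (by omega)) hbu hb' (hu.trans ht)
    have h3 := hT.connected.dist_triangle (u := t) (v := u) (w := t')
    omega

/-- If the geodesic from `x` to `x'` stays above the level of `t`, each of its edges costs 5. If it
dips below, the descents to `t` and `t'` have total length less than `K`, and the route through `x`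
and `x'` is shorter than `2 * K`. -/
theorem dist_le_of_dist_le {O x x' t t' : V} {K : ℕ} (hl : G.dist O x = G.dist O x')
    (hK : G.dist x x' ≤ K) (hb : G.Between O x t) (hb' : G.Between O x' t')
    (ht : G.dist O t = G.dist O t') : G.dist t t' ≤ 5 * K + 5 := by
  have hG := hT.connected
  obtain ⟨γ, h0, hN, hγ⟩ := hG.exists_geodesic x x'
  by_cases hlow : ∀ i, i ≤ G.dist x x' → G.dist O t ≤ G.dist O (γ i)
  · have := hT.dist_le_of_path (O := O) (γ := γ) (K := G.dist x x') (t := t) (t' := t')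
      (fun i hi => by have := hγ i (i + 1) (by omega) (by omega); omega) hlow (h0.symm ▸ hb)
      (hN.symm ▸ hb') ht
    omega
  · push Not at hlow
    obtain ⟨i, hi, hlt⟩ := hlow
    have e1 := hγ 0 i (by omega) hi
    have e2 := hγ i (G.dist x x') hi le_rfl
    rw [h0] at e1
    rw [hN] at e2
    have h1 := hG.dist_triangle (u := O) (v := γ i) (w := x)
    have h2 := hG.dist_triangle (u := O) (v := γ i) (w := x')
    rw [dist_comm (u := γ i) (v := x)] at h1
    have h3 := hG.dist_triangle (u := t) (v := x) (w := t')
    have h4 := hG.dist_triangle (u := x) (v := x') (w := t')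
    rw [dist_comm (u := x') (v := t')] at h4
    unfold Between at *
    omega

/-- Two parallel geodesics which stay at bounded distance come close to each other. -/
theorem exists_dist_le_ten {O : V} {γ γ' : ℕ → V} {n N K Q : ℕ} (hK : K ≤ Q)
    (hl : ∀ s, s ≤ N → G.dist O (γ s) + s = n) (hl' : ∀ s, s ≤ N → G.dist O (γ' s) + s = n)
    (hγ : ∀ i j, i ≤ j → j ≤ N → G.dist (γ i) (γ j) + i = j)
    (hγ' : ∀ i j, i ≤ j → j ≤ N → G.dist (γ' i) (γ' j) + i = j)
    (hd : ∀ s, s ≤ N → G.dist (γ s) (γ' s) ≤ K) (j a : ℕ) (ha : a + 3 ^ j * Q ≤ N)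
    -- Call the distance minus `3 ^ j * Q` the excess of the diagonal. It is assumed to be at least
    -- `K + 1 - j`, while it never exceeds `K`; so each trisection that raises it uses up one unit
    -- of `j`.
    (hj : K + 1 + 3 ^ j * Q ≤ G.dist (γ a) (γ' (a + 3 ^ j * Q)) + j) :
    ∃ s, s ≤ a + 3 ^ j * Q ∧ G.dist (γ s) (γ' s) ≤ 10 := by
  have hG := hT.connected
  have upper : ∀ a l, a + l ≤ N → G.dist (γ a) (γ' (a + l)) ≤ K + l := by
    intro a l hl
    have h1 := hd a (by omega)
    have h2 := hγ' a (a + l) (by omega) hl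
    have h3 := hG.dist_triangle (u := γ a) (v := γ' a) (w := γ' (a + l))
    omega
  induction j generalizing a with
  | zero =>
    have := upper _ _ ha
    omega
  | succ j ih =>
    have hQ : Q ≤ 3 ^ j * Q := Nat.le_mul_of_pos_left _ (by positivity)
    have hp : 3 ^ (j + 1) * Q = 3 * (3 ^ j * Q) := by ring
    rw [hp] at ha hj ⊢
    clear hp
    generalize 3 ^ j * Q = l at ha hj hQ ih ⊢
    -- Either the diagonal of the first or last third has a larger excess, or both `γ (a + 2 * l)`
    -- and `γ' (a + l)` lie on geodesics from `γ a` to `γ' (a + 3 * l)`.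
    rcases Nat.lt_or_ge (G.dist (γ a) (γ' (a + 3 * l))) (G.dist (γ a) (γ' (a + l)) + 2 * l) with
      h1 | h1
    · obtain ⟨s, hs, hs'⟩ := ih a (by omega) (by omega)
      exact ⟨s, by omega, hs'⟩
    rcases Nat.lt_or_ge (G.dist (γ a) (γ' (a + 3 * l)))
      (G.dist (γ (a + 2 * l)) (γ' (a + 3 * l)) + 2 * l) with h2 | h2
    · have e : a + 2 * l + l = a + 3 * l := by omega
      obtain ⟨s, hs, hs'⟩ := ih (a + 2 * l) (by omega) (by rw [e]; omega)
      exact ⟨s, by omega, hs'⟩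
    refine ⟨a + 2 * l, by omega, ?_⟩
    have c1 := hl a (by omega)
    have c2 := hl' (a + 3 * l) (by omega)
    have c3 := hG.dist_triangle (u := O) (v := γ' (a + 3 * l)) (w := γ a)
    rw [dist_comm (u := γ' (a + 3 * l)) (v := γ a)] at c3
    have c4 := upper a l (by omega)
    obtain ⟨e, he⟩ : ∃ e, G.dist (γ a) (γ' (a + 3 * l)) = 3 * l + e :=
      ⟨G.dist (γ a) (γ' (a + 3 * l)) - 3 * l, by omega⟩
    have d1 := hγ a (a + 2 * l) (by omega) (by omega)
    have d2 := hG.dist_triangle (u := γ a) (v := γ (a + 2 * l)) (w := γ' (a + 3 * l))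
    have d3 := hγ' (a + l) (a + 3 * l) (by omega) (by omega)
    have d4 := hG.dist_triangle (u := γ a) (v := γ' (a + l)) (w := γ' (a + 3 * l))
    have d5 := hγ' (a + l) (a + 2 * l - e) (by omega) (by omega)
    have d6 := hγ' (a + 2 * l - e) (a + 3 * l) (by omega) (by omega)
    have d7 := hG.dist_triangle (u := γ a) (v := γ' (a + l)) (w := γ' (a + 2 * l - e))
    have d8 := hG.dist_triangle (u := γ a) (v := γ' (a + 2 * l - e)) (w := γ' (a + 3 * l))
    -- Both points are at distance `2 * l` from `γ a`, so the bigon based there puts them within 5.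
    -- Comparing levels over `O` gives `e ≤ 5`, whence the total of 10.
    have d9 : G.dist (γ (a + 2 * l)) (γ' (a + 2 * l - e)) ≤ 5 := by
      refine hT.dist_le (γ a) (γ' (a + 3 * l)) (γ' (a + 3 * l)) _ _ (Near.refl _) rfl ?_ ?_ ?_
      · unfold Between
        omega
      · unfold Between
        omega
      · omega
    have f1 := hl (a + 2 * l) (by omega)
    have f2 := hl' (a + 2 * l - e) (by omega)
    have f3 := hG.dist_triangle (u := O) (v := γ (a + 2 * l)) (w := γ' (a + 2 * l - e))
    have f4 := hγ' (a + 2 * l - e) (a + 2 * l) (by omega) (by omega)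
    have f5 := hG.dist_triangle (u := γ (a + 2 * l)) (v := γ' (a + 2 * l - e))
      (w := γ' (a + 2 * l))
    omega

/-- Starting at distance at most 120, the geodesics stay within `605 = 5 * 120 + 5`. The initial
excess is nonnegative, so `606 = 605 + 1` trisections suffice; from distance 10 onwards the bound is
`5 * 10 + 5 ≤ 60`. -/
theorem contracts : G.Contracts (3 ^ 606 * 605) := by
  have hG := hT.connected
  intro O x x' t t' hx hxx hb hb' ht hM
  obtain ⟨γ, h0, hN, hγ⟩ := hG.exists_geodesic x t
  obtain ⟨γ', h0', hN', hγ'⟩ := hG.exists_geodesic x' t'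
  rw [dist_comm (u := x) (v := t)] at hN hγ
  rw [dist_comm (u := x') (v := t')] at hN' hγ'
  have hN'' : G.dist t' x' = G.dist t x := by unfold Between at *; omega
  rw [hN''] at hN' hγ'
  generalize hMM : 3 ^ 606 * 605 = M at hM
  have hl : ∀ s, s ≤ G.dist t x → G.dist O (γ s) + s = G.dist O x := by
    intro s hs
    have h1 := hγ 0 s (by omega) hs
    have h2 := hγ s _ hs le_rfl
    rw [h0] at h1
    rw [hN] at h2
    have h3 := hG.dist_triangle (u := O) (v := t) (w := γ s)
    have h4 := hG.dist_triangle (u := O) (v := γ s) (w := x)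
    rw [dist_comm (u := γ s) (v := x)] at h4
    rw [dist_comm (u := t) (v := γ s)] at h3
    unfold Between at *
    omega
  have hl' : ∀ s, s ≤ G.dist t x → G.dist O (γ' s) + s = G.dist O x := by
    intro s hs
    have h1 := hγ' 0 s (by omega) hs
    have h2 := hγ' s _ hs le_rfl
    rw [h0'] at h1
    rw [hN'] at h2
    have h3 := hG.dist_triangle (u := O) (v := t') (w := γ' s)
    have h4 := hG.dist_triangle (u := O) (v := γ' s) (w := x')
    rw [dist_comm (u := γ' s) (v := x')] at h4
    rw [dist_comm (u := t') (v := γ' s)] at h3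
    unfold Between at *
    omega
  have hbs : ∀ s, s ≤ G.dist t x → G.Between O x (γ s) := by
    intro s hs
    have h1 := hγ 0 s (by omega) hs
    rw [h0, dist_comm] at h1
    have h2 := hl s hs
    unfold Between
    omega
  have hbs' : ∀ s, s ≤ G.dist t x → G.Between O x' (γ' s) := by
    intro s hs
    have h1 := hγ' 0 s (by omega) hs
    rw [h0', dist_comm] at h1
    have h2 := hl' s hs
    unfold Between
    omega
  have hd : ∀ s, s ≤ G.dist t x → G.dist (γ s) (γ' s) ≤ 605 := by
    intro s hs
    have h1 := hl s hs
    have h2 := hl' s hs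
    exact hT.dist_le_of_dist_le hx hxx (hbs s hs) (hbs' s hs) (by omega)
  have hMle : M ≤ G.dist t x := by unfold Between at *; omega
  obtain ⟨s, hs, hs'⟩ := hT.exists_dist_le_ten (K := 605) (Q := 605) le_rfl hl hl' hγ hγ' hd 606 0
    (by rw [hMM]; omega) (by
      rw [hMM, Nat.zero_add]
      have h1 := hl 0 (by omega)
      have h2 := hl' M (by omega)
      have h3 := hG.dist_triangle (u := O) (v := γ' M) (w := γ 0)
      rw [dist_comm (u := γ' M) (v := γ 0)] at h3
      omega)
  rw [hMM] at hs
  have e1 := hl s (by omega)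
  have e2 := hl' s (by omega)
  have g1 := hγ s _ (show s ≤ G.dist t x by omega) le_rfl
  have g2 := hγ' s _ (show s ≤ G.dist t x by omega) le_rfl
  rw [hN, dist_comm] at g1
  rw [hN', dist_comm] at g2
  have := hT.dist_le_of_dist_le (O := O) (t := t) (t' := t') (by omega) hs'
    (by unfold Between at *; omega) (by unfold Between at *; omega) ht
  omega

end IsThin

end SimpleGraph

/-! ### Exponential divergence and the Gromov product. -/

namespace SimpleGraph

variable {V : Type*} {G : SimpleGraph V}

namespace IsThin

variable (hT : G.IsThin) {M : ℕ} (hM : G.Contracts M)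
include hT hM

/-- Contraction for vertices at different distances from `O`, joined through a third vertex. -/
theorem dist_le_of_triple {O a b c t t' : V} (hb : G.Between O a t) (hb' : G.Between O c t')
    (ht : G.dist O t = G.dist O t') (ha : G.dist O t + M ≤ G.dist O a)
    (hbm : G.dist O t + M ≤ G.dist O b) (hc : G.dist O t + M ≤ G.dist O c)
    (hab : ∀ u w, G.Between O a u → G.Between O b w → G.dist O u = G.dist O t + M →
      G.dist O u = G.dist O w → G.dist u w ≤ 60)
    (hbc : ∀ w u, G.Between O b w → G.Between O c u → G.dist O w = G.dist O t + M →
      G.dist O w = G.dist O u → G.dist w u ≤ 60) :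
    G.dist t t' ≤ 60 := by
  have hG := hT.connected
  obtain ⟨u, hu, hau, hut⟩ := hb.exists_between hG (l := G.dist O t + M) (by omega) ha
  obtain ⟨u', hu', hcu, hut'⟩ := hb'.exists_between hG (l := G.dist O t + M) (by omega) hc
  obtain ⟨w, hw, hbw⟩ := hG.exists_between O b hbm
  have h1 := hab u w hau hbw hu (by omega)
  have h2 := hbc w u' hbw hcu hw (by omega)
  have h3 := hG.dist_triangle (u := u) (v := w) (w := u')
  exact hM O u u' t t' (by omega) (by omega) hut hut' ht (by omega)

/-- The ends of a path of length at most `2 ^ k` far from `O` have close geodesics to `O`, `M * k`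
steps below the path. -/
theorem dist_le_of_pow {O : V} {γ : ℕ → V} {h : ℕ} (k a N : ℕ) {t t' : V} (hN : N ≤ 2 ^ k)
    (hγ : ∀ i, a ≤ i → i < a + N → G.dist (γ i) (γ (i + 1)) ≤ 1)
    (hl : ∀ i, a ≤ i → i ≤ a + N → h ≤ G.dist O (γ i)) (hb : G.Between O (γ a) t)
    (hb' : G.Between O (γ (a + N)) t') (ht : G.dist O t = G.dist O t')
    (hth : G.dist O t + M * k ≤ h) : G.dist t t' ≤ 60 := by
  induction k generalizing a N t t' with
  | zero =>
    have : G.dist (γ a) (γ (a + N)) ≤ 1 := by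
      rcases Nat.eq_zero_or_pos N with rfl | hN0
      · simp
      · obtain rfl : N = 1 := by rw [pow_zero] at hN; omega
        exact hγ a le_rfl (by omega)
    have := hT.dist_le_of_step this hb hb' ht
    omega
  | succ k ih =>
    rw [pow_succ] at hN
    rw [Nat.mul_succ] at hth
    have e : a + N / 2 + (N - N / 2) = a + N := by omega
    -- The two halves give distance at most 60 + 60 = 120 at `M` levels above `t`, and contraction
    -- over these `M` levels restores 60.
    refine hT.dist_le_of_triple hM (b := γ (a + N / 2)) hb hb' ht ?_ ?_ ?_ ?_ ?_
    · have := hl a le_rfl (by omega)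
      omega
    · have := hl (a + N / 2) (by omega) (by omega)
      omega
    · have := hl (a + N) (by omega) (by omega)
      omega
    · intro u w hu hw h1 h2
      exact ih a (N / 2) (by omega) (fun i h1 h2 => hγ i h1 (by omega))
        (fun i h1 h2 => hl i h1 (by omega)) hu hw h2 (by omega)
    · intro w u hw hu h1 h2
      exact ih (a + N / 2) (N - N / 2) (by omega) (fun i h1 h2 => hγ i (by omega) (by omega))
        (fun i h1 h2 => hl i (by omega) (by omega)) hw (e.symm ▸ hu) h2 (by omega)

/-- A geodesic which starts at its point closest to `O` moves away from `O`. -/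
theorem add_le_dist {O : V} {γ : ℕ → V} {N : ℕ}
    (hγ : ∀ i j, i ≤ j → j ≤ N → G.dist (γ i) (γ j) + i = j)
    (hl : ∀ i, i ≤ N → G.dist O (γ 0) ≤ G.dist O (γ i)) {i k : ℕ} (hi : i ≤ N) (hik : i ≤ 2 ^ k) :
    G.dist O (γ 0) + i ≤ G.dist O (γ i) + 60 + 2 * (M * k) := by
  have hG := hT.connected
  have e := hγ 0 i (by omega) hi
  rcases Nat.lt_or_ge (G.dist O (γ 0)) (M * k) with h | h
  · have h1 := hG.dist_triangle (u := γ 0) (v := O) (w := γ i)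
    rw [dist_comm (u := γ 0) (v := O)] at h1
    omega
  -- At `M * k` levels below `γ 0` the geodesics to `O` are within 60. Going down, across and up
  -- bounds `i = d(γ 0, γ i)`, which is the estimate.
  · have hli := hl i hi
    obtain ⟨t, ht, hbt⟩ := hG.exists_between O (γ 0) (l := G.dist O (γ 0) - M * k) (by omega)
    obtain ⟨t', ht', hbt'⟩ := hG.exists_between O (γ i) (l := G.dist O (γ 0) - M * k) (by omega)
    have h1 := hT.dist_le_of_pow hM (O := O) (γ := γ) (h := G.dist O (γ 0)) k 0 i (t := t)
      (t' := t') hik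
      (fun j _ hj => by have := hγ j (j + 1) (by omega) (by omega); omega)
      (fun j _ hj => hl j (by omega)) hbt (by rwa [Nat.zero_add]) (by omega) (by omega)
    have h2 := hG.dist_triangle (u := γ 0) (v := t) (w := γ i)
    have h3 := hG.dist_triangle (u := t) (v := t') (w := γ i)
    rw [dist_comm (u := γ 0) (v := t)] at h2
    unfold Between at *
    omega

-- The summand `60 + 2 * (M * (j + 1))` is the loss in `add_le_dist` up to the index `2 ^ (j + 1)`;
-- the other two are the height above the closest point at which a dyadic piece must lie in
-- `dist_le_of_pow_le`.
omit hT hM in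
theorem exists_pow_bound (M : ℕ) :
    ∃ j₀, ∀ j, j₀ ≤ j → 60 + 2 * (M * (j + 1)) + M * (j + 1) + M * j ≤ 2 ^ j := by
  have sq : ∀ j, 4 ≤ j → j * j ≤ 2 ^ j := by
    intro j hj
    induction j, hj using Nat.le_induction with
    | base => norm_num
    | succ j hj ih =>
      rw [pow_succ]
      nlinarith
  refine ⟨7 * M + 64, fun j hj => le_trans ?_ (sq j (by omega))⟩
  nlinarith [Nat.zero_le (M * j)]

/-- The piece from `2 ^ j` to `2 ^ (j + 1)` is so high that `dist_le_of_pow` applies down to `M * (j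
+ 1)` levels above the closest point; induction treats the rest with `j + 1`. The admissible level
rises by `M` with each `j`, which is just what one contraction consumes. -/
theorem dist_le_of_pow_le {O : V} {γ : ℕ → V} {N j₀ : ℕ}
    (hj₀ : ∀ j, j₀ ≤ j → 60 + 2 * (M * (j + 1)) + M * (j + 1) + M * j ≤ 2 ^ j)
    (hγ : ∀ i j, i ≤ j → j ≤ N → G.dist (γ i) (γ j) + i = j)
    (hl : ∀ i, i ≤ N → G.dist O (γ 0) ≤ G.dist O (γ i)) (j : ℕ) {t t' : V} (hj : j₀ ≤ j)
    (hjN : 2 ^ j ≤ N) (hb : G.Between O (γ (2 ^ j)) t) (hb' : G.Between O (γ N) t')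
    (ht : G.dist O t = G.dist O t') (hth : G.dist O t ≤ G.dist O (γ 0) + M * j) :
    G.dist t t' ≤ 60 := by
  induction hm : N - 2 ^ j using Nat.strong_induction_on generalizing j t t' with
  | _ m ih =>
  subst hm
  have hbd := hj₀ j hj
  have hpow : 2 ^ (j + 1) = 2 ^ j + 2 ^ j := by rw [pow_succ]; omega
  have hpos : 0 < 2 ^ j := by positivity
  have level : ∀ i, 2 ^ j ≤ i → i ≤ 2 ^ (j + 1) → i ≤ N →
      G.dist O (γ 0) + M * (j + 1) + M * j ≤ G.dist O (γ i) := by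
    intro i h1 h2 h3
    have := hT.add_le_dist hM hγ hl h3 h2
    omega
  have hstep : ∀ i, i < N → G.dist (γ i) (γ (i + 1)) ≤ 1 := fun i hi => by
    have := hγ i (i + 1) (by omega) (by omega)
    omega
  have hMj : M * (j + 1) = M * j + M := Nat.mul_succ _ _
  rcases Nat.lt_or_ge N (2 ^ (j + 1)) with hlt | hge
  · have e : 2 ^ j + (N - 2 ^ j) = N := by omega
    exact hT.dist_le_of_pow hM (O := O) (γ := γ) (h := G.dist O (γ 0) + M * (j + 1) + M * j) j
      (2 ^ j) (N - 2 ^ j) (by omega) (fun i _ h => hstep i (by omega))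
      (fun i h h' => level i h (by omega) (by omega)) hb (e.symm ▸ hb') ht (by omega)
  · have lvN : G.dist O (γ 0) + M * (j + 1) ≤ G.dist O (γ N) := by
      obtain ⟨i, hi⟩ : ∃ i, N < 2 ^ i := ⟨N, Nat.lt_two_pow_self⟩
      have hex : ∃ i, N < 2 ^ (i + 1) :=
        ⟨i, hi.trans_le (Nat.pow_le_pow_right (by omega) (by omega))⟩
      classical
      have h1 := Nat.find_spec hex
      have h2 : j < Nat.find hex := by
        by_contra hcon
        have := Nat.pow_le_pow_right (show 0 < 2 by omega) (show Nat.find hex + 1 ≤ j + 1 by omega)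
        omega
      have h3 : 2 ^ Nat.find hex ≤ N := by
        have := Nat.find_min hex (m := Nat.find hex - 1) (by omega)
        rw [show Nat.find hex - 1 + 1 = Nat.find hex by omega] at this
        omega
      have h4 := hT.add_le_dist hM hγ hl le_rfl h1.le
      have h5 := hj₀ (Nat.find hex) (by omega)
      have h6 : M * (j + 1) ≤ M * (Nat.find hex + 1) := Nat.mul_le_mul_left _ (by omega)
      omega
    refine hT.dist_le_of_triple hM (b := γ (2 ^ (j + 1))) hb hb' ht ?_ ?_ ?_ ?_ ?_
    · have := level (2 ^ j) le_rfl (by omega) hjN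
      omega
    · have := level (2 ^ (j + 1)) (by omega) le_rfl hge
      omega
    · omega
    · intro u w hu hw h1 h2
      exact hT.dist_le_of_pow hM (O := O) (γ := γ) (h := G.dist O (γ 0) + M * (j + 1) + M * j) j
        (2 ^ j) (2 ^ j) le_rfl (fun i _ h => hstep i (by omega))
        (fun i h h' => level i h (by omega) (by omega)) hu (hpow ▸ hw) h2 (by omega)
    · intro w u hw hu h1 h2
      exact ih _ (by omega) (j + 1) (by omega) hge hw hu h2 (by omega) rfl

/-- Geodesics to `O` from the ends of a geodesic which starts at its point closest to `O` are close
below a level which depends only on this point. -/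
theorem dist_le_of_geodesic {O : V} {γ : ℕ → V} {N j₀ : ℕ}
    (hj₀ : ∀ j, j₀ ≤ j → 60 + 2 * (M * (j + 1)) + M * (j + 1) + M * j ≤ 2 ^ j)
    (hγ : ∀ i j, i ≤ j → j ≤ N → G.dist (γ i) (γ j) + i = j)
    (hl : ∀ i, i ≤ N → G.dist O (γ 0) ≤ G.dist O (γ i)) {t t' : V}
    (hb : G.Between O (γ 0) t) (hb' : G.Between O (γ N) t')
    (ht : G.dist O t = G.dist O t') (hth : G.dist O t + M * (j₀ + 1) ≤ G.dist O (γ 0)) :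
    G.dist t t' ≤ 60 := by
  have hMj : M * (j₀ + 1) = M * j₀ + M := Nat.mul_succ _ _
  have hstep : ∀ i, i < N → G.dist (γ i) (γ (i + 1)) ≤ 1 := fun i hi => by
    have := hγ i (i + 1) (by omega) (by omega)
    omega
  rcases Nat.lt_or_ge N (2 ^ j₀) with hlt | hge
  · exact hT.dist_le_of_pow hM (O := O) (γ := γ) (h := G.dist O (γ 0)) j₀ 0 N hlt.le
      (fun i _ h => hstep i (by omega)) (fun i _ h => hl i (by omega)) hb
      (by rwa [Nat.zero_add]) ht (by omega)
  · have h1 := hl (2 ^ j₀) hge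
    have h2 := hl N le_rfl
    refine hT.dist_le_of_triple hM (b := γ (2 ^ j₀)) hb hb' ht (by omega) (by omega) (by omega)
      ?_ ?_
    · intro u w hu hw h1 h2
      exact hT.dist_le_of_pow hM (O := O) (γ := γ) (h := G.dist O (γ 0)) j₀ 0 (2 ^ j₀) le_rfl
        (fun i _ h => hstep i (by omega)) (fun i _ h => hl i (by omega)) hu
        (by rwa [Nat.zero_add]) h2 (by omega)
    · intro w u hw hu h1 h2
      exact hT.dist_le_of_pow_le hM hj₀ hγ hl j₀ le_rfl hge hw hu h2 (by omega)

/-- Geodesics to `O` from `x` and `y` are close below the level of the Gromov product. -/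
theorem dist_le_of_gromovProduct {O x y t t' : V} {j₀ : ℕ}
    (hj₀ : ∀ j, j₀ ≤ j → 60 + 2 * (M * (j + 1)) + M * (j + 1) + M * j ≤ 2 ^ j)
    (hb : G.Between O x t) (hb' : G.Between O y t') (ht : G.dist O t = G.dist O t')
    (hth : 2 * (G.dist O t + M * (j₀ + 1)) + G.dist x y ≤ G.dist O x + G.dist O y) :
    G.dist t t' ≤ 120 := by
  have hG := hT.connected
  obtain ⟨γ, h0, hN, hγ⟩ := hG.exists_geodesic x y
  -- The geodesic is cut at a point closest to `O`; each half contributes 60.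
  obtain ⟨m, hm, hmin⟩ := Finset.exists_min_image (Finset.range (G.dist x y + 1))
    (fun i => G.dist O (γ i)) ⟨0, by simp⟩
  have hm' : m ≤ G.dist x y := by simpa [Nat.lt_succ_iff] using hm
  have hmin' : ∀ i, i ≤ G.dist x y → G.dist O (γ m) ≤ G.dist O (γ i) := fun i hi =>
    hmin i (by simpa [Nat.lt_succ_iff] using hi)
  have e1 := hγ 0 m (by omega) hm'
  have e2 := hγ m _ hm' le_rfl
  rw [h0, dist_comm] at e1
  rw [hN] at e2
  have h1 := hG.dist_triangle (u := O) (v := γ m) (w := x)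
  have h2 := hG.dist_triangle (u := O) (v := γ m) (w := y)
  obtain ⟨w, hw, hbw⟩ := hG.exists_between O (γ m) (l := G.dist O t) (by omega)
  have k1 := hT.dist_le_of_geodesic hM (O := O) (γ := fun i => γ (m + i)) (N := G.dist x y - m)
    (t := w) (t' := t') hj₀
    (fun i j hij hj => by have := hγ (m + i) (m + j) (by omega) (by omega); omega)
    (fun i hi => hmin' (m + i) (by omega)) hbw
    (by rw [show m + (G.dist x y - m) = G.dist x y by omega, hN]; exact hb') (by omega)
    (by simp only [Nat.add_zero]; omega)
  have k2 := hT.dist_le_of_geodesic hM (O := O) (γ := fun i => γ (m - i)) (N := m)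
    (t := w) (t' := t) hj₀
    (fun i j hij hj => by
      have := hγ (m - j) (m - i) (by omega) (by omega)
      rw [dist_comm] at this
      omega)
    (fun i hi => hmin' (m - i) (by omega)) hbw
    (by rw [Nat.sub_self, h0]; exact hb) (by omega)
    (by simp only [Nat.sub_zero]; omega)
  have k3 := hG.dist_triangle (u := t) (v := w) (w := t')
  rw [dist_comm (u := t) (v := w)] at k3
  omega

end IsThin

/-- Thin graphs are hyperbolic. -/
theorem exists_isGromovHyperbolic :
    ∃ δ : ℝ, 0 ≤ δ ∧ ∀ (V : Type*) (G : SimpleGraph V), G.IsThin →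
      IsGromovHyperbolic (fun v w => (G.dist v w : ℝ)) δ := by
  obtain ⟨M, hM⟩ : ∃ M, ∀ (V : Type _) (G : SimpleGraph V), G.IsThin → G.Contracts M :=
    ⟨_, fun _ _ h => h.contracts⟩
  obtain ⟨j₀, hj₀⟩ := IsThin.exists_pow_bound M
  obtain ⟨Q, hQ⟩ : ∃ Q, Q = M * (j₀ + 1) := ⟨_, rfl⟩
  -- Two bounds of 120 plus an allowance for halving `min A B` make 242, and the Gromov product
  -- halves it.
  refine ⟨(Q : ℝ) + 121, by positivity, fun V G hT O x y z => ?_⟩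
  have hG := hT.connected
  have hC : G.Contracts M := hM V G hT
  have tri : ∀ {a b c : V}, G.dist a c ≤ G.dist a b + G.dist b c := hG.dist_triangle
  set A := G.dist O x + G.dist O y - G.dist x y with hA
  set B := G.dist O y + G.dist O z - G.dist y z with hB
  have t1 : G.dist x y ≤ G.dist x O + G.dist O y := tri
  have t2 : G.dist y z ≤ G.dist y O + G.dist O z := tri
  have t3 : G.dist x z ≤ G.dist x O + G.dist O z := tri
  have t4 : G.dist O x ≤ G.dist O y + G.dist y x := tri
  have t5 : G.dist O y ≤ G.dist O x + G.dist x y := tri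
  have t6 : G.dist O z ≤ G.dist O y + G.dist y z := tri
  have t7 : G.dist O y ≤ G.dist O z + G.dist z y := tri
  rw [dist_comm (u := x) (v := O)] at t1 t3
  rw [dist_comm (u := y) (v := O)] at t2
  rw [dist_comm (u := y) (v := x)] at t4
  rw [dist_comm (u := z) (v := y)] at t7
  have key : min A B + G.dist x z ≤ G.dist O x + G.dist O z + 2 * Q + 242 := by
    rcases Nat.lt_or_ge (min A B) (2 * Q + 2) with hlt | hge
    · omega
    · obtain ⟨l, hl⟩ : ∃ l, l = min A B / 2 - Q := ⟨_, rfl⟩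
      obtain ⟨t, ht, hbt⟩ := hG.exists_between O x (l := l) (by omega)
      obtain ⟨s, hs, hbs⟩ := hG.exists_between O y (l := l) (by omega)
      obtain ⟨r, hr, hbr⟩ := hG.exists_between O z (l := l) (by omega)
      have h1 := hT.dist_le_of_gromovProduct hC hj₀ hbt hbs (by omega) (by rw [← hQ]; omega)
      have h2 := hT.dist_le_of_gromovProduct hC hj₀ hbs hbr (by omega) (by rw [← hQ]; omega)
      have t8 : G.dist t r ≤ G.dist t s + G.dist s r := tri
      have t9 : G.dist x z ≤ G.dist x t + G.dist t z := tri
      have t10 : G.dist t z ≤ G.dist t r + G.dist r z := tri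
      rw [dist_comm (u := x) (v := t)] at t9
      unfold Between at hbt hbs hbr
      omega
  have key' : (min A B : ℝ) + G.dist x z ≤ G.dist O x + G.dist O z + 2 * Q + 242 := by
    exact_mod_cast key
  have hA' : (A : ℝ) = G.dist O x + G.dist O y - G.dist x y := by
    rw [hA, Nat.cast_sub (by omega)]
    push_cast
    ring
  have hB' : (B : ℝ) = G.dist O y + G.dist O z - G.dist y z := by
    rw [hB, Nat.cast_sub (by omega)]
    push_cast
    ring
  simp only [gromovProduct]
  rw [dist_comm (u := x) (v := O), dist_comm (u := y) (v := O), dist_comm (u := z) (v := O),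
    ← hA', ← hB']
  have hmin : min ((A : ℝ) / 2) ((B : ℝ) / 2) = min (A : ℝ) B / 2 :=
    (min_div_div_right (by norm_num) _ _)
  rw [hmin]
  linarith

end SimpleGraph

/-! ### Application to complexes. -/

namespace AbstractSimplicialComplex

variable {V : Type*} {X : AbstractSimplicialComplex V}

theorem isLayered_oneSkeleton (hsc : X.IsSimplyConnected) (hloc : X.IsLocated 8) (O : V) :
    X.oneSkeleton.IsLayered (X.oneSkeleton.dist O) where
  coned := isConed_oneSkeleton hsc hloc
  lv_adj x y h := by
    have h1 := hsc.1.dist_triangle (u := O) (v := y) (w := x)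
    rwa [SimpleGraph.dist_eq_one_iff_adj.2 h.symm] at h1
  down x hx := by
    obtain ⟨u, hu, hb⟩ := hsc.1.exists_between O x (l := X.oneSkeleton.dist O x - 1) (by omega)
    unfold SimpleGraph.Between at hb
    exact ⟨u, (SimpleGraph.dist_eq_one_iff_adj.1 (by omega)).symm, by omega⟩
  edge := (edgeCond_and_vertCond hsc hloc O).1
  vert := (edgeCond_and_vertCond hsc hloc O).2

end AbstractSimplicialComplex

theorem theorem4p2 :
    ∃ δ : ℝ, 0 ≤ δ ∧ ∀ (V : Type*) (X : AbstractSimplicialComplex V),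
      X.IsSimplyConnected → X.IsLocated 8 → IsGromovHyperbolic X.vertexDist δ := by
  obtain ⟨δ, h0, h⟩ := SimpleGraph.exists_isGromovHyperbolic
  exact ⟨δ, h0, fun V X hsc hloc => h V X.oneSkeleton (SimpleGraph.isThin_of_isLayered hsc.1
    (AbstractSimplicialComplex.isLayered_oneSkeleton hsc hloc))⟩
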